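/- Let $\mathbb{k}$ be a field. Let $\mathbf{FA}$ be (a skeleton of) the category of finite sets and all maps, and let $\mathbf{FB},\mathbf{FI},\mathbf{FS}\subset\mathbf{FA}$ be the wide subcategories of bijections, injections and surjections; $\mathbb{k}\mathcal{C}$ is the $\mathbb{k}$-linearization of $\mathcal{C}$. Let $\mathbb{k}\mathbf{FI}^{[n]}$ be the $\mathbb{k}\mathbf{FB}$-bimodule of the $\mathbb{k}\mathbf{FI}(a,b)$ with $|b|=|a|+n$. *Filtration.* $G_n\mathbb{k}\mathbf{FA}\subset\mathbb{k}\mathbf{FA}$ is the image of $\bigoplus_{t\le n}\mathbb{k}\mathbf{FI}^{[t]}\otimes_{\mathbf{FB}}\mathbb{k}\mathbf{FS}$ under composition, so $G_0=\mathbb{k}\mathbf{FS}$; $\mathrm{gr}^G\mathbb{k}\mathbf{FA}$ is the associated graded category, over $\mathbb{k}\mathbf{FS}$. The right augmentation $\varepsilon:\mathbb{k}\mathbf{FA}\to\mathbb{k}\mathbf{FS}$, $[f]\mapsto[f]_{\mathbf{FS}}$, is the identity on surjections and sends $[f]$ to $0$ if $f$ is not surjective. It makes $\mathbb{k}\mathbf{FS}$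 a right $\mathbb{k}\mathbf{FI}$-module by $[p]\cdot[i]=[p\circ i]_{\mathbf{FS}}$. *Quadratic duals.* For a bimodule $V$ over a $\mathbb{k}$-linear category $C$ put $V^\vee=\mathrm{Hom}_{C^{op}}(V,C)$, the bimodule of right $C$-linear maps. For a graded category $B$ with $B_0=C$, $B^\perp=T_C(B_1^\vee)/\langle I^\perp\rangle$, where $I^\perp\subset B_1^\vee\otimes_C B_1^\vee$ consists of the elements whose functional $v\otimes w\mapsto\sum_j f_j(g_j(v)w)$ (for $\sum_j f_j\otimes g_j$) factors as $\psi\circ\mu$ with $\mu:B_1\otimes_C B_1\to B_2$ the product and $\psi\in B_2^\vee$. It is graded with $C$ in degree $0$ and $B_1^\vee$ in degree $1$. Thus $\mathbb{k}\mathbf{FI}^\perp$ is formed over $C=\mathbb{k}\mathbf{FB}$ with $B_n=\mathbb{k}\mathbf{FI}^{[n]}$, and $(\mathrm{gr}^G\mathbb{k}\mathbf{FA})^\perp$ over $C=\mathbb{k}\mathbf{FS}$ with $B_n=\mathrm{gr}^G_n\mathbb{k}\mathbf{FA}$. *Differential.* A differential of degree $1$ on $(\mathrm{gr}^G\mathbb{k}\mathbf{FA})^\perp$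 (with $d(xy)=(dx)y+(-1)^{|x|}x\,dy$, $d^2=0$) is called *dual to* $(\mathbb{k}\mathbf{FA},G,\varepsilon)$ if (i) for $r\in\mathbb{k}\mathbf{FS}$, $dr\in(\mathrm{gr}^G_1)^\vee$ is given by $(dr)([v])=\varepsilon(rv)$ for $v\in G_1\cap\ker\varepsilon$; and (ii) for $\varphi\in(\mathrm{gr}^G_1)^\vee$, $d\varphi=\sum_j f_jg_j$ with $f_j,g_j\in(\mathrm{gr}_1^G)^\vee$ such that $$\sum_i\sum_j f_j\bigl(g_j([v_i])\cdot[w_i]\bigr)=\sum_i\varepsilon\bigl(\varphi([v_i])\,w_i\bigr)-\varphi\Bigl(\bigl[\textstyle\sum_i v_iw_i\bigr]\Bigr)$$ for all finite families of composable $v_i,w_i\in G_1\cap\ker\varepsilon$ with $\sum_i v_iw_i\in G_1$. **Proposition.** $(\mathrm{gr}^G\mathbb{k}\mathbf{FA})^\perp$ is an $\mathbb{N}$-graded $\mathbb{k}$-linear category, and it has exactly one differential $d$ dual to $(\mathbb{k}\mathbf{FA},G,\varepsilon)$, so that it is a DG $\mathbb{k}$-linear category. There is a $\mathbb{k}$-linear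 functor $j:\mathbb{k}\mathbf{FI}^\perp\to(\mathrm{gr}^G\mathbb{k}\mathbf{FA})^\perp$, the identity on objects, that extends the inclusion $\mathbb{k}\mathbf{FB}\subset\mathbb{k}\mathbf{FS}$ and sends $\varphi\in(\mathbb{k}\mathbf{FI}^{[1]})^\vee$ to the element $\chi\in(\mathrm{gr}^G_1)^\vee$ with $\chi([i])=\varphi(i)$ for $i\in\mathbb{k}\mathbf{FI}^{[1]}$, and such that $$\Phi:\mathbb{k}\mathbf{FS}\otimes_{\mathbf{FB}}\mathbb{k}\mathbf{FI}^\perp\longrightarrow(\mathrm{gr}^G\mathbb{k}\mathbf{FA})^\perp,\qquad s\otimes\rho\mapsto s\,j(\rho),$$ is an isomorphism of $\mathbb{k}\mathbf{FB}$-bimodules that carries the grading induced by that of $\mathbb{k}\mathbf{FI}^\perp$ to the cohomological grading. Under $\Phi$ the differential $d$ is the differential of the Koszul complex of the right $\mathbb{k}\mathbf{FI}$-module $\mathbb{k}\mathbf{FS}$: $$s\otimes\rho\longmapsto\sum_j (s\cdot v_j)\otimes\varphi_j\rho\qquad(s\in\mathbb{k}\mathbf{FS}(d,e),\ \rho\in\mathbb{k}\mathbf{FI}^\perp(a,d)),$$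 where $\sum_j v_j\otimes\varphi_j\in\mathbb{k}\mathbf{FI}^{[1]}\otimes_{\mathbf{FB}}(\mathbb{k}\mathbf{FI}^{[1]})^\vee$ is the canonical element at $d$, i.e. $\sum_j v_j\,\varphi_j(w)=w$ for all $w\in\mathbb{k}\mathbf{FI}^{[1]}(-,d)$; such $v_j,\varphi_j$ exist for every $d$, and the formula does not depend on their choice. -/

import Mathlib

open CategoryTheory
open scoped TensorProduct DirectSum

noncomputable section

namespace FinKoszul

universe u

/-! ## Bimodules over `k`-linear categories -/

section Bimodules

/-- A `D`-`C`-bimodule: a family of `k`-modules `X a b` (`a` in `C`, `b` in `D`) with a right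
action of `C` (contravariant in `a`) and a commuting left action of `D` (covariant in `b`), both
`k`-bilinear. -/
structure Bimod (k : Type u) [CommRing k] (C D : Type)
    [Category.{u} C] [Preadditive C] [Linear k C]
    [Category.{u} D] [Preadditive D] [Linear k D] where
  /-- the underlying modules -/
  X : C → D → Type u
  [grp : ∀ a b, AddCommGroup (X a b)]
  [mod : ∀ a b, Module k (X a b)]
  /-- the right action `v ↦ v · f` -/
  ract : ∀ {a a' : C} (b : D), (a' ⟶ a) →ₗ[k] X a b →ₗ[k] X a' b
  /-- the left action `v ↦ g · v` -/
  lact : ∀ (a : C) {b b' : D}, (b ⟶ b') →ₗ[k] X a b →ₗ[k] X a b'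
  ract_id : ∀ (a : C) (b : D) (v : X a b), ract b (𝟙 a) v = v
  ract_comp : ∀ {a a' a'' : C} (b : D) (f' : a'' ⟶ a') (f : a' ⟶ a) (v : X a b),
    ract b (f' ≫ f) v = ract b f' (ract b f v)
  lact_id : ∀ (a : C) (b : D) (v : X a b), lact a (𝟙 b) v = v
  lact_comp : ∀ (a : C) {b b' b'' : D} (g : b ⟶ b') (g' : b' ⟶ b'') (v : X a b),
    lact a (g ≫ g') v = lact a g' (lact a g v)
  lact_ract : ∀ {a a' : C} {b b' : D} (f : a' ⟶ a) (g : b ⟶ b') (v : X a b),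
    lact a' g (ract b f v) = ract b' f (lact a g v)

attribute [instance] Bimod.grp Bimod.mod

variable {k : Type u} [CommRing k]
variable {C D E : Type}
  [Category.{u} C] [Preadditive C] [Linear k C]
  [Category.{u} D] [Preadditive D] [Linear k D]
  [Category.{u} E] [Preadditive E] [Linear k E]
variable {C' D' : Type}
  [Category.{u} C'] [Preadditive C'] [Linear k C']
  [Category.{u} D'] [Preadditive D'] [Linear k D']

namespace Bimod

variable (k C) in
/-- A `k`-linear category as a bimodule over itself. -/
def regular : Bimod k C C where
  X a b := a ⟶ b
  ract b := LinearMap.mk₂ k (fun f v => f ≫ v) (by simp) (by simp) (by simp) (by simp)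
  lact a := LinearMap.mk₂ k (fun g v => v ≫ g) (by simp) (by simp) (by simp) (by simp)
  ract_id := by simp
  ract_comp := by simp
  lact_id := by simp
  lact_comp := by simp
  lact_ract := by simp

/-- Restriction of a bimodule along `k`-linear functors. -/
def restrict (M : Bimod k C D) (F : C' ⥤ C) [F.Additive] [F.Linear k]
    (G : D' ⥤ D) [G.Additive] [G.Linear k] : Bimod k C' D' where
  X a b := M.X (F.obj a) (G.obj b)
  ract b := M.ract (G.obj b) ∘ₗ F.mapLinearMap k
  lact a := M.lact (F.obj a) ∘ₗ G.mapLinearMap k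
  ract_id := by simp [M.ract_id]
  ract_comp := by simp [M.ract_comp]
  lact_id := by simp [M.lact_id]
  lact_comp := by simp [M.lact_comp]
  lact_ract := by simp [M.lact_ract]

/-- A family of submodules stable under both actions, as a bimodule. -/
def sub (M : Bimod k C D) (N : ∀ a b, Submodule k (M.X a b))
    (hr : ∀ {a a' : C} (b : D) (f : a' ⟶ a) (v : M.X a b), v ∈ N a b → M.ract b f v ∈ N a' b)
    (hl : ∀ (a : C) {b b' : D} (g : b ⟶ b') (v : M.X a b), v ∈ N a b → M.lact a g v ∈ N a b') :
    Bimod k C D where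
  X a b := N a b
  ract {a a'} b := LinearMap.mk₂ k (fun f v => ⟨M.ract b f v.1, hr b f v.1 v.2⟩)
    (by intros; ext; simp) (by intros; ext; simp) (by intros; ext; simp) (by intros; ext; simp)
  lact a {b b'} := LinearMap.mk₂ k (fun g v => ⟨M.lact a g v.1, hl a g v.1 v.2⟩)
    (by intros; ext; simp) (by intros; ext; simp) (by intros; ext; simp) (by intros; ext; simp)
  ract_id := by intros; ext; simp [M.ract_id]
  ract_comp := by intros; ext; simp [M.ract_comp]
  lact_id := by intros; ext; simp [M.lact_id]
  lact_comp := by intros; ext; simp [M.lact_comp]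
  lact_ract := by intros; ext; simp [M.lact_ract]

/-- The quotient of a bimodule by a family of submodules stable under both actions. -/
def quot (M : Bimod k C D) (N : ∀ a b, Submodule k (M.X a b))
    (hr : ∀ {a a' : C} (b : D) (f : a' ⟶ a) (v : M.X a b), v ∈ N a b → M.ract b f v ∈ N a' b)
    (hl : ∀ (a : C) {b b' : D} (g : b ⟶ b') (v : M.X a b), v ∈ N a b → M.lact a g v ∈ N a b') :
    Bimod k C D where
  X a b := M.X a b ⧸ N a b
  ract {a a'} b :=
    { toFun := fun f => (N a b).mapQ (N a' b) (M.ract b f) (fun v hv => hr b f v hv)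
      map_add' := by intros; ext; simp
      map_smul' := by intros; ext; simp }
  lact a {b b'} :=
    { toFun := fun g => (N a b).mapQ (N a b') (M.lact a g) (fun v hv => hl a g v hv)
      map_add' := by intros; ext; simp
      map_smul' := by intros; ext; simp }
  ract_id a b v := by
    obtain ⟨v, rfl⟩ := Submodule.Quotient.mk_surjective _ v; simp [M.ract_id]
  ract_comp b f' f v := by
    obtain ⟨v, rfl⟩ := Submodule.Quotient.mk_surjective _ v; simp [M.ract_comp]
  lact_id a b v := by
    obtain ⟨v, rfl⟩ := Submodule.Quotient.mk_surjective _ v; simp [M.lact_id]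
  lact_comp a _ _ _ g g' v := by
    obtain ⟨v, rfl⟩ := Submodule.Quotient.mk_surjective _ v; simp [M.lact_comp]
  lact_ract f g v := by
    obtain ⟨v, rfl⟩ := Submodule.Quotient.mk_surjective _ v; simp [M.lact_ract]

/-- The right dual `V^∨ = Hom_{Cᵒᵖ}(V, C)`: an element of `V^∨(b, c)` is a family of `k`-linear
maps `V(a, b) → C(a, c)` compatible with the right actions of `C`. -/
def rightDualSubmodule (V : Bimod k C D) (b : D) (c : C) :
    Submodule k (∀ a : C, V.X a b →ₗ[k] (a ⟶ c)) where
  carrier := {φ | ∀ {a a' : C} (f : a' ⟶ a) (v : V.X a b), φ a' (V.ract b f v) = f ≫ φ a v}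
  add_mem' := by intro φ ψ hφ hψ a a' f v; simp [hφ f v, hψ f v]
  zero_mem' := by intro a a' f v; simp
  smul_mem' := by intro r φ hφ a a' f v; simp [hφ f v]

/-- The right dual, with the left action of `C` on the values and the right action of `D` induced
by the left action of `D` on `V`. -/
def rightDual (V : Bimod k C D) : Bimod k D C where
  X b c := V.rightDualSubmodule b c
  ract {b b'} c := LinearMap.mk₂ k
    (fun g φ => ⟨fun a => φ.1 a ∘ₗ V.lact a g, fun f v => by simp [V.lact_ract, φ.2 f]⟩)
    (by intros; ext; simp) (by intros; ext; simp) (by intros; ext; simp) (by intros; ext; simp)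
  lact b {c c'} := LinearMap.mk₂ k
    (fun h φ => ⟨fun a => Linear.rightComp k a h ∘ₗ φ.1 a, fun f v => by simp [φ.2 f]⟩)
    (by intros; ext; simp) (by intros; ext; simp) (by intros; ext; simp) (by intros; ext; simp)
  ract_id := by intros; ext; simp [V.lact_id]
  ract_comp := by intros; ext; simp [V.lact_comp]
  lact_id := by intros; ext; simp
  lact_comp := by intros; ext; simp
  lact_ract := by intros; ext; simp

/-- The value `φ(v)` of an element of the right dual. -/
def ev {V : Bimod k C D} {b : D} {c : C} {a : C} :
    V.rightDual.X b c →ₗ[k] V.X a b →ₗ[k] (a ⟶ c) where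
  toFun φ := φ.1 a
  map_add' _ _ := rfl
  map_smul' _ _ := rfl

/-- The relations defining the tensor product over `D`: the submodule generated by the
differences `(m · r) ⊗ n - m ⊗ (r · n)`. -/
def tensorRel (M : Bimod k D E) (N : Bimod k C D) (a : C) (e : E) :
    Submodule k (⨁ d : D, M.X d e ⊗[k] N.X a d) :=
  letI := Classical.decEq D
  Submodule.span k {t | ∃ (d d' : D) (r : d ⟶ d') (m : M.X d' e) (n : N.X a d),
    t = DirectSum.lof k D (fun d => M.X d e ⊗[k] N.X a d) d (M.ract e r m ⊗ₜ n) -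
      DirectSum.lof k D (fun d => M.X d e ⊗[k] N.X a d) d' (m ⊗ₜ N.lact a r n)}

/-- The components of the tensor product `M ⊗_D N`. -/
def TensorX (M : Bimod k D E) (N : Bimod k C D) (a : C) (e : E) : Type u :=
  (⨁ d : D, M.X d e ⊗[k] N.X a d) ⧸ tensorRel M N a e

instance (M : Bimod k D E) (N : Bimod k C D) (a : C) (e : E) : AddCommGroup (TensorX M N a e) :=
  inferInstanceAs (AddCommGroup ((⨁ d : D, M.X d e ⊗[k] N.X a d) ⧸ tensorRel M N a e))

instance (M : Bimod k D E) (N : Bimod k C D) (a : C) (e : E) : Module k (TensorX M N a e) :=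
  inferInstanceAs (Module k ((⨁ d : D, M.X d e ⊗[k] N.X a d) ⧸ tensorRel M N a e))

/-- The quotient map onto the components of the tensor product. -/
def tensorMk (M : Bimod k D E) (N : Bimod k C D) (a : C) (e : E) :
    (⨁ d : D, M.X d e ⊗[k] N.X a d) →ₗ[k] TensorX M N a e :=
  (tensorRel M N a e).mkQ

/-- The class of `m ⊗ n` in `M ⊗_D N`. -/
def tmul (M : Bimod k D E) (N : Bimod k C D) {a : C} {d : D} {e : E} :
    M.X d e →ₗ[k] N.X a d →ₗ[k] TensorX M N a e :=
  letI := Classical.decEq D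
  (TensorProduct.mk k (M.X d e) (N.X a d)).compr₂
    (tensorMk M N a e ∘ₗ DirectSum.lof k D (fun d => M.X d e ⊗[k] N.X a d) d)

theorem tmul_balanced (M : Bimod k D E) (N : Bimod k C D) {a : C} {d d' : D} {e : E}
    (r : d ⟶ d') (m : M.X d' e) (n : N.X a d) :
    tmul M N (M.ract e r m) n = tmul M N m (N.lact a r n) := by
  refine (Submodule.Quotient.eq _).2 (Submodule.subset_span ?_)
  exact ⟨d, d', r, m, n, rfl⟩

/-- The universal property of the tensor product. -/
def tlift (M : Bimod k D E) (N : Bimod k C D) {a : C} {e : E} {P : Type u} [AddCommGroup P]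
    [Module k P] (β : ∀ d : D, M.X d e →ₗ[k] N.X a d →ₗ[k] P)
    (hβ : ∀ (d d' : D) (r : d ⟶ d') (m : M.X d' e) (n : N.X a d),
      β d (M.ract e r m) n = β d' m (N.lact a r n)) :
    TensorX M N a e →ₗ[k] P :=
  letI := Classical.decEq D
  (tensorRel M N a e).liftQ (DirectSum.toModule k D P fun d => TensorProduct.lift (β d)) (by
    refine Submodule.span_le.2 ?_
    rintro _ ⟨d, d', r, m, n, rfl⟩
    simp [hβ d d' r m n])

@[simp]
theorem tlift_tmul (M : Bimod k D E) (N : Bimod k C D) {a : C} {e : E} {P : Type u}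
    [AddCommGroup P] [Module k P] (β : ∀ d : D, M.X d e →ₗ[k] N.X a d →ₗ[k] P)
    (hβ : ∀ (d d' : D) (r : d ⟶ d') (m : M.X d' e) (n : N.X a d),
      β d (M.ract e r m) n = β d' m (N.lact a r n)) {d : D} (m : M.X d e) (n : N.X a d) :
    tlift M N β hβ (tmul M N m n) = β d m n := by
  let := Classical.decEq D
  have : tlift M N β hβ (tmul M N m n) =
    DirectSum.toModule k D P (fun d => TensorProduct.lift (β d))
      (DirectSum.lof k D (fun d => M.X d e ⊗[k] N.X a d) d (m ⊗ₜ n)) := rfl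
  rw [this, DirectSum.toModule_lof, TensorProduct.lift.tmul]

theorem tensor_ext {M : Bimod k D E} {N : Bimod k C D} {a : C} {e : E} {P : Type u}
    [AddCommGroup P] [Module k P] {f g : TensorX M N a e →ₗ[k] P}
    (h : ∀ (d : D) (m : M.X d e) (n : N.X a d), f (tmul M N m n) = g (tmul M N m n)) : f = g := by
  let := Classical.decEq D
  have : f ∘ₗ tensorMk M N a e = g ∘ₗ tensorMk M N a e :=
    DirectSum.linearMap_ext _ fun d => TensorProduct.ext' (h d)
  ext x
  obtain ⟨x, rfl⟩ := Submodule.Quotient.mk_surjective _ x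
  exact LinearMap.congr_fun this x

/-- The right action on the tensor product. -/
def tensorRact (M : Bimod k D E) (N : Bimod k C D) {a a' : C} (e : E) (f : a' ⟶ a) :
    TensorX M N a e →ₗ[k] TensorX M N a' e :=
  tlift M N (fun d => (tmul M N).compl₂ (N.ract d f))
    (fun _ _ r m n => by simp [tmul_balanced, N.lact_ract])

/-- The left action on the tensor product. -/
def tensorLact (M : Bimod k D E) (N : Bimod k C D) (a : C) {e e' : E} (g : e ⟶ e') :
    TensorX M N a e →ₗ[k] TensorX M N a e' :=
  tlift M N (fun d => (tmul M N) ∘ₗ (M.lact d g))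
    (fun _ _ r m n => by simp [← tmul_balanced, M.lact_ract])

@[simp]
theorem tensorRact_tmul (M : Bimod k D E) (N : Bimod k C D) {a a' : C} {d : D} {e : E}
    (f : a' ⟶ a) (m : M.X d e) (n : N.X a d) :
    tensorRact M N e f (tmul M N m n) = tmul M N m (N.ract d f n) :=
  tlift_tmul M N _ _ m n

@[simp]
theorem tensorLact_tmul (M : Bimod k D E) (N : Bimod k C D) {a : C} {d : D} {e e' : E}
    (g : e ⟶ e') (m : M.X d e) (n : N.X a d) :
    tensorLact M N a g (tmul M N m n) = tmul M N (M.lact d g m) n :=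
  tlift_tmul M N _ _ m n

/-- The tensor product `M ⊗_D N` of bimodules. -/
def tensor (M : Bimod k D E) (N : Bimod k C D) : Bimod k C E where
  X a e := TensorX M N a e
  ract {a a'} e :=
    { toFun := fun f => tensorRact M N e f
      map_add' := fun f g => tensor_ext fun d m n => by simp
      map_smul' := fun f g => tensor_ext fun d m n => by simp }
  lact a {e e'} :=
    { toFun := fun g => tensorLact M N a g
      map_add' := fun f g => tensor_ext fun d m n => by simp
      map_smul' := fun f g => tensor_ext fun d m n => by simp }
  ract_id a e v := by
    refine LinearMap.congr_fun (g := LinearMap.id) (tensor_ext fun d m n => ?_) v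
    simp [N.ract_id]
  ract_comp {a a' a''} e f' f v := by
    refine LinearMap.congr_fun (f := tensorRact M N e (f' ≫ f))
      (g := tensorRact M N e f' ∘ₗ tensorRact M N e f) (tensor_ext fun d m n => ?_) v
    simp [N.ract_comp]
  lact_id a e v := by
    refine LinearMap.congr_fun (g := LinearMap.id) (tensor_ext fun d m n => ?_) v
    simp [M.lact_id]
  lact_comp a _ _ _ g g' v := by
    refine LinearMap.congr_fun (f := tensorLact M N a (g ≫ g'))
      (g := tensorLact M N a g' ∘ₗ tensorLact M N a g) (tensor_ext fun d m n => ?_) v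
    simp [M.lact_comp]
  lact_ract {a a' b b'} f g v := by
    refine LinearMap.congr_fun (f := tensorLact M N a' g ∘ₗ tensorRact M N b f)
      (g := tensorRact M N b' f ∘ₗ tensorLact M N a g) (tensor_ext fun d m n => ?_) v
    simp

/-- An isomorphism of bimodules. -/
structure Iso (M N : Bimod k C D) where
  /-- the components -/
  equiv : ∀ a b, M.X a b ≃ₗ[k] N.X a b
  map_ract : ∀ {a a' : C} (b : D) (f : a' ⟶ a) (v : M.X a b),
    equiv a' b (M.ract b f v) = N.ract b f (equiv a b v)
  map_lact : ∀ (a : C) {b b' : D} (g : b ⟶ b') (v : M.X a b),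
    equiv a b' (M.lact a g v) = N.lact a g (equiv a b v)

@[simp]
theorem ev_ract {V : Bimod k C D} {b b' : D} {c : C} (r : b' ⟶ b) (φ : V.rightDual.X b c) {a : C}
    (v : V.X a b') : ev (V.rightDual.ract c r φ) v = ev φ (V.lact a r v) := rfl

@[simp]
theorem ev_lact {V : Bimod k C D} {b : D} {c c' : C} (h : c ⟶ c') (φ : V.rightDual.X b c) {a : C}
    (v : V.X a b) : ev (V.rightDual.lact b h φ) v = ev φ v ≫ h := rfl

/-- The pairing `⟨φ ⊗ χ, v ⊗ w⟩ = φ(χ(v) · w)` between `V^∨ ⊗_C V^∨` and `V ⊗_C V`, which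
identifies `V^∨ ⊗_C V^∨` with `(V ⊗_C V)^∨` when `V` is finitely generated projective over
`Cᵒᵖ`. -/
def pairing (V : Bimod k C C) {a c x x' : C} (v : V.X x' a) (w : V.X x x') :
    TensorX V.rightDual V.rightDual a c →ₗ[k] (x ⟶ c) :=
  tlift V.rightDual V.rightDual
    (fun d => LinearMap.mk₂ k
      (fun (φ : V.rightDual.X d c) (χ : V.rightDual.X a d) => ev φ (V.lact x (ev χ v) w))
      (by simp) (by simp) (by simp) (by simp))
    (fun _ _ r φ χ => by simp [V.lact_comp])

/-- The relations `I^⊥` of the right quadratic dual, where `I` is the kernel of the product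
`μ : V ⊗_C V → B₂`: the elements of `V^∨ ⊗_C V^∨` that, as functionals on `V ⊗_C V`, factor as
`ψ ∘ μ` with `ψ` in `B₂^∨`. -/
def perp (V B₂ : Bimod k C C)
    (μ : ∀ {x x' a : C}, V.X x' a →ₗ[k] V.X x x' →ₗ[k] B₂.X x a) (a c : C) :
    Submodule k (TensorX V.rightDual V.rightDual a c) where
  carrier := {t | ∃ ψ : B₂.rightDual.X a c, ∀ (x x' : C) (v : V.X x' a) (w : V.X x x'),
    pairing V v w t = ev ψ (μ v w)}
  add_mem' := by
    rintro s t ⟨ψ, hψ⟩ ⟨ψ', hψ'⟩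
    exact ⟨ψ + ψ', fun x x' v w => by simp [hψ, hψ']⟩
  zero_mem' := ⟨0, fun x x' v w => by simp⟩
  smul_mem' := by
    rintro r t ⟨ψ, hψ⟩
    exact ⟨r • ψ, fun x x' v w => by simp [hψ]⟩

end Bimod

end Bimodules

/-! ## Quadratic `k`-linear categories -/

section Quadratic

variable {k : Type u} [CommRing k]
variable {C : Type} [Category.{u} C] [Preadditive C] [Linear k C]

/-- Formal expressions in the morphisms of `C` and the elements of `V`. -/
inductive PreQuad (V : Bimod k C C) : C → C → Type u
  | base {a b : C} (f : a ⟶ b) : PreQuad V a b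
  | gen {a b : C} (v : V.X a b) : PreQuad V a b
  | zero {a b : C} : PreQuad V a b
  | add {a b : C} (x y : PreQuad V a b) : PreQuad V a b
  | smul {a b : C} (r : k) (x : PreQuad V a b) : PreQuad V a b
  | comp {a b c : C} (x : PreQuad V a b) (y : PreQuad V b c) : PreQuad V a c

/-- The relations that present `T_C(V) / ⟨I⟩`: the laws of a `k`-linear category, the requirements
that `base` is a `k`-linear functor on `C` and `gen` a map of `C`-bimodules on `V`, and the
vanishing of the elements of `I ⊆ V ⊗_C V`. -/
inductive QuadRel (V : Bimod k C C) (I : ∀ a c : C, Submodule k (Bimod.TensorX V V a c)) :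
    ∀ {a b : C}, PreQuad V a b → PreQuad V a b → Prop
  | add_left {a b : C} {x x' : PreQuad V a b} (y : PreQuad V a b) :
      QuadRel V I x x' → QuadRel V I (.add x y) (.add x' y)
  | add_right {a b : C} (x : PreQuad V a b) {y y' : PreQuad V a b} :
      QuadRel V I y y' → QuadRel V I (.add x y) (.add x y')
  | smul_right {a b : C} (r : k) {x x' : PreQuad V a b} :
      QuadRel V I x x' → QuadRel V I (.smul r x) (.smul r x')
  | comp_left {a b c : C} {x x' : PreQuad V a b} (y : PreQuad V b c) :
      QuadRel V I x x' → QuadRel V I (.comp x y) (.comp x' y)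
  | comp_right {a b c : C} (x : PreQuad V a b) {y y' : PreQuad V b c} :
      QuadRel V I y y' → QuadRel V I (.comp x y) (.comp x y')
  | add_assoc {a b : C} (x y z : PreQuad V a b) :
      QuadRel V I (.add (.add x y) z) (.add x (.add y z))
  | add_comm {a b : C} (x y : PreQuad V a b) : QuadRel V I (.add x y) (.add y x)
  | zero_add {a b : C} (x : PreQuad V a b) : QuadRel V I (.add .zero x) x
  | neg_add {a b : C} (x : PreQuad V a b) : QuadRel V I (.add (.smul (-1) x) x) .zero
  | smul_add {a b : C} (r : k) (x y : PreQuad V a b) :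
      QuadRel V I (.smul r (.add x y)) (.add (.smul r x) (.smul r y))
  | add_smul {a b : C} (r s : k) (x : PreQuad V a b) :
      QuadRel V I (.smul (r + s) x) (.add (.smul r x) (.smul s x))
  | mul_smul {a b : C} (r s : k) (x : PreQuad V a b) :
      QuadRel V I (.smul (r * s) x) (.smul r (.smul s x))
  | one_smul {a b : C} (x : PreQuad V a b) : QuadRel V I (.smul 1 x) x
  | add_comp {a b c : C} (x x' : PreQuad V a b) (y : PreQuad V b c) :
      QuadRel V I (.comp (.add x x') y) (.add (.comp x y) (.comp x' y))
  | comp_add {a b c : C} (x : PreQuad V a b) (y y' : PreQuad V b c) :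
      QuadRel V I (.comp x (.add y y')) (.add (.comp x y) (.comp x y'))
  | smul_comp {a b c : C} (r : k) (x : PreQuad V a b) (y : PreQuad V b c) :
      QuadRel V I (.comp (.smul r x) y) (.smul r (.comp x y))
  | comp_smul {a b c : C} (r : k) (x : PreQuad V a b) (y : PreQuad V b c) :
      QuadRel V I (.comp x (.smul r y)) (.smul r (.comp x y))
  | assoc {a b c d : C} (x : PreQuad V a b) (y : PreQuad V b c) (z : PreQuad V c d) :
      QuadRel V I (.comp (.comp x y) z) (.comp x (.comp y z))
  | id_comp {a b : C} (x : PreQuad V a b) : QuadRel V I (.comp (.base (𝟙 a)) x) x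
  | comp_id {a b : C} (x : PreQuad V a b) : QuadRel V I (.comp x (.base (𝟙 b))) x
  | base_add {a b : C} (f g : a ⟶ b) : QuadRel V I (.base (f + g)) (.add (.base f) (.base g))
  | base_smul {a b : C} (r : k) (f : a ⟶ b) : QuadRel V I (.base (r • f)) (.smul r (.base f))
  | base_comp {a b c : C} (f : a ⟶ b) (g : b ⟶ c) :
      QuadRel V I (.base (f ≫ g)) (.comp (.base f) (.base g))
  | gen_add {a b : C} (v w : V.X a b) : QuadRel V I (.gen (v + w)) (.add (.gen v) (.gen w))
  | gen_smul {a b : C} (r : k) (v : V.X a b) : QuadRel V I (.gen (r • v)) (.smul r (.gen v))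
  | gen_ract {a a' b : C} (f : a' ⟶ a) (v : V.X a b) :
      QuadRel V I (.gen (V.ract b f v)) (.comp (.base f) (.gen v))
  | gen_lact {a b b' : C} (g : b ⟶ b') (v : V.X a b) :
      QuadRel V I (.gen (V.lact a g v)) (.comp (.gen v) (.base g))
  | quad {a c : C} (l : List (Σ d : C, V.X d c × V.X a d)) :
      (l.map fun p => Bimod.tmul V V p.2.1 p.2.2).sum ∈ I a c →
      QuadRel V I (l.foldr (fun p x => .add (.comp (.gen p.2.2) (.gen p.2.1)) x) .zero) .zero

/-- The quadratic `k`-linear category `T_C(V) / ⟨I⟩` over `C` with generating bimodule `V` and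
relations `I ⊆ V ⊗_C V`. It has the same objects as `C`. -/
structure QuadCat (V : Bimod k C C) (I : ∀ a c : C, Submodule k (Bimod.TensorX V V a c)) where
  /-- the underlying object of `C` -/
  obj : C

namespace QuadCat

variable {V : Bimod k C C} {I : ∀ a c : C, Submodule k (Bimod.TensorX V V a c)}

/-- The morphisms of `T_C(V) / ⟨I⟩`. -/
def HomType (V : Bimod k C C) (I : ∀ a c : C, Submodule k (Bimod.TensorX V V a c)) (a b : C) :
    Type u :=
  Quot (QuadRel V I (a := a) (b := b))

/-- The class of an expression. -/
def cls {a b : C} (x : PreQuad V a b) : HomType V I a b := Quot.mk _ x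

instance homAddCommGroup (a b : C) : AddCommGroup (HomType V I a b) :=
  letI : Zero (HomType V I a b) := ⟨cls .zero⟩
  letI : Add (HomType V I a b) :=
    ⟨Quot.map₂ .add (fun x _ _ h => .add_right x h) (fun _ _ y h => .add_left y h)⟩
  letI : Neg (HomType V I a b) := ⟨Quot.map (.smul (-1)) (fun _ _ h => .smul_right _ h)⟩
  { AddGroup.ofLeftAxioms
      (by rintro ⟨x⟩ ⟨y⟩ ⟨z⟩; exact Quot.sound (.add_assoc x y z))
      (by rintro ⟨x⟩; exact Quot.sound (.zero_add x))
      (by rintro ⟨x⟩; exact Quot.sound (.neg_add x)) with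
    add_comm := by rintro ⟨x⟩ ⟨y⟩; exact Quot.sound (.add_comm x y) }

instance homModule (a b : C) : Module k (HomType V I a b) :=
  letI : SMul k (HomType V I a b) :=
    ⟨fun r => Quot.map (.smul r) (fun _ _ h => .smul_right _ h)⟩
  have sa : ∀ (r : k) (x y : HomType V I a b), r • (x + y) = r • x + r • y := by
    rintro r ⟨x⟩ ⟨y⟩; exact Quot.sound (.smul_add r x y)
  have as : ∀ (r s : k) (x : HomType V I a b), (r + s) • x = r • x + s • x := by
    rintro r s ⟨x⟩; exact Quot.sound (.add_smul r s x)
  { one_smul := by rintro ⟨x⟩; exact Quot.sound (.one_smul x)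
    mul_smul := by rintro r s ⟨x⟩; exact Quot.sound (.mul_smul r s x)
    smul_add := sa
    add_smul := as
    smul_zero := fun r => by simpa using (sa r 0 0)
    zero_smul := fun x => by simpa using (as 0 0 x) }

instance : Category.{u} (QuadCat V I) where
  Hom a b := HomType V I a.obj b.obj
  id a := cls (.base (𝟙 a.obj))
  comp x y := Quot.map₂ .comp (fun x _ _ h => .comp_right x h) (fun _ _ y h => .comp_left y h) x y
  id_comp := by rintro _ _ ⟨x⟩; exact Quot.sound (.id_comp x)
  comp_id := by rintro _ _ ⟨x⟩; exact Quot.sound (.comp_id x)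
  assoc := by rintro _ _ _ _ ⟨x⟩ ⟨y⟩ ⟨z⟩; exact Quot.sound (.assoc x y z)

instance : Preadditive (QuadCat V I) where
  homGroup a b := homAddCommGroup a.obj b.obj
  add_comp := by rintro _ _ _ ⟨x⟩ ⟨x'⟩ ⟨y⟩; exact Quot.sound (.add_comp x x' y)
  comp_add := by rintro _ _ _ ⟨x⟩ ⟨y⟩ ⟨y'⟩; exact Quot.sound (.comp_add x y y')

instance : Linear k (QuadCat V I) where
  homModule a b := homModule a.obj b.obj
  smul_comp := by rintro _ _ _ r ⟨x⟩ ⟨y⟩; exact Quot.sound (.smul_comp r x y)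
  comp_smul := by rintro _ _ _ ⟨x⟩ r ⟨y⟩; exact Quot.sound (.comp_smul r x y)

/-- The functor `C → T_C(V) / ⟨I⟩`. -/
def base (V : Bimod k C C) (I : ∀ a c : C, Submodule k (Bimod.TensorX V V a c)) :
    C ⥤ QuadCat V I where
  obj a := ⟨a⟩
  map f := cls (.base f)
  map_id _ := rfl
  map_comp f g := Quot.sound (.base_comp f g)

instance : (base V I).Additive where
  map_add {_ _ f g} := Quot.sound (.base_add f g)

instance : (base V I).Linear k where
  map_smul f r := Quot.sound (.base_smul r f)

/-- The `k`-linear map `V → T_C(V) / ⟨I⟩`. -/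
def gen (V : Bimod k C C) (I : ∀ a c : C, Submodule k (Bimod.TensorX V V a c)) {a b : C} :
    V.X a b →ₗ[k] ((base V I).obj a ⟶ (base V I).obj b) where
  toFun v := cls (.gen v)
  map_add' v w := Quot.sound (.gen_add v w)
  map_smul' r v := Quot.sound (.gen_smul r v)

/-- `IsMonomial n x`: the morphism `x` is a composite of morphisms of `C` and exactly `n`
elements of `V`. -/
inductive IsMonomial (V : Bimod k C C) (I : ∀ a c : C, Submodule k (Bimod.TensorX V V a c)) :
    ∀ {a b : QuadCat V I}, ℕ → (a ⟶ b) → Prop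
  | base {a b : C} (f : a ⟶ b) : IsMonomial V I 0 ((base V I).map f)
  | gen {a b : C} (v : V.X a b) : IsMonomial V I 1 (gen V I v)
  | comp {a b c : QuadCat V I} {m n : ℕ} {x : a ⟶ b} {y : b ⟶ c} :
      IsMonomial V I m x → IsMonomial V I n y → IsMonomial V I (m + n) (x ≫ y)

/-- The grading of `T_C(V) / ⟨I⟩` with `C` in degree `0` and `V` in degree `1`. -/
def degree (V : Bimod k C C) (I : ∀ a c : C, Submodule k (Bimod.TensorX V V a c)) (n : ℕ)
    (a b : QuadCat V I) : Submodule k (a ⟶ b) :=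
  Submodule.span k {x | IsMonomial V I n x}

end QuadCat

/-- The right quadratic dual over `C` of a graded category with degree `0` part `C`, degree `1`
part `V`, degree `2` part `B₂` and product `μ : V ⊗_C V → B₂`: it is `T_C(V^∨) / ⟨I^⊥⟩`. -/
abbrev RightQuadDual (V B₂ : Bimod k C C)
    (μ : ∀ {x x' a : C}, V.X x' a →ₗ[k] V.X x x' →ₗ[k] B₂.X x a) : Type :=
  QuadCat V.rightDual (V.perp B₂ μ)

end Quadratic

/-! ## Differential graded `k`-linear categories -/

section DG

variable {k : Type u} [CommRing k]
variable {C : Type} [Category.{u} C] [Preadditive C] [Linear k C]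

/-- A family of submodules that makes `C` an `ℕ`-graded `k`-linear category. -/
structure IsGrading (gr : ℕ → ∀ a b : C, Submodule k (a ⟶ b)) : Prop where
  isInternal : ∀ a b : C, DirectSum.IsInternal (fun n => gr n a b)
  id_mem : ∀ a : C, 𝟙 a ∈ gr 0 a a
  comp_mem : ∀ {a b c : C} {m n : ℕ} (f : a ⟶ b) (g : b ⟶ c),
    f ∈ gr m a b → g ∈ gr n b c → f ≫ g ∈ gr (m + n) a c

/-- A differential of cohomological degree `1` on a graded `k`-linear category. In the usual order
of composition the Leibniz rule is `d(g f) = (dg) f + (-1)^{|g|} g (df)`. -/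
structure IsDGDifferential (gr : ℕ → ∀ a b : C, Submodule k (a ⟶ b))
    (d : ∀ a b : C, (a ⟶ b) →ₗ[k] (a ⟶ b)) : Prop where
  degree : ∀ {a b : C} {n : ℕ} (f : a ⟶ b), f ∈ gr n a b → d a b f ∈ gr (n + 1) a b
  square : ∀ {a b : C} (f : a ⟶ b), d a b (d a b f) = 0
  leibniz : ∀ {a b c : C} {n : ℕ} (f : a ⟶ b) (g : b ⟶ c), g ∈ gr n b c →
    d a c (f ≫ g) = f ≫ d b c g + (-1 : k) ^ n • (d a b f ≫ g)

end DG

/-! ## Finite sets -/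

section FiniteSets

/-- Objects of the skeleton of the category of finite sets: `⟨n⟩` is the set with `n` elements. -/
structure FA where
  /-- the cardinality -/
  card : ℕ

/-- The category of finite sets and all maps. -/
instance : Category.{0} FA where
  Hom a b := Fin a.card → Fin b.card
  id _ := _root_.id
  comp f g := g ∘ f

/-- The injective maps. -/
def FA.isInj : MorphismProperty FA := fun _ _ f => Function.Injective f

/-- The surjective maps. -/
def FA.isSurj : MorphismProperty FA := fun _ _ f => Function.Surjective f

/-- The bijective maps. -/
def FA.isBij : MorphismProperty FA := fun _ _ f => Function.Bijective f

instance : FA.isInj.IsMultiplicative where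
  id_mem _ := Function.injective_id
  comp_mem _ _ hf hg := Function.Injective.comp hg hf

instance : FA.isSurj.IsMultiplicative where
  id_mem _ := Function.surjective_id
  comp_mem _ _ hf hg := Function.Surjective.comp hg hf

instance : FA.isBij.IsMultiplicative where
  id_mem _ := Function.bijective_id
  comp_mem _ _ hf hg := Function.Bijective.comp hg hf

/-- Finite sets and injections. -/
abbrev FI := WideSubcategory FA.isInj

/-- Finite sets and surjections. -/
abbrev FS := WideSubcategory FA.isSurj

/-- Finite sets and bijections. -/
abbrev FB := WideSubcategory FA.isBij

/-- The inclusion of bijections into injections. -/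
def bijToInj : FB ⥤ FI where
  obj a := ⟨a.obj⟩
  map f := ⟨f.hom, f.property.1⟩

/-- The inclusion of bijections into surjections. -/
def bijToSurj : FB ⥤ FS where
  obj a := ⟨a.obj⟩
  map f := ⟨f.hom, f.property.2⟩

end FiniteSets

/-! ## Linearizations -/

section Linearization

variable (k : Type u) [CommRing k]
variable {C D : Type} [Category.{0} C] [Category.{0} D]

/-- The basis of the morphisms of `k C` given by the morphisms of `C`. -/
def homBasis (a b : C) : Module.Basis (a ⟶ b) k (Free.of k a ⟶ Free.of k b) :=
  Module.Basis.ofRepr (LinearEquiv.refl k ((a ⟶ b) →₀ k))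

/-- The basis element `[f]`. -/
def arr {a b : C} (f : a ⟶ b) : Free.of k a ⟶ Free.of k b := homBasis k a b f

theorem arr_comp {a b c : C} (f : a ⟶ b) (g : b ⟶ c) : arr k f ≫ arr k g = arr k (f ≫ g) := by
  refine (Free.single_comp_single k C f g 1 1).trans ?_
  rw [one_mul]
  rfl

theorem arr_id (a : C) : arr k (𝟙 a) = 𝟙 (Free.of k a) := rfl

variable {k} in
theorem arr_induction {a b : C} {P : (Free.of k a ⟶ Free.of k b) → Prop}
    (x : Free.of k a ⟶ Free.of k b) (zero : P 0) (add : ∀ x y, P x → P y → P (x + y))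
    (smul : ∀ (r : k) x, P x → P (r • x)) (arr : ∀ f : a ⟶ b, P (arr k f)) : P x := by
  have hx : x ∈ Submodule.span k (Set.range (homBasis k a b)) := by simp
  induction hx using Submodule.span_induction with
  | mem x h => obtain ⟨f, rfl⟩ := h; exact arr f
  | zero => exact zero
  | add x y _ _ hx hy => exact add x y hx hy
  | smul r x _ hx => exact smul r x hx

/-- The `k`-linear extension of a family indexed by the morphisms of `C`. -/
def arrLift {M : Type u} [AddCommGroup M] [Module k M] {a b : C} (φ : (a ⟶ b) → M) :
    (Free.of k a ⟶ Free.of k b) →ₗ[k] M :=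
  (homBasis k a b).constr k φ

@[simp]
theorem arrLift_arr {M : Type u} [AddCommGroup M] [Module k M] {a b : C} (φ : (a ⟶ b) → M)
    (f : a ⟶ b) : arrLift k φ (arr k f) = φ f :=
  (homBasis k a b).constr_basis k φ f

/-- The action of a functor on linearized morphisms. -/
def linHom (F : C ⥤ D) (a b : C) :
    (Free.of k a ⟶ Free.of k b) →ₗ[k] (Free.of k (F.obj a) ⟶ Free.of k (F.obj b)) :=
  arrLift k (fun f => arr k (F.map f))

@[simp]
theorem linHom_arr (F : C ⥤ D) {a b : C} (f : a ⟶ b) :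
    linHom k F a b (arr k f) = arr k (F.map f) :=
  arrLift_arr k _ f

theorem linHom_id (F : C ⥤ D) (a : C) :
    linHom k F a a (𝟙 (Free.of k a)) = 𝟙 (Free.of k (F.obj a)) := by
  rw [← arr_id, linHom_arr, F.map_id, arr_id]

theorem linHom_comp (F : C ⥤ D) {a b c : C} (x : Free.of k a ⟶ Free.of k b)
    (y : Free.of k b ⟶ Free.of k c) :
    linHom k F a c (x ≫ y) = linHom k F a b x ≫ linHom k F b c y := by
  induction x using arr_induction with
  | zero => simp
  | add x x' h h' => simp only [Preadditive.add_comp, map_add, h, h']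
  | smul r x h => simp only [Linear.smul_comp, map_smul, h]
  | arr f =>
    induction y using arr_induction with
    | zero => simp
    | add y y' h h' => simp only [Preadditive.comp_add, map_add, h, h']
    | smul r y h => simp only [Linear.comp_smul, map_smul, h]
    | arr g => rw [arr_comp, linHom_arr, linHom_arr, linHom_arr, arr_comp, F.map_comp]

/-- The `k`-linear functor `k C ⥤ k D` induced by a functor `C ⥤ D`. -/
def linMap (F : C ⥤ D) : Free k C ⥤ Free k D where
  obj a := Free.of k (F.obj a)
  map {a b} := linHom k F a b
  map_id := linHom_id k F
  map_comp := linHom_comp k F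

instance (F : C ⥤ D) : (linMap k F).Additive where
  map_add {a b _ _} := (linHom k F a b).map_add _ _

instance (F : C ⥤ D) : (linMap k F).Linear k where
  map_smul {a b} x r := (linHom k F a b).map_smul r x

end Linearization

/-! ## The right augmented filtration of `k FA` -/

section Filtration

variable (k : Type u) [CommRing k]

/-- The inclusion of surjections into all maps. -/
abbrev surjToAll : FS ⥤ FA := wideSubcategoryInclusion FA.isSurj

/-- The inclusion of injections into all maps. -/
abbrev injToAll : FI ⥤ FA := wideSubcategoryInclusion FA.isInj

/-- The inclusion `k FS → k FA` on morphisms. -/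
def inclS (a b : FS) : (Free.of k a ⟶ Free.of k b) →ₗ[k] (Free.of k a.obj ⟶ Free.of k b.obj) :=
  linHom k surjToAll a b

@[simp]
theorem inclS_arr {a b : FS} (f : a ⟶ b) : inclS k a b (arr k f) = arr k f.hom :=
  linHom_arr k surjToAll f

/-- The inclusion `k FI → k FA` on morphisms. -/
def inclI (a b : FI) : (Free.of k a ⟶ Free.of k b) →ₗ[k] (Free.of k a.obj ⟶ Free.of k b.obj) :=
  linHom k injToAll a b

@[simp]
theorem inclI_arr {a b : FI} (f : a ⟶ b) : inclI k a b (arr k f) = arr k f.hom :=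
  linHom_arr k injToAll f

/-- The inclusion `k FB → k FA` on morphisms. -/
def inclB (a b : FB) : (Free.of k a ⟶ Free.of k b) →ₗ[k] (Free.of k a.obj ⟶ Free.of k b.obj) :=
  linHom k (wideSubcategoryInclusion FA.isBij) a b

@[simp]
theorem inclB_arr {a b : FB} (f : a ⟶ b) : inclB k a b (arr k f) = arr k f.hom :=
  linHom_arr k (wideSubcategoryInclusion FA.isBij) f

/-- The inclusion `k FB → k FS` on morphisms. -/
def inclBS (a b : FB) :
    (Free.of k a ⟶ Free.of k b) →ₗ[k] (Free.of k (⟨a.obj⟩ : FS) ⟶ Free.of k (⟨b.obj⟩ : FS)) :=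
  linHom k bijToSurj a b

/-- A surjective map as a morphism of `FS`. -/
def surjHom {a b : FS} (f : a.obj ⟶ b.obj) (h : FA.isSurj f) : a ⟶ b := ⟨f, h⟩

@[simp]
theorem inclBS_arr {a b : FB} (f : a ⟶ b) :
    inclBS k a b (arr k f) = arr k (surjHom (a := ⟨a.obj⟩) (b := ⟨b.obj⟩) f.hom f.property.2) :=
  linHom_arr k bijToSurj f

open Classical in
/-- The right augmentation `ε : k FA → k FS`, `f ↦ [f]_FS`: the class `[f]` goes to `[f]` if `f` is
surjective and to `0` otherwise. -/
def rightAug (a b : FS) : (Free.of k a.obj ⟶ Free.of k b.obj) →ₗ[k] (Free.of k a ⟶ Free.of k b) :=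
  arrLift k fun f => if h : FA.isSurj f then arr k (surjHom f h) else 0

theorem rightAug_of_surj {a b : FS} (f : a.obj ⟶ b.obj) (h : FA.isSurj f) :
    rightAug k a b (arr k f) = arr k (surjHom f h) := by
  simp [rightAug, h]

theorem rightAug_of_not_surj {a b : FS} (f : a.obj ⟶ b.obj) (h : ¬ FA.isSurj f) :
    rightAug k a b (arr k f) = 0 := by
  simp [rightAug, h]

theorem rightAug_incl {a b : FS} (s : Free.of k a ⟶ Free.of k b) :
    rightAug k a b (inclS k a b s) = s := by
  induction s using arr_induction with
  | zero => simp
  | add x y hx hy => simp only [map_add, hx, hy]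
  | smul r x hx => simp only [map_smul, hx]
  | arr f => rw [inclS_arr]; exact rightAug_of_surj k f.hom f.property

theorem rightAug_incl_comp {a b c : FS} (s : Free.of k a ⟶ Free.of k b)
    (x : Free.of k b.obj ⟶ Free.of k c.obj) :
    rightAug k a c (inclS k a b s ≫ x) = s ≫ rightAug k b c x := by
  induction s using arr_induction with
  | zero => simp
  | add s t hs ht => simp only [Preadditive.add_comp, map_add, hs, ht]
  | smul r s hs => simp only [Linear.smul_comp, map_smul, hs]
  | arr p =>
    induction x using arr_induction with
    | zero => simp
    | add x y hx hy => simp only [Preadditive.comp_add, map_add, hx, hy]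
    | smul r x hx => simp only [Linear.comp_smul, map_smul, hx]
    | arr f =>
      rw [inclS_arr, arr_comp]
      by_cases h : FA.isSurj f
      · rw [rightAug_of_surj k f h, arr_comp]
        exact rightAug_of_surj k _ (Function.Surjective.comp h p.property)
      · rw [rightAug_of_not_surj k f h, Limits.comp_zero, rightAug_of_not_surj]
        exact fun h' => h (Function.Surjective.of_comp h')

theorem rightAug_comp_bij {a b c : FB} (x : Free.of k a.obj ⟶ Free.of k b.obj)
    (r : Free.of k b ⟶ Free.of k c) :
    rightAug k ⟨a.obj⟩ ⟨c.obj⟩ (x ≫ inclB k b c r) =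
      rightAug k ⟨a.obj⟩ ⟨b.obj⟩ x ≫ inclBS k b c r := by
  induction x using arr_induction with
  | zero => simp
  | add s t hs ht => simp only [Preadditive.add_comp, map_add, hs, ht]
  | smul r s hs => simp only [Linear.smul_comp, map_smul, hs]
  | arr f =>
    induction r using arr_induction with
    | zero => simp
    | add x y hx hy => simp only [Preadditive.comp_add, map_add, hx, hy]
    | smul r x hx => simp only [Linear.comp_smul, map_smul, hx]
    | arr p =>
      rw [inclB_arr, inclBS_arr, arr_comp]
      by_cases h : FA.isSurj f
      · rw [rightAug_of_surj k (a := ⟨a.obj⟩) (b := ⟨b.obj⟩) f h, arr_comp]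
        exact rightAug_of_surj k (a := ⟨a.obj⟩) (b := ⟨c.obj⟩) _
          (Function.Surjective.comp p.property.2 h)
      · rw [rightAug_of_not_surj k (a := ⟨a.obj⟩) (b := ⟨b.obj⟩) f h, Limits.zero_comp]
        refine rightAug_of_not_surj k (a := ⟨a.obj⟩) (b := ⟨c.obj⟩) _ fun h' => h ?_
        have h'' : Function.Surjective (p.hom ∘ f) := h'
        exact Function.Surjective.of_comp_left h'' p.property.1

/-- The kernel of the right augmentation is a right ideal. -/
theorem rightAug_comp {a b c : FS} (x : Free.of k a.obj ⟶ Free.of k b.obj)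
    (y : Free.of k b.obj ⟶ Free.of k c.obj) :
    rightAug k a c (x ≫ inclS k b c (rightAug k b c y)) = rightAug k a c (x ≫ y) := by
  induction y using arr_induction with
  | zero => simp
  | add y z hy hz => simp only [Preadditive.comp_add, map_add, hy, hz]
  | smul r y hy => simp only [Linear.comp_smul, map_smul, hy]
  | arr g =>
    by_cases h : FA.isSurj g
    · rw [rightAug_of_surj k g h, inclS_arr]; rfl
    · rw [rightAug_of_not_surj k g h, map_zero, Limits.comp_zero, map_zero]
      induction x using arr_induction with
      | zero => simp
      | add x y hx hy => simp only [Preadditive.add_comp, map_add, ← hx, ← hy, add_zero]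
      | smul r x hx => simp only [Linear.smul_comp, map_smul, ← hx, smul_zero]
      | arr f =>
        rw [arr_comp, rightAug_of_not_surj]
        exact fun h' => h (Function.Surjective.of_comp h')

/-- The maps `a → c → b` with `a → c` surjective, `c → b` injective and `|b| - |c| ≤ n`. -/
def filtSet (n : ℤ) (a b : FA) : Set (a ⟶ b) :=
  {f | ∃ (c : FA) (p : a ⟶ c) (i : c ⟶ b),
    FA.isSurj p ∧ FA.isInj i ∧ (b.card : ℤ) - c.card ≤ n ∧ f = p ≫ i}

theorem mem_filtSet_iff {n : ℤ} {a b : FA} (f : a ⟶ b) :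
    f ∈ filtSet n a b ↔ ((Set.range f)ᶜ.ncard : ℤ) ≤ n := by
  have key : ∀ {c : FA} (i : c ⟶ b), FA.isInj i →
      ((Set.range i)ᶜ.ncard : ℤ) = (b.card : ℤ) - c.card := by
    intro c i hi
    have h1 := Set.ncard_add_ncard_compl (Set.range i)
    have h2 : (Set.range i).ncard = c.card := by
      rw [← Set.image_univ, Set.ncard_image_of_injective _ hi]; simp
    simp only [Nat.card_eq_fintype_card, Fintype.card_fin] at h1
    omega
  constructor
  · rintro ⟨c, p, i, hp, hi, hn, rfl⟩
    have : Set.range (p ≫ i) = Set.range i := Function.Surjective.range_comp hp i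
    rw [this, key i hi]
    exact hn
  · intro h
    let e : Set.range f ≃ Fin (Set.range f).ncard :=
      (Finite.equivFin _).trans (finCongr (Nat.card_coe_set_eq _))
    let i : (⟨(Set.range f).ncard⟩ : FA) ⟶ b := fun x => (e.symm x).1
    have hi : FA.isInj i := Subtype.val_injective.comp e.symm.injective
    refine ⟨⟨(Set.range f).ncard⟩, fun x => e ⟨f x, x, rfl⟩, i, ?_, hi, ?_, ?_⟩
    · intro y
      obtain ⟨x, hx⟩ := (e.symm y).2
      refine ⟨x, ?_⟩
      simp [hx]
    · rw [← key i hi]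
      refine le_trans (le_of_eq ?_) h
      congr 3
      ext y
      constructor
      · rintro ⟨x, rfl⟩; exact (e.symm x).2
      · intro hy; exact ⟨e ⟨y, hy⟩, by simp [i]⟩
    · funext x
      change f x = (e.symm (e ⟨f x, x, rfl⟩)).1
      simp

theorem comp_mem_filtSet {m n : ℤ} {a b c : FA} {f : a ⟶ b} {g : b ⟶ c}
    (hf : f ∈ filtSet n a b) (hg : g ∈ filtSet m b c) : f ≫ g ∈ filtSet (m + n) a c := by
  rw [mem_filtSet_iff] at hf hg ⊢
  have hsub : (Set.range (f ≫ g))ᶜ ⊆ (Set.range g)ᶜ ∪ g '' (Set.range f)ᶜ := by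
    intro y hy
    by_cases h : y ∈ Set.range g
    · obtain ⟨x, rfl⟩ := h
      refine Or.inr ⟨x, ?_, rfl⟩
      rintro ⟨z, rfl⟩
      exact hy ⟨z, rfl⟩
    · exact Or.inl h
  have h1 := Set.ncard_le_ncard hsub
  have h2 := Set.ncard_union_le (Set.range g)ᶜ (g '' (Set.range f)ᶜ)
  have h3 := Set.ncard_image_le (f := g) (s := (Set.range f)ᶜ)
  omega

/-- The step `G_n k FA` of the filtration of `k FA`: the span of the maps that factor as a
surjection followed by an injection `c → b` with `|b| - |c| ≤ n`, that is, the image of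
`⨁_{t ≤ n} k FI^[t] ⊗_FB k FS`. -/
def filt (n : ℤ) (a b : FA) : Submodule k (Free.of k a ⟶ Free.of k b) :=
  Submodule.span k (arr k '' filtSet n a b)

theorem filt_mono {m n : ℤ} (h : m ≤ n) (a b : FA) : filt k m a b ≤ filt k n a b := by
  refine Submodule.span_mono (Set.image_mono ?_)
  rintro f ⟨c, p, i, hp, hi, hc, rfl⟩
  exact ⟨c, p, i, hp, hi, hc.trans h, rfl⟩

theorem comp_mem_filt {m n : ℤ} {a b c : FA} {x : Free.of k a ⟶ Free.of k b}
    {y : Free.of k b ⟶ Free.of k c} (hx : x ∈ filt k n a b) (hy : y ∈ filt k m b c) :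
    x ≫ y ∈ filt k (m + n) a c := by
  induction hx using Submodule.span_induction with
  | zero => simp
  | add x x' _ _ h h' => rw [Preadditive.add_comp]; exact add_mem h h'
  | smul r x _ h => rw [Linear.smul_comp]; exact Submodule.smul_mem _ r h
  | mem x hx =>
    obtain ⟨f, hf, rfl⟩ := hx
    induction hy using Submodule.span_induction with
    | zero => simp
    | add y y' _ _ h h' => rw [Preadditive.comp_add]; exact add_mem h h'
    | smul r y _ h => rw [Linear.comp_smul]; exact Submodule.smul_mem _ r h
    | mem y hy =>
      obtain ⟨g, hg, rfl⟩ := hy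
      rw [arr_comp]
      exact Submodule.subset_span ⟨_, comp_mem_filtSet hf hg, rfl⟩

theorem incl_mem_filt {a b : FS} (s : Free.of k a ⟶ Free.of k b) :
    inclS k a b s ∈ filt k 0 a.obj b.obj := by
  induction s using arr_induction with
  | zero => simp
  | add x y hx hy => rw [map_add]; exact add_mem hx hy
  | smul r x hx => rw [map_smul]; exact Submodule.smul_mem _ r hx
  | arr f =>
    rw [inclS_arr]
    exact Submodule.subset_span ⟨_, ⟨b.obj, f.hom, 𝟙 _, f.property,
      Function.injective_id, by simp, by simp⟩, rfl⟩

/-- `k FA` as a `k FS`-bimodule. -/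
def allBimod : Bimod k (Free k FS) (Free k FS) :=
  (Bimod.regular k (Free k FA)).restrict (linMap k surjToAll) (linMap k surjToAll)

/-- `G_n k FA` as a `k FS`-bimodule. -/
def filtBimod (n : ℤ) : Bimod k (Free k FS) (Free k FS) :=
  (allBimod k).sub (fun a b => filt k n (WideSubcategory.obj a) (WideSubcategory.obj b))
    (fun {a a'} b f v hv => by
      have := comp_mem_filt k (incl_mem_filt k (a := a') (b := a) f) hv
      rwa [add_zero] at this)
    (fun a b b' g v hv => by
      have := comp_mem_filt k hv (incl_mem_filt k (a := b) (b := b') g)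
      rwa [zero_add] at this)

/-- `G_{n-1}` inside `G_n`. -/
def filtPred (n : ℤ) (a b : Free k FS) : Submodule k ((filtBimod k n).X a b) :=
  Submodule.comap (Submodule.subtype (filt k n (WideSubcategory.obj a) (WideSubcategory.obj b)))
    (filt k (n - 1) (WideSubcategory.obj a) (WideSubcategory.obj b))

/-- The associated graded piece `gr_n^G k FA = G_n / G_{n-1}` as a `k FS`-bimodule. -/
def grBimod (n : ℤ) : Bimod k (Free k FS) (Free k FS) :=
  (filtBimod k n).quot (filtPred k n)
    (fun {a a'} b f v hv => by
      have := comp_mem_filt k (incl_mem_filt k (a := a') (b := a) f) hv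
      rwa [add_zero] at this)
    (fun a b b' g v hv => by
      have := comp_mem_filt k hv (incl_mem_filt k (a := b) (b := b') g)
      rwa [zero_add] at this)

/-- The class in `gr_n^G k FA` of an element of `G_n k FA`. -/
def grClass (n : ℤ) (a b : Free k FS) : (filtBimod k n).X a b →ₗ[k] (grBimod k n).X a b :=
  (filtPred k n a b).mkQ

/-- The product `G_m × G_n → G_{m+n}`. -/
def filtMul (m n : ℤ) (a b c : Free k FS) :
    (filtBimod k m).X b c →ₗ[k] (filtBimod k n).X a b →ₗ[k] (filtBimod k (m + n)).X a c :=
  LinearMap.mk₂ k (fun v w => ⟨w.1 ≫ v.1, comp_mem_filt k w.2 v.2⟩)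
    (fun _ _ _ => Subtype.ext (Preadditive.comp_add ..))
    (fun _ _ _ => Subtype.ext (Linear.comp_smul ..))
    (fun _ _ _ => Subtype.ext (Preadditive.add_comp ..))
    (fun _ _ _ => Subtype.ext (Linear.smul_comp ..))

/-- The product `gr_m × gr_n → gr_{m+n}` of the associated graded category. -/
def grMul (m n : ℤ) (a b c : Free k FS) :
    (grBimod k m).X b c →ₗ[k] (grBimod k n).X a b →ₗ[k] (grBimod k (m + n)).X a c :=
  (filtPred k m b c).liftQ
    { toFun := fun v => (filtPred k n a b).mapQ (filtPred k (m + n) a c) (filtMul k m n a b c v)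
        (fun w hw => by
          have := comp_mem_filt k hw v.2
          rwa [← add_sub_assoc] at this)
      map_add' := fun v v' => by
        refine Submodule.linearMap_qext _ (LinearMap.ext fun w => ?_)
        change grClass k (m + n) a c (filtMul k m n a b c (v + v') w) =
          grClass k (m + n) a c (filtMul k m n a b c v w) +
            grClass k (m + n) a c (filtMul k m n a b c v' w)
        rw [map_add, LinearMap.add_apply, map_add]
      map_smul' := fun r v => by
        refine Submodule.linearMap_qext _ (LinearMap.ext fun w => ?_)
        change grClass k (m + n) a c (filtMul k m n a b c (r • v) w) =
          r • grClass k (m + n) a c (filtMul k m n a b c v w)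
        rw [map_smul, LinearMap.smul_apply, map_smul] }
    (fun v hv => by
      refine Submodule.linearMap_qext _ (LinearMap.ext fun w => ?_)
      refine (Submodule.Quotient.mk_eq_zero (filtPred k (m + n) a c)).2 ?_
      have := comp_mem_filt k w.2 hv
      rwa [sub_add_eq_add_sub] at this)

theorem grMul_class (m n : ℤ) (a b c : Free k FS) (v : (filtBimod k m).X b c)
    (w : (filtBimod k n).X a b) :
    grMul k m n a b c (grClass k m b c v) (grClass k n a b w) =
      grClass k (m + n) a c (filtMul k m n a b c v w) := rfl

end Filtration

/-! ## The quadratic dual of `k FI` and the DG category `(gr^G k FA)^⊥` -/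

section Main

variable (k : Type u) [CommRing k]

theorem bij_eq_zero {a b : FB} (h : a.obj.card ≠ b.obj.card) (x : Free.of k a ⟶ Free.of k b) :
    x = 0 := by
  induction x using arr_induction with
  | zero => rfl
  | add x y hx hy => rw [hx, hy, add_zero]
  | smul r x hx => rw [hx, smul_zero]
  | arr f => exact absurd (by simpa using Fintype.card_of_bijective f.property) h

/-- The linearized inclusion `k FB ⥤ k FI`. -/
abbrev bijInj : Free k FB ⥤ Free k FI := linMap k bijToInj

/-- The linearized inclusion `k FB ⥤ k FS`. -/
abbrev bijSurj : Free k FB ⥤ Free k FS := linMap k bijToSurj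

/-- `k FI` as a `k FB`-bimodule. -/
def injBimod : Bimod k (Free k FB) (Free k FB) :=
  (Bimod.regular k (Free k FI)).restrict (bijInj k) (bijInj k)

/-- The homogeneous part of degree `n`: all of `k FI(a, b)` if `|b| = |a| + n`, and `0`
otherwise. -/
def injDegree (n : ℕ) (a b : Free k FB) : Submodule k ((injBimod k).X a b) where
  carrier := {x | (WideSubcategory.obj b).card = (WideSubcategory.obj a).card + n ∨ x = 0}
  add_mem' := by
    rintro x y (h | rfl) (h' | rfl)
    · exact Or.inl h
    · exact Or.inl h
    · exact Or.inl h'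
    · exact Or.inr (add_zero 0)
  zero_mem' := Or.inr rfl
  smul_mem' := by
    rintro r x (h | rfl)
    · exact Or.inl h
    · exact Or.inr (smul_zero r)

/-- The `k FB`-bimodule `k FI^[n]`. -/
def injPart (n : ℕ) : Bimod k (Free k FB) (Free k FB) :=
  (injBimod k).sub (injDegree k n)
    (fun {a a'} b f v hv => by
      rcases hv with hv | rfl
      · by_cases h : (WideSubcategory.obj a').card = (WideSubcategory.obj a).card
        · exact Or.inl (h ▸ hv)
        · have h0 : f = 0 := bij_eq_zero k (a := a') (b := a) h f
          rw [h0, map_zero]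
          exact Or.inr rfl
      · exact Or.inr (map_zero _))
    (fun a b b' g v hv => by
      rcases hv with hv | rfl
      · by_cases h : (WideSubcategory.obj b).card = (WideSubcategory.obj b').card
        · exact Or.inl (h ▸ hv)
        · have h0 : g = 0 := bij_eq_zero k (a := b) (b := b') h g
          rw [h0, map_zero]
          exact Or.inr rfl
      · exact Or.inr (map_zero _))

/-- The product `k FI^[m] × k FI^[n] → k FI^[m+n]`. -/
def injMul (m n : ℕ) (a b c : Free k FB) :
    (injPart k m).X b c →ₗ[k] (injPart k n).X a b →ₗ[k] (injPart k (m + n)).X a c :=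
  LinearMap.mk₂ k
    (fun v w => ⟨CategoryStruct.comp (obj := Free k FI) w.1 v.1, by
      rcases v.2 with hv | hv
      · rcases w.2 with hw | hw
        · left; omega
        · right; rw [hw]; exact Limits.zero_comp
      · right; rw [hv]; exact Limits.comp_zero⟩)
    (fun _ _ _ => Subtype.ext (Preadditive.comp_add ..))
    (fun _ _ _ => Subtype.ext (Linear.comp_smul ..))
    (fun _ _ _ => Subtype.ext (Preadditive.add_comp ..))
    (fun _ _ _ => Subtype.ext (Linear.smul_comp ..))

/-- The quadratic dual `k FI^⊥` over `k FB`. -/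
abbrev InjDual : Type :=
  RightQuadDual (injPart k 1) (injPart k (1 + 1)) (fun {x x' a} => injMul k 1 1 x x' a)

/-- The functor `k FB ⥤ k FI^⊥`. -/
abbrev injDualBase : Free k FB ⥤ InjDual k := QuadCat.base _ _

/-- The generators `(k FI^[1])^∨ → k FI^⊥`. -/
abbrev injDualGen {a b : Free k FB} :
    (injPart k 1).rightDual.X a b →ₗ[k] ((injDualBase k).obj a ⟶ (injDualBase k).obj b) :=
  QuadCat.gen _ _

/-- The grading of `k FI^⊥`. -/
abbrev injDualDegree (n : ℕ) (a b : InjDual k) : Submodule k (a ⟶ b) :=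
  QuadCat.degree _ _ n a b

/-- The quadratic dual `(gr^G k FA)^⊥` over `k FS`. -/
abbrev GrDual : Type :=
  RightQuadDual (grBimod k 1) (grBimod k (1 + 1)) (fun {x x' a} => grMul k 1 1 x x' a)

/-- The functor `k FS ⥤ (gr^G k FA)^⊥`. -/
abbrev grDualBase : Free k FS ⥤ GrDual k := QuadCat.base _ _

/-- The generators `(gr_1^G k FA)^∨ → (gr^G k FA)^⊥`. -/
abbrev grDualGen {a b : Free k FS} :
    (grBimod k 1).rightDual.X a b →ₗ[k] ((grDualBase k).obj a ⟶ (grDualBase k).obj b) :=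
  QuadCat.gen _ _

/-- The cohomological grading of `(gr^G k FA)^⊥`. -/
abbrev grDualDegree (n : ℕ) (a b : GrDual k) : Submodule k (a ⟶ b) :=
  QuadCat.degree _ _ n a b

/-- The right augmentation on `k FA`, seen as a `k FS`-bimodule. -/
def aug (a b : Free k FS) : (allBimod k).X a b →ₗ[k] (a ⟶ b) := rightAug k a b

/-- The composite `w ≫ v` in `k FA`. -/
def compAll {a b c : Free k FS} (w : (allBimod k).X a b) (v : (allBimod k).X b c) :
    (allBimod k).X a c :=
  CategoryStruct.comp (obj := Free k FA) w v

/-- The inclusion of `k FS` into `k FA`. -/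
def inclAll {a b : Free k FS} (s : a ⟶ b) : (allBimod k).X a b := (linMap k surjToAll).map s

/-- The formulas that determine the differential of the DG category `(gr^G k FA)^⊥` dual to the
right augmented nonhomogeneous quadratic category `k FA`.

* For `r` in `k FS`, `d r` is the element `χ` of `(gr_1)^∨` with `χ[v] = ε(r v)` for
  `v ∈ G_1 ∩ ker ε`.
* For `φ` in `(gr_1)^∨`, `d φ = ∑ f_j g_j` where
  `∑_i ∑_j f_j(g_j[v_i] · [w_i]) = ∑_i ε(φ[v_i] w_i) - φ[∑_i v_i w_i]`
  for all finite families in `G_1 ∩ ker ε` with `∑_i v_i w_i ∈ G_1`. -/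
structure IsDualDifferential (d : ∀ a b : GrDual k, (a ⟶ b) →ₗ[k] (a ⟶ b)) : Prop where
  on_base : ∀ {a b : Free k FS} (r : a ⟶ b), ∃ χ : (grBimod k 1).rightDual.X a b,
    d _ _ ((grDualBase k).map r) = grDualGen k χ ∧
    ∀ (x : Free k FS) (v : (filtBimod k 1).X x a), aug k x a v.1 = 0 →
      Bimod.ev χ (grClass k 1 x a v) = aug k x b (compAll k v.1 (inclAll k r))
  on_gen : ∀ {a c : Free k FS} (φ : (grBimod k 1).rightDual.X a c),
    ∃ (n : ℕ) (e : Fin n → Free k FS) (f : ∀ j, (grBimod k 1).rightDual.X (e j) c)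
      (g : ∀ j, (grBimod k 1).rightDual.X a (e j)),
    d _ _ (grDualGen k φ) = ∑ j, grDualGen k (g j) ≫ grDualGen k (f j) ∧
    ∀ (x : Free k FS) (m : ℕ) (y : Fin m → Free k FS) (v : ∀ i, (filtBimod k 1).X (y i) a)
      (w : ∀ i, (filtBimod k 1).X x (y i)) (s : (filtBimod k 1).X x a),
      (∀ i, aug k _ _ (v i).1 = 0) → (∀ i, aug k _ _ (w i).1 = 0) →
      s.1 = ∑ i, compAll k (w i).1 (v i).1 →
      ∑ i, ∑ j, Bimod.ev (f j) ((grBimod k 1).lact x (Bimod.ev (g j) (grClass k 1 _ _ (v i)))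
          (grClass k 1 _ _ (w i))) =
        ∑ i, aug k _ _ (compAll k (w i).1 (inclAll k (Bimod.ev φ (grClass k 1 _ _ (v i))))) -
          Bimod.ev φ (grClass k 1 _ _ s)

/-- The underlying `k FB`-bimodule of `(gr^G k FA)^⊥`. -/
abbrev grDualBimod : Bimod k (Free k FB) (Free k FB) :=
  (Bimod.regular k (GrDual k)).restrict (bijSurj k ⋙ grDualBase k) (bijSurj k ⋙ grDualBase k)

/-- The underlying `k FB`-bimodule of `k FI^⊥`. -/
abbrev injDualBimod : Bimod k (Free k FB) (Free k FB) :=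
  (Bimod.regular k (InjDual k)).restrict (injDualBase k) (injDualBase k)

/-! ### The Koszul complex of a right `k FI`-module -/

variable {k} in
/-- Dual bases of the right `k FB`-module `k FI^[1](-, d)`: the family represents the canonical
element of `k FI^[1] ⊗_FB (k FI^[1])^∨` at `d`. -/
def IsDualBasis {d : Free k FB} {n : ℕ} {c : Fin n → Free k FB}
    (v : ∀ j, (injPart k 1).X (c j) d) (φ : ∀ j, (injPart k 1).rightDual.X d (c j)) : Prop :=
  ∀ (a : Free k FB) (w : (injPart k 1).X a d),
    ∑ j, (injPart k 1).ract d (Bimod.ev (φ j) w) (v j) = w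

variable {k} in
/-- A right `k FI`-module with commuting left `k FB`-action, as a `k FB`-bimodule. -/
abbrev toBij (M : Bimod k (Free k FI) (Free k FB)) : Bimod k (Free k FB) (Free k FB) :=
  M.restrict (bijInj k) (𝟭 _)

variable {k} in
/-- The differential of the Koszul complex `M ⊗_FB k FI^⊥` of a right `k FI`-module `M`:
`κ(m ⊗ ρ) = ∑ m v_j ⊗ φ_j ρ`, where `∑ v_j ⊗ φ_j` is the canonical element of
`k FI^[1] ⊗_FB (k FI^[1])^∨`. Both the existence of representatives of the canonical element and
the independence of their choice are included. -/
def IsKoszulDifferential (M : Bimod k (Free k FI) (Free k FB))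
    (κ : ∀ a e : Free k FB, ((toBij M).tensor (injDualBimod k)).X a e →ₗ[k]
      ((toBij M).tensor (injDualBimod k)).X a e) : Prop :=
  ∀ d : Free k FB,
    (∃ (n : ℕ) (c : Fin n → Free k FB) (v : ∀ j, (injPart k 1).X (c j) d)
      (φ : ∀ j, (injPart k 1).rightDual.X d (c j)), IsDualBasis v φ) ∧
    ∀ (n : ℕ) (c : Fin n → Free k FB) (v : ∀ j, (injPart k 1).X (c j) d)
      (φ : ∀ j, (injPart k 1).rightDual.X d (c j)), IsDualBasis v φ →
      ∀ (a e : Free k FB) (m : (toBij M).X d e) (ρ : (injDualBimod k).X a d),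
        κ a e (Bimod.tmul (toBij M) (injDualBimod k) m ρ) =
          ∑ j, Bimod.tmul (toBij M) (injDualBimod k) (a := a) (d := c j) (e := e)
            (M.ract e (v j).1 m)
            (CategoryStruct.comp (obj := InjDual k) ρ (injDualGen k (φ j)))

/-! ### The right `k FI`-module `k FS` -/

/-- The right action of `k FI` on `k FS` induced by the right augmentation:
`[p] · [i] = [p ∘ i]_FS`. -/
def surjRact (a a' : FI) (b : FB) : (Free.of k a' ⟶ Free.of k a) →ₗ[k]
    (Free.of k (⟨a.obj⟩ : FS) ⟶ Free.of k (⟨b.obj⟩ : FS)) →ₗ[k]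
    (Free.of k (⟨a'.obj⟩ : FS) ⟶ Free.of k (⟨b.obj⟩ : FS)) :=
  LinearMap.mk₂ k
    (fun i p => rightAug k ⟨a'.obj⟩ ⟨b.obj⟩ (inclI k a' a i ≫ inclS k ⟨a.obj⟩ ⟨b.obj⟩ p))
    (by intros; rw [map_add, Preadditive.add_comp, map_add])
    (by intros; rw [map_smul, Linear.smul_comp, map_smul])
    (by intros; rw [map_add, Preadditive.comp_add, map_add])
    (by intros; rw [map_smul, Linear.comp_smul, map_smul])

/-- The left action of `k FB` on `k FS` by postcomposition. -/
def surjLact (a b b' : FB) : (Free.of k b ⟶ Free.of k b') →ₗ[k]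
    (Free.of k (⟨a.obj⟩ : FS) ⟶ Free.of k (⟨b.obj⟩ : FS)) →ₗ[k]
    (Free.of k (⟨a.obj⟩ : FS) ⟶ Free.of k (⟨b'.obj⟩ : FS)) :=
  LinearMap.mk₂ k (fun r p => p ≫ inclBS k b b' r)
    (by intros; rw [map_add, Preadditive.comp_add])
    (by intros; rw [map_smul, Linear.comp_smul])
    (by intros; rw [Preadditive.add_comp])
    (by intros; rw [Linear.smul_comp])

theorem inclS_id (a : FS) : inclS k a a (𝟙 (Free.of k a)) = 𝟙 (Free.of k a.obj) :=
  linHom_id k surjToAll a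

theorem inclS_comp {a b c : FS} (x : Free.of k a ⟶ Free.of k b) (y : Free.of k b ⟶ Free.of k c) :
    inclS k a c (x ≫ y) = inclS k a b x ≫ inclS k b c y :=
  linHom_comp k surjToAll x y

/-- The inclusion `k FB → k FI` on morphisms. -/
def inclBI (a b : FB) :
    (Free.of k a ⟶ Free.of k b) →ₗ[k] (Free.of k (⟨a.obj⟩ : FI) ⟶ Free.of k (⟨b.obj⟩ : FI)) :=
  linHom k bijToInj a b

theorem inclI_inclBI {a b : FB} (r : Free.of k a ⟶ Free.of k b) :
    inclI k ⟨a.obj⟩ ⟨b.obj⟩ (inclBI k a b r) = inclB k a b r := by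
  induction r using arr_induction with
  | zero => simp
  | add x y hx hy => simp only [map_add, hx, hy]
  | smul r x hx => simp only [map_smul, hx]
  | arr f =>
    rw [inclB_arr]
    exact (congrArg (inclI k _ _) (linHom_arr k bijToInj f)).trans (inclI_arr k _)

theorem inclS_inclBS {a b : FB} (r : Free.of k a ⟶ Free.of k b) :
    inclS k ⟨a.obj⟩ ⟨b.obj⟩ (inclBS k a b r) = inclB k a b r := by
  induction r using arr_induction with
  | zero => simp
  | add x y hx hy => simp only [map_add, hx, hy]
  | smul r x hx => simp only [map_smul, hx]
  | arr f => rw [inclBS_arr, inclS_arr, inclB_arr]; rfl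

/-- `k FS` as a right `k FI`-module, with its left `k FB`-action. -/
def surjMod : Bimod k (Free k FI) (Free k FB) where
  X a b := Free.of k (⟨WideSubcategory.obj a⟩ : FS) ⟶ Free.of k (⟨WideSubcategory.obj b⟩ : FS)
  ract {a a'} b := surjRact k a a' b
  lact a {b b'} := surjLact k ⟨WideSubcategory.obj a⟩ b b'
  ract_id a b p := by
    refine Eq.trans ?_ (rightAug_incl k p)
    refine congrArg (rightAug k _ _) ?_
    exact (congrArg (· ≫ _) (linHom_id k injToAll a)).trans (Category.id_comp _)
  ract_comp {a a' a''} b i' i p := by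
    refine Eq.trans ?_ (rightAug_comp k (a := ⟨WideSubcategory.obj a''⟩)
      (b := ⟨WideSubcategory.obj a'⟩) (c := ⟨WideSubcategory.obj b⟩)
      (inclI k a'' a' i') _).symm
    refine congrArg (rightAug k _ _) ?_
    exact (congrArg (· ≫ _) (linHom_comp k injToAll i' i)).trans (Category.assoc ..)
  lact_id a b p :=
    (congrArg (p ≫ ·) (linHom_id k bijToSurj b)).trans (Category.comp_id _)
  lact_comp a b b' b'' g g' p :=
    (congrArg (p ≫ ·) (linHom_comp k bijToSurj g g')).trans (Category.assoc ..).symm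
  lact_ract {a a' b b'} i r p := by
    refine (rightAug_comp_bij k (a := ⟨WideSubcategory.obj a'⟩) (b := b) (c := b') _ r).symm.trans ?_
    refine congrArg (rightAug k _ _) ?_
    refine (Category.assoc ..).trans (congrArg (_ ≫ ·) ?_)
    refine (congrArg (_ ≫ ·) (inclS_inclBS k r).symm).trans (inclS_comp k _ _).symm

/-- The right action of bijections on `k FS` is precomposition. -/
theorem surjMod_ract_bij {a a' b : FB} (r : Free.of k a' ⟶ Free.of k a)
    (p : Free.of k (⟨a.obj⟩ : FS) ⟶ Free.of k (⟨b.obj⟩ : FS)) :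
    (toBij (surjMod k)).ract (a := Free.of k a) (a' := Free.of k a') (Free.of k b) r p =
      inclBS k a' a r ≫ p := by
  refine Eq.trans ?_ (rightAug_incl k (a := ⟨a'.obj⟩) (b := ⟨b.obj⟩) (inclBS k a' a r ≫ p))
  refine congrArg (rightAug k _ _) ?_
  refine Eq.trans (congrArg (· ≫ _) ?_) (inclS_comp k (inclBS k a' a r) p).symm
  rw [inclS_inclBS]
  exact inclI_inclBI k r

theorem inclI_mem_filt {a b : FI} (h : b.obj.card = a.obj.card + 1)
    (x : Free.of k a ⟶ Free.of k b) : inclI k a b x ∈ filt k 1 a.obj b.obj := by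
  induction x using arr_induction with
  | zero => simp
  | add x y hx hy => rw [map_add]; exact add_mem hx hy
  | smul r x hx => rw [map_smul]; exact Submodule.smul_mem _ r hx
  | arr f =>
    rw [inclI_arr]
    refine Submodule.subset_span ⟨_, ⟨a.obj, 𝟙 _, f.hom,
      Function.surjective_id, f.property, ?_, by simp⟩, rfl⟩
    omega

/-- The map `k FI^[1] → gr_1^G k FA` given by the inclusion of `k FI` into `k FA`. -/
def injToGr (a b : Free k FB) :
    (injPart k 1).X a b →ₗ[k] (grBimod k 1).X ((bijSurj k).obj a) ((bijSurj k).obj b) :=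
  grClass k 1 ((bijSurj k).obj a) ((bijSurj k).obj b) ∘ₗ
    LinearMap.codRestrict (filt k 1 (WideSubcategory.obj a) (WideSubcategory.obj b))
      (inclI k ⟨WideSubcategory.obj a⟩ ⟨WideSubcategory.obj b⟩ ∘ₗ (injDegree k 1 a b).subtype)
      (fun x => x.2.elim (fun h => inclI_mem_filt k h x.1)
        (fun h => (congrArg (inclI k _ _) h).trans (map_zero _) ▸ zero_mem _))

end Main

end FinKoszul

end

open CategoryTheory
open scoped TensorProduct DirectSum

noncomputable section

namespace FinKoszul

universe u w

/-! ## Functors out of quadratic categories -/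

/-! Let `δ_m` be the functional that reads off the coefficient of the standard injection `m → m +
1`, the one missing the last point. It exists on `k FI^[1]` over `k FB` and on `gr_1` over `k FS`.
The `δ_m` twisted by transpositions form a dual basis of `k FI^[1](-, m + 1)`. The same injections
give a dual basis of `gr_1` over `k FS`, because modulo `G_0` a map of defect one is a surjection
followed by an injection missing one point. So each quadratic dual is generated over its degree zero
part by the `δ_m`.

The `δ_m` are natural in bijections, and they anticommute: removing two points in one order and in
the other adds up to the coefficient of the injection missing both, which depends only on the
product (`chop_swap_add_chop`). Hence every morphism is a combination of words "bijection, iterate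
of `δ`, morphism of degree zero", and an iterate changes by the sign under permutations of the
removed points. Words can therefore be indexed by the subsets `s` of the source, where `s` survives
and its complement is removed.

Independence of these words comes from a representation. The alternating sum `D_n : x + n → x + n +
1` of the injections missing one of the last `n + 1` points satisfies `D_{n+1} D_n = 0`. On families
`u = (u_m)` of morphisms out of the `x + m`, a functional `φ` acts by `u ↦ (φ(u_{m+1} D_m))_m`. The
relations `I^⊥` act by zero, since as functionals they factor through the product and consecutive
products of the `D_n` vanish. Evaluating on families concentrated in one level defines coefficients
of morphisms. On the words above these are a signed permutation or zero, so every morphism is the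
sum of the words given by its own coefficients (`sum_term`, `inj_eq_sum`, `gr_eq_sum`). The
coefficients of corresponding iterates agree in the two duals. This yields the grading, the functor
`j` (a relation of `k FI^⊥` has vanishing coefficients in the other dual), and an explicit inverse
of `Φ`.

The families also carry the boundary `∂u = (ε(u_{m+1} D_m))_m`. It squares to zero because `ker ε`
is a right ideal and `D_{m+1} D_m = 0` holds in `k FA` itself. The graded commutator of `∂` with the
action of a morphism is again the action of a morphism. For `r` in `k FS` that morphism is the
functional prescribed in (i), and for a generator it is the quadratic expression prescribed in (ii).
Since the action on all families is faithful, this commutator defines `d`. The Leibniz rule and `d²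
= 0` are identities of commutators, and any dual differential has the same commutators on
generators, hence equals `d`. Finally `ε` commutes with bijections, so `d` vanishes on the image of
`j` and `d(s j(ρ)) = (ds) j(ρ)`. Expanding `ds` along a dual basis of `k FI^[1]` gives the Koszul
differential. -/

@[simp]
theorem Bimod.pairing_tmul {k : Type u} [CommRing k] {C : Type} [Category.{u} C] [Preadditive C]
    [Linear k C] (V : Bimod k C C) {a c d x x' : C} (v : V.X x' a) (w : V.X x x')
    (φ : V.rightDual.X d c) (χ : V.rightDual.X a d) :
    pairing V v w (tmul V.rightDual V.rightDual φ χ) = ev φ (V.lact x (ev χ v) w) :=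
  tlift_tmul ..

namespace QuadCat

variable {k : Type u} [CommRing k]
variable {C : Type} [Category.{u} C] [Preadditive C] [Linear k C]
variable {V : Bimod k C C} {I : ∀ a c : C, Submodule k (Bimod.TensorX V V a c)}

theorem hom_induction {P : ∀ {a b : C}, ((base V I).obj a ⟶ (base V I).obj b) → Prop}
    (hbase : ∀ {a b : C} (f : a ⟶ b), P ((base V I).map f))
    (hgen : ∀ {a b : C} (v : V.X a b), P (gen V I v))
    (hadd : ∀ {a b : C} (x y : (base V I).obj a ⟶ (base V I).obj b), P x → P y → P (x + y))
    (hsmul : ∀ {a b : C} (r : k) (x : (base V I).obj a ⟶ (base V I).obj b), P x → P (r • x))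
    (hcomp : ∀ {a b c : C} (x : (base V I).obj a ⟶ (base V I).obj b)
      (y : (base V I).obj b ⟶ (base V I).obj c), P x → P y → P (x ≫ y))
    {a b : C} (z : (base V I).obj a ⟶ (base V I).obj b) : P z := by
  have key : ∀ {a b : C} (x : PreQuad V a b),
      P (show (base V I).obj a ⟶ (base V I).obj b from cls x) := by
    intro a b x
    induction x with
    | base f => exact hbase f
    | gen v => exact hgen v
    | @zero a b =>
      -- Zero needs no hypothesis of its own: it is the image of the zero morphism of `C`.
      have h := hbase (0 : a ⟶ b)
      rw [(base V I).map_zero] at h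
      exact h
    | add x y hx hy => exact hadd _ _ hx hy
    | smul r x hx => exact hsmul r _ hx
    | comp x y hx hy => exact hcomp _ _ hx hy
  exact Quot.inductionOn z key

theorem base_comp_gen {a a' b : C} (f : a' ⟶ a) (v : V.X a b) :
    (base V I).map f ≫ gen V I v = gen V I (V.ract b f v) :=
  (Quot.sound (.gen_ract f v)).symm

theorem gen_comp_base {a b b' : C} (v : V.X a b) (g : b ⟶ b') :
    gen V I v ≫ (base V I).map g = gen V I (V.lact a g v) :=
  (Quot.sound (.gen_lact g v)).symm

section Lift

variable {E : Type w} [Category.{u} E] [Preadditive E] [Linear k E] (F : C ⥤ E)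
  (g : ∀ {a b : C}, V.X a b →ₗ[k] (F.obj a ⟶ F.obj b))

/-- The map `V ⊗_C V → E` induced by a map of bimodules `V → E`. -/
def compTwo (hr : ∀ {a a' b : C} (f : a' ⟶ a) (v : V.X a b), g (V.ract b f v) = F.map f ≫ g v)
    (hl : ∀ {a b b' : C} (f : b ⟶ b') (v : V.X a b), g (V.lact a f v) = g v ≫ F.map f)
    (a c : C) : Bimod.TensorX V V a c →ₗ[k] (F.obj a ⟶ F.obj c) :=
  Bimod.tlift V V (fun d => LinearMap.mk₂ k (fun (v : V.X d c) (w : V.X a d) => g w ≫ g v)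
    (by simp) (by simp) (by simp) (by simp)) (fun d d' r m n => by simp [hr, hl])

@[simp]
theorem compTwo_tmul
    (hr : ∀ {a a' b : C} (f : a' ⟶ a) (v : V.X a b), g (V.ract b f v) = F.map f ≫ g v)
    (hl : ∀ {a b b' : C} (f : b ⟶ b') (v : V.X a b), g (V.lact a f v) = g v ≫ F.map f)
    {a c d : C} (v : V.X d c) (w : V.X a d) :
    compTwo F g hr hl a c (Bimod.tmul V V v w) = g w ≫ g v :=
  Bimod.tlift_tmul ..

/-- The value of a formal expression under a functor on `C` and a map on `V`. -/
def preLift : ∀ {a b : C}, PreQuad V a b → (F.obj a ⟶ F.obj b)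
  | _, _, .base f => F.map f
  | _, _, .gen v => g v
  | _, _, .zero => 0
  | _, _, .add x y => preLift x + preLift y
  | _, _, .smul r x => r • preLift x
  | _, _, .comp x y => preLift x ≫ preLift y

variable [F.Additive] [F.Linear k]

/-- All relations except `quad` hold in any `k`-linear category once `F` is linear and `g` is a map
of bimodules. For `quad`, the listed sum is the image under `compTwo` of an element of `I`. -/
theorem preLift_eq
    (hr : ∀ {a a' b : C} (f : a' ⟶ a) (v : V.X a b), g (V.ract b f v) = F.map f ≫ g v)
    (hl : ∀ {a b b' : C} (f : b ⟶ b') (v : V.X a b), g (V.lact a f v) = g v ≫ F.map f)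
    (hI : ∀ (a c : C) (t : Bimod.TensorX V V a c), t ∈ I a c → compTwo F g hr hl a c t = 0)
    {a b : C} {x y : PreQuad V a b} (h : QuadRel V I x y) :
    preLift F g x = preLift F g y := by
  induction h with
  | quad l hl' =>
    have h0 := hI _ _ _ hl'
    rw [map_list_sum, List.map_map] at h0
    refine Eq.trans ?_ h0
    clear h0 hl'
    induction l with
    | nil => rfl
    | cons p l ih =>
      simp only [List.foldr_cons, preLift, List.map_cons, List.sum_cons, ih, Function.comp_apply,
        compTwo_tmul]
  | add_comm x y => exact add_comm _ _
  | _ => simp_all [preLift, add_assoc, add_smul, mul_smul]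

/-- The functor on `T_C(V) / ⟨I⟩` induced by a functor on `C` and a map on `V` that annihilates
the relations. -/
def lift (hr : ∀ {a a' b : C} (f : a' ⟶ a) (v : V.X a b), g (V.ract b f v) = F.map f ≫ g v)
    (hl : ∀ {a b b' : C} (f : b ⟶ b') (v : V.X a b), g (V.lact a f v) = g v ≫ F.map f)
    (hI : ∀ (a c : C) (t : Bimod.TensorX V V a c), t ∈ I a c → compTwo F g hr hl a c t = 0) :
    QuadCat V I ⥤ E where
  obj a := F.obj a.obj
  map {a b} := Quot.lift (preLift F g) (fun _ _ h => preLift_eq F g hr hl hI h)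
  map_id a := F.map_id a.obj
  map_comp := by rintro _ _ _ ⟨x⟩ ⟨y⟩; rfl

section

variable (hr : ∀ {a a' b : C} (f : a' ⟶ a) (v : V.X a b), g (V.ract b f v) = F.map f ≫ g v)
  (hl : ∀ {a b b' : C} (f : b ⟶ b') (v : V.X a b), g (V.lact a f v) = g v ≫ F.map f)
  (hI : ∀ (a c : C) (t : Bimod.TensorX V V a c), t ∈ I a c → compTwo F g hr hl a c t = 0)

instance : (lift F g hr hl hI).Additive where
  map_add := by rintro _ _ ⟨x⟩ ⟨y⟩; rfl

instance : (lift F g hr hl hI).Linear k where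
  map_smul := by rintro _ _ ⟨x⟩ r; rfl

end

end Lift

/-- The elements of `I` vanish in `T_C(V) / ⟨I⟩`. -/
theorem compTwo_gen_eq_zero {a c : C} {t : Bimod.TensorX V V a c} (ht : t ∈ I a c) :
    compTwo (base V I) (gen V I) (fun f v => (base_comp_gen f v).symm)
      (fun f v => (gen_comp_base v f).symm) a c t = 0 := by
  classical
  -- The relation `quad` is stated for lists of pure tensors, so `t` is first brought to that shape.
  have key : ∀ t : Bimod.TensorX V V a c, ∃ l : List (Σ d : C, V.X d c × V.X a d),
      t = (l.map fun p => Bimod.tmul V V p.2.1 p.2.2).sum := by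
    intro t
    obtain ⟨t, rfl⟩ := Submodule.Quotient.mk_surjective _ t
    induction t using DirectSum.induction_on with
    | zero => exact ⟨[], rfl⟩
    | add x y hx hy =>
      obtain ⟨l, hl⟩ := hx
      obtain ⟨l', hl'⟩ := hy
      exact ⟨l ++ l', by rw [List.map_append, List.sum_append, ← hl, ← hl']; rfl⟩
    | of d x =>
      induction x using TensorProduct.induction_on with
      | zero => exact ⟨[], by simp; rfl⟩
      | add x y hx hy =>
        obtain ⟨l, hl⟩ := hx
        obtain ⟨l', hl'⟩ := hy
        exact ⟨l ++ l', by
          rw [List.map_append, List.sum_append, ← hl, ← hl', map_add]; rfl⟩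
      | tmul v w =>
        refine ⟨[⟨d, v, w⟩], ?_⟩
        simp only [List.map_cons, List.map_nil, List.sum_cons, List.sum_nil, add_zero]
        unfold Bimod.tmul
        congr!
  obtain ⟨l, rfl⟩ := key t
  have h := Quot.sound (QuadRel.quad (I := I) l ht)
  rw [map_list_sum, List.map_map]
  refine Eq.trans ?_ h
  clear h ht
  induction l with
  | nil => rfl
  | cons p l ih =>
    simp only [List.map_cons, List.sum_cons, ih, Function.comp_apply, compTwo_tmul]
    rfl

/-! ### The grading by the number of generators -/

theorem base_mem_degree {a b : C} (f : a ⟶ b) : (base V I).map f ∈ degree V I 0 _ _ :=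
  Submodule.subset_span (.base f)

theorem gen_mem_degree {a b : C} (v : V.X a b) : gen V I v ∈ degree V I 1 _ _ :=
  Submodule.subset_span (.gen v)

theorem comp_mem_degree {a b c : QuadCat V I} {m n : ℕ} {x : a ⟶ b} {y : b ⟶ c}
    (hx : x ∈ degree V I m a b) (hy : y ∈ degree V I n b c) : x ≫ y ∈ degree V I (m + n) a c := by
  induction hx using Submodule.span_induction with
  | zero => simp
  | add x x' _ _ h h' => rw [Preadditive.add_comp]; exact add_mem h h'
  | smul r x _ h => rw [Linear.smul_comp]; exact Submodule.smul_mem _ r h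
  | mem x hx =>
    induction hy using Submodule.span_induction with
    | zero => simp
    | add y y' _ _ h h' => rw [Preadditive.comp_add]; exact add_mem h h'
    | smul r y _ h => rw [Linear.comp_smul]; exact Submodule.smul_mem _ r h
    | mem y hy => exact Submodule.subset_span (.comp hx hy)

/-- Spanning only. Independence of the degrees is obtained in `gr_isGrading`, from coefficients that
each vanish outside a single degree. -/
theorem iSup_degree_eq_top (a b : QuadCat V I) : ⨆ n, degree V I n a b = ⊤ := by
  refine eq_top_iff.2 fun z _ => ?_
  refine hom_induction (P := fun {a b} z => z ∈ ⨆ n, degree V I n _ _) (fun f => ?_) (fun v => ?_)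
    (fun x y hx hy => add_mem hx hy) (fun r x hx => Submodule.smul_mem _ r hx)
    (fun x y hx hy => ?_) z
  · exact Submodule.mem_iSup_of_mem 0 (base_mem_degree f)
  · exact Submodule.mem_iSup_of_mem 1 (gen_mem_degree v)
  · induction hx using Submodule.iSup_induction' with
    | zero => simp
    | add x x' _ _ h h' => rw [Preadditive.add_comp]; exact add_mem h h'
    | mem m x hx =>
      induction hy using Submodule.iSup_induction' with
      | zero => simp
      | add y y' _ _ h h' => rw [Preadditive.comp_add]; exact add_mem h h'
      | mem n y hy => exact Submodule.mem_iSup_of_mem (m + n) (comp_mem_degree hx hy)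

/-- The degree is an index of `P`, so that statements involving signs `(-1)^n` can be proved along
the monomials. -/
theorem mem_degree_induction {P : ∀ {a b : C}, ℕ → ((base V I).obj a ⟶ (base V I).obj b) → Prop}
    (hbase : ∀ {a b : C} (f : a ⟶ b), P 0 ((base V I).map f))
    (hgen : ∀ {a b : C} (v : V.X a b), P 1 (gen V I v))
    (hzero : ∀ {a b : C} {n : ℕ}, P n (0 : (base V I).obj a ⟶ (base V I).obj b))
    (hadd : ∀ {a b : C} {n : ℕ} (x y : (base V I).obj a ⟶ (base V I).obj b),
      P n x → P n y → P n (x + y))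
    (hsmul : ∀ {a b : C} {n : ℕ} (r : k) (x : (base V I).obj a ⟶ (base V I).obj b),
      P n x → P n (r • x))
    (hcomp : ∀ {a b c : C} {m n : ℕ} (x : (base V I).obj a ⟶ (base V I).obj b)
      (y : (base V I).obj b ⟶ (base V I).obj c), P m x → P n y → P (m + n) (x ≫ y))
    {a b : C} {n : ℕ} {z : (base V I).obj a ⟶ (base V I).obj b} (hz : z ∈ degree V I n _ _) :
    P n z := by
  have key : ∀ {a b : QuadCat V I} {n : ℕ} {z : a ⟶ b}, IsMonomial V I n z →
      P (a := a.obj) (b := b.obj) n z := by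
    intro a b n z hz
    induction hz with
    | base f => exact hbase f
    | gen v => exact hgen v
    | comp _ _ hx hy => exact hcomp _ _ hx hy
  refine Submodule.span_induction (p := fun z _ => P n z) (fun z hz => key hz) hzero
    (fun x y _ _ hx hy => hadd x y hx hy) (fun r x _ hx => hsmul r x hx) hz

/-- A morphism is a sum of homogeneous ones. -/
theorem degree_induction {a b : QuadCat V I} {P : (a ⟶ b) → Prop} (zero : P 0)
    (add : ∀ x y, P x → P y → P (x + y)) (mem : ∀ n x, x ∈ degree V I n a b → P x)
    (z : a ⟶ b) : P z := by
  have hz : z ∈ ⨆ n, degree V I n a b := by rw [iSup_degree_eq_top]; trivial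
  exact Submodule.iSup_induction _ (motive := P) hz mem zero add

end QuadCat

/-! ## The representation of a quadratic dual attached to a chain -/

namespace RightQuadDual

variable {k : Type u} [CommRing k]
variable {C : Type} [Category.{u} C] [Preadditive C] [Linear k C]

section

variable (k) (X : ℕ → C)

/-- The `k`-module of families of morphisms from the objects `X m`. -/
abbrev Fam (a : C) : Type u := ∀ m : ℕ, (X m ⟶ a)

/-- The functor `a ↦ ∏ m, C(X m, a)`. -/
def famFunctor : C ⥤ ModuleCat.{u} k where
  obj a := ModuleCat.of k (Fam X a)
  map s := ModuleCat.ofHom (LinearMap.pi fun m => Linear.rightComp k _ s ∘ₗ LinearMap.proj m)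
  map_id a := by ext; simp
  map_comp f g := by ext; simp

instance : (famFunctor k X).Additive where
  map_add {_ _ f g} := ModuleCat.hom_ext (LinearMap.ext fun u => funext fun m =>
    Preadditive.comp_add _ _ _ (u m) f g)

instance : (famFunctor k X).Linear k where
  map_smul f r := ModuleCat.hom_ext (LinearMap.ext fun u => funext fun m =>
    Linear.comp_smul _ _ _ (u m) r f)

end

variable {V B₂ : Bimod k C C}
  {μ : ∀ {x x' a : C}, V.X x' a →ₗ[k] V.X x x' →ₗ[k] B₂.X x a}

/-- A sequence of elements of `V` with vanishing consecutive products. -/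
structure Chain (V B₂ : Bimod k C C)
    (μ : ∀ {x x' a : C}, V.X x' a →ₗ[k] V.X x x' →ₗ[k] B₂.X x a) where
  /-- the objects -/
  X : ℕ → C
  /-- the elements of `V` -/
  D : ∀ m, V.X (X m) (X (m + 1))
  -- The morphism `u` is what a family supplies at level `m + 2`: two successive generators meet the
  -- product of `u D_{m+1}` with `D_m`.
  mul_eq_zero : ∀ (m : ℕ) (a : C) (u : X (m + 2) ⟶ a), μ (V.lact _ u (D (m + 1))) (D m) = 0

variable (S : Chain V B₂ μ)

/-- The action of a generator on families. -/
def genAct {a b : C} :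
    V.rightDual.X a b →ₗ[k] ((famFunctor k S.X).obj a ⟶ (famFunctor k S.X).obj b) where
  toFun φ := ModuleCat.ofHom (LinearMap.pi fun m =>
    (Bimod.ev φ ∘ₗ (V.lact _).flip (S.D m)) ∘ₗ LinearMap.proj (m + 1))
  map_add' _ _ := rfl
  map_smul' _ _ := rfl

theorem genAct_ract {a a' b : C} (f : a' ⟶ a) (φ : V.rightDual.X a b) :
    genAct S (V.rightDual.ract b f φ) = (famFunctor k S.X).map f ≫ genAct S φ :=
  ModuleCat.hom_ext (LinearMap.ext fun (u : Fam S.X a') => funext fun m =>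
    congrArg (Bimod.ev φ) (V.lact_comp _ (u (m + 1)) f (S.D m)).symm)

theorem genAct_lact {a b b' : C} (f : b ⟶ b') (φ : V.rightDual.X a b) :
    genAct S (V.rightDual.lact a f φ) = genAct S φ ≫ (famFunctor k S.X).map f := rfl

/-- The representation of the quadratic dual on families. -/
def repFunctor : RightQuadDual V B₂ μ ⥤ ModuleCat.{u} k :=
  QuadCat.lift (famFunctor k S.X) (genAct S)
    (genAct_ract S) (genAct_lact S)
    (fun a c t ht => by
      obtain ⟨ψ, hψ⟩ := ht
      ext u
      funext m
      change Fam S.X a at u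
      let L : Bimod.TensorX V.rightDual V.rightDual a c →ₗ[k] (S.X m ⟶ c) :=
        LinearMap.proj (R := k) (φ := fun m => (S.X m ⟶ c)) m ∘ₗ LinearMap.applyₗ (M₂ :=
          Fam S.X c) u ∘ₗ
          (ModuleCat.homLinearEquiv (S := k) (M := (famFunctor k S.X).obj a)
            (N := (famFunctor k S.X).obj c)).toLinearMap ∘ₗ
              QuadCat.compTwo _ (genAct S) (genAct_ract S) (genAct_lact S) a c
      -- At level `m` a quadratic element acts on `u` through its pairing with `u_{m+2} D_{m+1}` and
      -- `D_m`. For an element of `I^⊥` this pairing factors through their product, which is zero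
      -- along a chain.
      have hL : L = Bimod.pairing V (V.lact _ (u (m + 2)) (S.D (m + 1))) (S.D m) := by
        refine Bimod.tensor_ext fun d φ χ => ?_
        rw [Bimod.pairing_tmul]
        have h := QuadCat.compTwo_tmul (famFunctor k S.X) (genAct S) (genAct_ract S)
          (genAct_lact S) φ χ
        exact congrFun (LinearMap.congr_fun (congrArg ModuleCat.Hom.hom h) u) m
      refine (LinearMap.congr_fun hL t).trans ?_
      rw [hψ, S.mul_eq_zero, map_zero]
      rfl)

instance : (repFunctor S).Additive := by unfold repFunctor; infer_instance

instance : (repFunctor S).Linear k := by unfold repFunctor; infer_instance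

/-- The action of a morphism of the quadratic dual on families. -/
def rep {a b : C} :
    ((QuadCat.base V.rightDual (V.perp B₂ μ)).obj a ⟶ (QuadCat.base _ (V.perp B₂ μ)).obj b) →ₗ[k]
      Fam S.X a →ₗ[k] Fam S.X b where
  toFun z := ((repFunctor S).map z).hom
  map_add' x y := by rw [Functor.map_add]; rfl
  map_smul' r x := by rw [Functor.map_smul]; rfl

@[simp]
theorem rep_comp {a b c : C}
    (x : (QuadCat.base V.rightDual (V.perp B₂ μ)).obj a ⟶ (QuadCat.base _ (V.perp B₂ μ)).obj b)
    (y : (QuadCat.base V.rightDual (V.perp B₂ μ)).obj b ⟶ (QuadCat.base _ (V.perp B₂ μ)).obj c)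
    (u : Fam S.X a) : rep S (x ≫ y) u = rep S y (rep S x u) := by
  change ((repFunctor S).map (x ≫ y)).hom u = _
  rw [Functor.map_comp]
  rfl

@[simp]
theorem rep_base {a b : C} (s : a ⟶ b) (u : Fam S.X a) (m : ℕ) :
    rep S ((QuadCat.base V.rightDual (V.perp B₂ μ)).map s) u m = u m ≫ s := rfl

@[simp]
theorem rep_gen {a b : C} (φ : V.rightDual.X a b) (u : Fam S.X a) (m : ℕ) :
    rep S (QuadCat.gen V.rightDual (V.perp B₂ μ) φ) u m =
      Bimod.ev φ (V.lact _ (u (m + 1)) (S.D m)) := rfl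

/-- An element of degree `n` lowers the level of a family by `n`. -/
theorem rep_apply_eq_zero {n : ℕ} {a b : C}
    {z : (QuadCat.base V.rightDual (V.perp B₂ μ)).obj a ⟶ (QuadCat.base _ (V.perp B₂ μ)).obj b}
    (hz : z ∈ QuadCat.degree V.rightDual (V.perp B₂ μ) n _ _) (u : Fam S.X a) (m : ℕ)
    (hu : u (m + n) = 0) : rep S z u m = 0 := by
  refine QuadCat.mem_degree_induction (P := fun {a b} n z => ∀ (u : Fam S.X a) (m : ℕ),
    u (m + n) = 0 → rep S z u m = 0) (fun f u m hu => ?_) (fun v u m hu => ?_)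

           (fun {a b n} u m hu => by simp)
    (fun x y hx hy u m hu => ?_) (fun r x hx u m hu => ?_) (fun {_ _ _ m' n'} x y hx hy u m hu => ?_)
    hz u m hu
  · rw [rep_base]; exact (congrArg (· ≫ f) hu).trans Limits.zero_comp
  · rw [rep_gen, hu, map_zero, LinearMap.zero_apply, map_zero]
  · rw [map_add, LinearMap.add_apply, Pi.add_apply, hx u m hu, hy u m hu, add_zero]
  · rw [map_smul, LinearMap.smul_apply, Pi.smul_apply, hx u m hu, smul_zero]
  · rw [rep_comp]
    refine hy _ m (hx _ _ ?_)
    rwa [add_assoc, Nat.add_comm n' m']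

/-- The value of a morphism of the quadratic dual on a morphism `X n ⟶ a`. -/
def value (n : ℕ) {a b : C} (u : S.X n ⟶ a) :
    ((QuadCat.base V.rightDual (V.perp B₂ μ)).obj a ⟶ (QuadCat.base _ (V.perp B₂ μ)).obj b) →ₗ[k]
      (S.X 0 ⟶ b) :=
  LinearMap.proj 0 ∘ₗ LinearMap.applyₗ (Pi.single n u : Fam S.X a) ∘ₗ rep S

theorem value_def (n : ℕ) {a b : C} (u : S.X n ⟶ a)
    (z : (QuadCat.base V.rightDual (V.perp B₂ μ)).obj a ⟶ (QuadCat.base _ (V.perp B₂ μ)).obj b) :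
    value S n u z = rep S z (Pi.single n u : Fam S.X a) 0 := rfl

/-- Degree `n` brings level `n` down to level `0`, so nothing arrives there from a family
concentrated in another level. -/
theorem value_eq_zero {m n : ℕ} (h : m ≠ n) {a b : C} (u : S.X m ⟶ a)
    {z : (QuadCat.base V.rightDual (V.perp B₂ μ)).obj a ⟶ (QuadCat.base _ (V.perp B₂ μ)).obj b}
    (hz : z ∈ QuadCat.degree V.rightDual (V.perp B₂ μ) n _ _) : value S m u z = 0 :=
  rep_apply_eq_zero S hz _ 0 (Pi.single_eq_of_ne (by omega) _)

theorem rep_base_single {a b : C} (s : a ⟶ b) (n : ℕ) (u : S.X n ⟶ a) :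
    rep S ((QuadCat.base V.rightDual (V.perp B₂ μ)).map s) (Pi.single n u : Fam S.X a) =
      (Pi.single n (u ≫ s) : Fam S.X b) := by
  funext m
  rw [rep_base]
  by_cases h : m = n
  · subst h; simp
  · simp [Pi.single_eq_of_ne h]

theorem rep_gen_single {a b : C} (φ : V.rightDual.X a b) (n : ℕ) (u : S.X (n + 1) ⟶ a) :
    rep S (QuadCat.gen V.rightDual (V.perp B₂ μ) φ) (Pi.single (n + 1) u : Fam S.X a) =
      (Pi.single n (Bimod.ev φ (V.lact _ u (S.D n))) : Fam S.X b) := by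
  funext m
  rw [rep_gen]
  by_cases h : m = n
  · subst h; simp
  · rw [Pi.single_eq_of_ne h, Pi.single_eq_of_ne (by omega), map_zero, LinearMap.zero_apply,
      map_zero]

theorem value_base_comp {a b c : C} (s : a ⟶ b) (n : ℕ) (u : S.X n ⟶ a)
    (z : (QuadCat.base V.rightDual (V.perp B₂ μ)).obj b ⟶ (QuadCat.base _ (V.perp B₂ μ)).obj c) :
    value S n u ((QuadCat.base _ _).map s ≫ z) = value S n (u ≫ s) z := by
  rw [value_def, rep_comp, rep_base_single, value_def]

theorem value_comp_base {a b c : C} (n : ℕ) (u : S.X n ⟶ a)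
    (z : (QuadCat.base V.rightDual (V.perp B₂ μ)).obj a ⟶ (QuadCat.base _ (V.perp B₂ μ)).obj b)
    (s : b ⟶ c) :
    value S n u (z ≫ (QuadCat.base _ _).map s) = value S n u z ≫ s := by
  rw [value_def, rep_comp, rep_base, value_def]

/-- The recursion for values: the first generator consumes the step `D_n` of the chain and turns `u`
into a morphism of `C` one level lower. -/
theorem value_gen_comp {a b c : C} (φ : V.rightDual.X a b) (n : ℕ) (u : S.X (n + 1) ⟶ a)
    (z : (QuadCat.base V.rightDual (V.perp B₂ μ)).obj b ⟶ (QuadCat.base _ (V.perp B₂ μ)).obj c) :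
    value S (n + 1) u (QuadCat.gen _ _ φ ≫ z) =
      value S n (Bimod.ev φ (V.lact _ u (S.D n))) z := by
  rw [value_def, rep_comp, rep_gen_single, value_def]

end RightQuadDual

end FinKoszul

end

noncomputable section

namespace FinKoszul

universe u w

/-! ## Adding and removing a point -/

section AddPoint

/-- The map `f ⊔ 1` obtained by adding a point to source and target. -/
def addPt {m n : ℕ} (f : Fin m → Fin n) : Fin (m + 1) → Fin (n + 1) :=
  Fin.lastCases (Fin.last n) (fun i => (f i).castSucc)

@[simp]
theorem addPt_last {m n : ℕ} (f : Fin m → Fin n) : addPt f (Fin.last m) = Fin.last n := by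
  simp [addPt]

@[simp]
theorem addPt_castSucc {m n : ℕ} (f : Fin m → Fin n) (i : Fin m) :
    addPt f i.castSucc = (f i).castSucc := by
  simp [addPt]

theorem addPt_id (m : ℕ) : addPt (id : Fin m → Fin m) = id := by
  funext i
  induction i using Fin.lastCases <;> simp

theorem addPt_comp {l m n : ℕ} (g : Fin m → Fin n) (f : Fin l → Fin m) :
    addPt (g ∘ f) = addPt g ∘ addPt f := by
  funext i
  induction i using Fin.lastCases <;> simp

theorem addPt_injective {m n : ℕ} {f : Fin m → Fin n} (hf : Function.Injective f) :
    Function.Injective (addPt f) := by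
  intro i j h
  induction i using Fin.lastCases with
  | last =>
    induction j using Fin.lastCases with
    | last => rfl
    | cast j =>
      simp only [addPt_last, addPt_castSucc] at h
      exact absurd h.symm (Fin.castSucc_ne_last _)
  | cast i =>
    induction j using Fin.lastCases with
    | last => simp only [addPt_last, addPt_castSucc] at h; exact absurd h (Fin.castSucc_ne_last _)
    | cast j => simp only [addPt_castSucc, Fin.castSucc_inj] at h; rw [hf h]

theorem addPt_surjective {m n : ℕ} {f : Fin m → Fin n} (hf : Function.Surjective f) :
    Function.Surjective (addPt f) := by
  intro i
  induction i using Fin.lastCases with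
  | last => exact ⟨Fin.last m, by simp⟩
  | cast i =>
    obtain ⟨j, rfl⟩ := hf i
    exact ⟨j.castSucc, by simp⟩

/-- The map `f ⊔ 1` as an injection. -/
def addHomI {m n : ℕ} (f : (⟨⟨m⟩⟩ : FI) ⟶ ⟨⟨n⟩⟩) : (⟨⟨m + 1⟩⟩ : FI) ⟶ ⟨⟨n + 1⟩⟩ :=
  ⟨addPt f.hom, addPt_injective f.property⟩

/-- The map `f ⊔ 1` as a bijection. -/
def addHomB {m n : ℕ} (f : (⟨⟨m⟩⟩ : FB) ⟶ ⟨⟨n⟩⟩) : (⟨⟨m + 1⟩⟩ : FB) ⟶ ⟨⟨n + 1⟩⟩ :=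
  ⟨addPt f.hom, addPt_injective f.property.1, addPt_surjective f.property.2⟩

/-- The functor that adds a point, on injections. -/
def addPtI : FI ⥤ FI where
  obj a := ⟨⟨a.obj.card + 1⟩⟩
  map f := addHomI f
  map_id _ := WideSubcategory.hom_ext _ (addPt_id _)
  map_comp f g := WideSubcategory.hom_ext _ (addPt_comp g.hom f.hom)

/-- The standard injection that misses the last point. -/
def coface (n : ℕ) : (⟨⟨n⟩⟩ : FI) ⟶ ⟨⟨n + 1⟩⟩ := ⟨Fin.castSucc, Fin.castSucc_injective n⟩

section

variable (k : Type u) [CommRing k]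

/-- The linear extension of `f ↦ f ⊔ 1` on injections. -/
def addI (m n : ℕ) : (Free.of k (⟨⟨m⟩⟩ : FI) ⟶ Free.of k (⟨⟨n⟩⟩ : FI)) →ₗ[k]
    (Free.of k (⟨⟨m + 1⟩⟩ : FI) ⟶ Free.of k (⟨⟨n + 1⟩⟩ : FI)) :=
  linHom k addPtI ⟨⟨m⟩⟩ ⟨⟨n⟩⟩

end

variable {k : Type u} [CommRing k]

theorem addI_arr {m n : ℕ} (f : (⟨⟨m⟩⟩ : FI) ⟶ ⟨⟨n⟩⟩) :
    addI k m n (arr k f) = arr k (addHomI f) :=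
  linHom_arr k addPtI f

theorem addI_comp {l m n : ℕ} (x : Free.of k (⟨⟨l⟩⟩ : FI) ⟶ Free.of k (⟨⟨m⟩⟩ : FI))
    (y : Free.of k (⟨⟨m⟩⟩ : FI) ⟶ Free.of k (⟨⟨n⟩⟩ : FI)) :
    addI k l n (x ≫ y) = addI k l m x ≫ addI k m n y :=
  linHom_comp k addPtI x y

/-- The injections missing the last point form a natural transformation from the identity to the
functor that adds a point. -/
theorem comp_coface {m n : ℕ} (y : Free.of k (⟨⟨m⟩⟩ : FI) ⟶ Free.of k ⟨⟨n⟩⟩) :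
    y ≫ arr k (coface n) = arr k (coface m) ≫ addI k m n y := by
  induction y using arr_induction with
  | zero => simp
  | add x y hx hy => simp only [Preadditive.add_comp, map_add, Preadditive.comp_add, hx, hy]
  | smul r x hx => simp only [Linear.smul_comp, map_smul, Linear.comp_smul, hx]
  | arr f =>
    rw [arr_comp, addI_arr, arr_comp]
    congr 1
    exact WideSubcategory.hom_ext _ (funext fun i => (addPt_castSucc f.hom i).symm)

variable (k) in
/-- The signed sum of the injections `x + n → x + (n + 1)` that miss one of the last `n + 1`
points. -/
def altCoface (x : ℕ) : ∀ n : ℕ,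
    (Free.of k (⟨⟨x + n⟩⟩ : FI) ⟶ Free.of k (⟨⟨x + n + 1⟩⟩ : FI))
  | 0 => arr k (coface x)
  | n + 1 => arr k (coface (x + n + 1)) - addI k (x + n) (x + n + 1) (altCoface x n)

theorem altCoface_succ (x n : ℕ) : altCoface k x (n + 1) =
    arr k (coface (x + n + 1)) - addI k (x + n) (x + n + 1) (altCoface k x n) := rfl

/-- With `ι` the last coface, `D_{n+1} = ι - (D_n ⊔ 1)`. Naturality moves `ι` past `D_n`, and
functoriality of adding a point turns the remaining product into `(D_n ≫ D_{n+1}) ⊔ 1`, which is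
zero by induction. The recursive form makes explicit signs unnecessary. -/
theorem altCoface_comp (x n : ℕ) : altCoface k x n ≫ altCoface k x (n + 1) = 0 := by
  have key : ∀ n, altCoface k x n ≫ altCoface k x (n + 1) = altCoface k x n ≫
      arr k (coface (x + n + 1)) - altCoface k x n ≫
        addI k (x + n) (x + n + 1) (altCoface k x n) := fun n => Preadditive.comp_sub ..
  induction n with
  | zero => exact (key 0).trans (sub_eq_zero.2 (comp_coface (altCoface k x 0)))
  | succ n ih =>
    refine (key (n + 1)).trans (sub_eq_zero.2 ((comp_coface (altCoface k x (n + 1))).trans ?_))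
    have h3 : addI k (x + n) (x + n + 1) (altCoface k x n) ≫
        addI k (x + n + 1) (x + n + 1 + 1) (altCoface k x (n + 1)) = 0 :=
      (addI_comp (altCoface k x n) (altCoface k x (n + 1))).symm.trans
        ((congrArg _ ih).trans (map_zero _))
    have h5 : altCoface k x (n + 1) ≫ addI k (x + n + 1) (x + n + 1 + 1) (altCoface k x (n + 1)) =
        arr k (coface (x + n + 1)) ≫
          addI k (x + n + 1) (x + n + 1 + 1) (altCoface k x (n + 1)) := by
      conv_lhs => arg 1; rw [altCoface_succ]
      exact (Preadditive.sub_comp ..).trans ((congrArg _ h3).trans (sub_zero _))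
    exact h5.symm

end AddPoint

/-! ## Coefficients of a map along an injection -/

section Retract

variable (k : Type u) [CommRing k]

open Classical in
/-- For an injective map `i : c → a`, the map `k FA(x, a) → k FS(x, c)` that sends `i ∘ s` to `s`
for `s` surjective, and the maps not of this form to zero. -/
def retract {c : FS} {a : FA} (i : c.obj ⟶ a) (x : FS) :
    (Free.of k x.obj ⟶ Free.of k a) →ₗ[k] (Free.of k x ⟶ Free.of k c) :=
  arrLift k fun f => if h : ∃ s : x ⟶ c, f = s.hom ≫ i then arr k h.choose else 0

variable {k}

/-- Injectivity of `i` makes the factor `s` unique, so the choice inside `retract` is harmless. -/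
theorem retract_of_eq {c : FS} {a : FA} {i : c.obj ⟶ a} (hi : FA.isInj i) {x : FS}
    {f : x.obj ⟶ a} (s : x ⟶ c) (h : f = s.hom ≫ i) : retract k i x (arr k f) = arr k s := by
  have h' : ∃ s : x ⟶ c, f = s.hom ≫ i := ⟨s, h⟩
  rw [retract, arrLift_arr, dif_pos h']
  congr 1
  refine WideSubcategory.hom_ext _ (funext fun p => hi ?_)
  exact congrFun (h'.choose_spec.symm.trans h) p

theorem retract_of_not {c : FS} {a : FA} (i : c.obj ⟶ a) {x : FS}
    {f : x.obj ⟶ a} (h : ¬ ∃ s : x ⟶ c, f = s.hom ≫ i) : retract k i x (arr k f) = 0 := by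
  rw [retract, arrLift_arr, dif_neg h]

theorem retract_of_range_ne {c : FS} {a : FA} (i : c.obj ⟶ a) {x : FS}
    {f : x.obj ⟶ a} (h : Set.range f ≠ Set.range i) : retract k i x (arr k f) = 0 := by
  refine retract_of_not i ?_
  rintro ⟨s, rfl⟩
  exact h (Function.Surjective.range_comp s.property i)

/-- Together with `retract_of_range_ne` this reduces the computation of coefficients to a comparison
of images: a map contributes exactly when its image is that of `i`. -/
theorem exists_eq_comp_of_range_eq {c : FS} {a : FA} {i : c.obj ⟶ a} (hi : FA.isInj i) {x : FS}
    {f : x.obj ⟶ a} (h : Set.range f = Set.range i) : ∃ s : x ⟶ c, f = s.hom ≫ i := by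
  have hf : ∀ p, ∃ q, i q = f p := fun p => by
    have : f p ∈ Set.range i := h ▸ ⟨p, rfl⟩
    exact this
  choose s hs using hf
  refine ⟨⟨s, fun q => ?_⟩, (funext hs).symm⟩
  obtain ⟨p, hp⟩ : i q ∈ Set.range f := h ▸ ⟨q, rfl⟩
  exact ⟨p, hi ((hs p).trans hp)⟩

/-- Precomposition with a surjection does not change the image. This is the right `k FS`-linearity
that makes coefficients elements of the right dual. -/
theorem retract_incl_comp {c : FS} {a : FA} {i : c.obj ⟶ a} (hi : FA.isInj i) {x x' : FS}
    (p : Free.of k x' ⟶ Free.of k x) (f : Free.of k x.obj ⟶ Free.of k a) :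
    retract k i x' (inclS k x' x p ≫ f) = p ≫ retract k i x f := by
  induction p using arr_induction with
  | zero => simp
  | add s t hs ht => simp only [Preadditive.add_comp, map_add, hs, ht]
  | smul r s hs => simp only [Linear.smul_comp, map_smul, hs]
  | arr p =>
    induction f using arr_induction with
    | zero => simp
    | add s t hs ht => simp only [Preadditive.comp_add, map_add, hs, ht]
    | smul r s hs => simp only [Linear.comp_smul, map_smul, hs]
    | arr f =>
      rw [inclS_arr, arr_comp]
      have hr : Set.range (p.hom ≫ f) = Set.range f := Function.Surjective.range_comp p.property f
      by_cases h : Set.range f = Set.range i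
      · obtain ⟨s, rfl⟩ := exists_eq_comp_of_range_eq hi h
        rw [retract_of_eq hi s rfl, arr_comp]
        exact retract_of_eq hi (p ≫ s) rfl
      · rw [retract_of_range_ne i h, Limits.comp_zero]
        exact retract_of_range_ne i (hr.trans_ne h)

/-- Taking images of subsets under the injection `g` is injective, so the equality of images that
selects a coefficient is unaffected by `g`. -/
theorem retract_comp_arr {c d : FS} {a : FA} {i : c.obj ⟶ d.obj} (hi : FA.isInj i)
    {g : d.obj ⟶ a} (hg : FA.isInj g) {x : FS} (f : Free.of k x.obj ⟶ Free.of k d.obj) :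
    retract k (i ≫ g) x (f ≫ arr k g) = retract k i x f := by
  induction f using arr_induction with
  | zero => simp
  | add s t hs ht => simp only [Preadditive.add_comp, map_add, hs, ht]
  | smul r s hs => simp only [Linear.smul_comp, map_smul, hs]
  | arr f =>
    rw [arr_comp]
    by_cases h : Set.range f = Set.range i
    · obtain ⟨s, rfl⟩ := exists_eq_comp_of_range_eq hi h
      rw [retract_of_eq hi s rfl]
      exact retract_of_eq (hg.comp hi) s rfl
    · rw [retract_of_range_ne i h]
      refine retract_of_range_ne _ fun h' => h ?_
      have h' : Set.range (g ∘ f) = Set.range (g ∘ i) := h'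
      rw [Set.range_comp, Set.range_comp] at h'
      exact hg.image_injective h'

theorem retract_id {c : FS} {x : FS} (f : Free.of k x.obj ⟶ Free.of k c.obj) :
    retract k (𝟙 c.obj) x f = rightAug k x c f := by
  induction f using arr_induction with
  | zero => simp
  | add s t hs ht => simp only [map_add, hs, ht]
  | smul r s hs => simp only [map_smul, hs]
  | arr f =>
    by_cases h : FA.isSurj f
    · rw [rightAug_of_surj k f h]
      exact retract_of_eq Function.injective_id (surjHom f h) rfl
    · rw [rightAug_of_not_surj k f h]
      refine retract_of_not _ ?_
      rintro ⟨s, rfl⟩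
      exact h s.property

theorem rightAug_inclI {a b : FI} (h : a.obj.card < b.obj.card)
    (v : Free.of k a ⟶ Free.of k b) :
    rightAug k ⟨a.obj⟩ ⟨b.obj⟩ (inclI k a b v) = 0 := by
  induction v using arr_induction with
  | zero => simp
  | add s t hs ht => simp only [map_add, hs, ht, add_zero]
  | smul r s hs => simp only [map_smul, hs, smul_zero]
  | arr f =>
    rw [inclI_arr]
    refine rightAug_of_not_surj k (a := ⟨a.obj⟩) (b := ⟨b.obj⟩) _ fun h' => ?_
    have := Fintype.card_le_of_surjective f.hom h'
    simp only [Fintype.card_fin] at this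
    omega

/-! ### The coefficient of the standard injection -/

variable (k) in
/-- The coefficient of the standard injection `m → m + 1`. -/
def chop (m : ℕ) (x : FS) :
    (Free.of k x.obj ⟶ Free.of k (⟨m + 1⟩ : FA)) →ₗ[k] (Free.of k x ⟶ Free.of k ⟨⟨m⟩⟩) :=
  retract k (c := ⟨⟨m⟩⟩) (coface m).hom x

theorem range_coface (m : ℕ) : Set.range (coface m).hom = {Fin.last m}ᶜ := by
  ext i
  exact Fin.exists_castSucc_eq

theorem chop_incl_comp {m : ℕ} {x x' : FS} (p : Free.of k x' ⟶ Free.of k x)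
    (f : Free.of k x.obj ⟶ Free.of k (⟨m + 1⟩ : FA)) :
    chop k m x' (inclS k x' x p ≫ f) = p ≫ chop k m x f :=
  retract_incl_comp (coface m).property p f

theorem chop_comp_coface {m : ℕ} {x : FS} (f : Free.of k x.obj ⟶ Free.of k (⟨m⟩ : FA)) :
    chop k m x (f ≫ arr k (coface m).hom) = rightAug k x ⟨⟨m⟩⟩ f := by
  rw [← retract_id]
  exact retract_comp_arr (c := ⟨⟨m⟩⟩) (d := ⟨⟨m⟩⟩) (i := 𝟙 _) Function.injective_id
    (coface m).property f

/-- A surjection has full image, so the coefficient vanishes on `G_0` and will descend to `gr_1`. -/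
theorem chop_incl {m : ℕ} {x : FS} (p : Free.of k x ⟶ Free.of k ⟨⟨m + 1⟩⟩) :
    chop k m x (inclS k x ⟨⟨m + 1⟩⟩ p) = 0 := by
  induction p using arr_induction with
  | zero => simp
  | add s t hs ht => simp only [map_add, hs, ht, add_zero]
  | smul r s hs => simp only [map_smul, hs, smul_zero]
  | arr p =>
    rw [inclS_arr]
    refine retract_of_range_ne _ fun h => ?_
    rw [range_coface, p.property.range_eq] at h
    exact (h ▸ Set.mem_univ (Fin.last m) : Fin.last m ∈ ({Fin.last m}ᶜ : Set _)) rfl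

/-- A map of defect at most one is surjective or misses exactly one point. -/
theorem filt_one_induction {x a : FA} {P : (Free.of k x ⟶ Free.of k a) → Prop} (zero : P 0)
    (add : ∀ v w, P v → P w → P (v + w)) (smul : ∀ (r : k) v, P v → P (r • v))
    (surj : ∀ f : x ⟶ a, FA.isSurj f → P (arr k f))
    (miss : ∀ (f : x ⟶ a) (y : Fin a.card), Set.range f = {y}ᶜ → P (arr k f))
    {v : Free.of k x ⟶ Free.of k a} (hv : v ∈ filt k 1 x a) : P v := by
  induction hv using Submodule.span_induction with
  | zero => exact zero
  | add v w _ _ hv hw => exact add v w hv hw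
  | smul r v _ hv => exact smul r v hv
  | mem v hv =>
    obtain ⟨f, hf, rfl⟩ := hv
    rw [mem_filtSet_iff] at hf
    have hf : (Set.range f)ᶜ.ncard ≤ 1 := by exact_mod_cast hf
    rcases Set.Subsingleton.eq_empty_or_singleton
      (Set.ncard_le_one_iff_subsingleton.1 hf) with h | ⟨y, h⟩
    · exact surj f (Set.range_eq_univ.1 (Set.compl_empty_iff.1 h))
    · exact miss f y (by rw [← h, compl_compl])

/-- The key property of the coefficient of the standard injection. -/
theorem chop_comp {m : ℕ} {x x' : FS} (w : Free.of k x'.obj ⟶ Free.of k x.obj)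
    {v : Free.of k x.obj ⟶ Free.of k (⟨m + 1⟩ : FA)} (hv : v ∈ filt k 1 x.obj ⟨m + 1⟩) :
    chop k m x' (w ≫ v) = rightAug k x' ⟨⟨m⟩⟩ (w ≫ inclS k x ⟨⟨m⟩⟩ (chop k m x v)) +
      chop k m x' (w ≫ inclS k x ⟨⟨m + 1⟩⟩ (rightAug k x ⟨⟨m + 1⟩⟩ v)) := by
  refine filt_one_induction (P := fun v => chop k m x' (w ≫ v) =
    rightAug k x' ⟨⟨m⟩⟩ (w ≫ inclS k x ⟨⟨m⟩⟩ (chop k m x v)) +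
      chop k m x' (w ≫ inclS k x ⟨⟨m + 1⟩⟩ (rightAug k x ⟨⟨m + 1⟩⟩ v))) ?_ ?_ ?_ ?_ ?_ hv
  · simp
  · intro v v' h h'
    simp only [Preadditive.comp_add, map_add, h, h']
    abel
  · intro r v h
    simp only [Linear.comp_smul, map_smul, h, smul_add]
  · intro f hf
    have h1 : arr k f = inclS k x ⟨⟨m + 1⟩⟩ (arr k (surjHom (b := ⟨⟨m + 1⟩⟩) f hf)) := by
      rw [inclS_arr]; rfl
    rw [h1, chop_incl, rightAug_incl]
    simp
  · intro f y hy
    have h0 : ¬ FA.isSurj f := fun h => by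
      rw [Function.Surjective.range_eq h] at hy
      exact (hy ▸ Set.mem_univ y : y ∈ ({y}ᶜ : Set _)) rfl
    have h2 := rightAug_of_not_surj k (a := x) (b := ⟨⟨m + 1⟩⟩) f h0
    rw [h2, map_zero, Limits.comp_zero, map_zero, add_zero]
    -- Since `f` is not surjective, only the term containing `chop` of `f` is left. If the missed
    -- point is not the last one, every composite through `f` misses it too, and both sides vanish.
    by_cases hl : y = Fin.last m
    · subst hl
      obtain ⟨s, rfl⟩ := exists_eq_comp_of_range_eq (c := ⟨⟨m⟩⟩) (coface m).property
        (hy.trans (range_coface m).symm)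
      have h3 : chop k m x (arr k (s.hom ≫ (coface m).hom)) = arr k s :=
        retract_of_eq (coface m).property s rfl
      rw [h3, inclS_arr, ← arr_comp, ← Category.assoc]
      exact chop_comp_coface _
    · have h3 : chop k m x (arr k f) = 0 := by
        refine retract_of_range_ne _ fun h => hl ?_
        rw [range_coface, hy] at h
        exact Set.singleton_injective (compl_injective h)
      rw [h3, map_zero, Limits.comp_zero, map_zero]
      clear hv h2 h3
      induction w using arr_induction with
      | zero => simp
      | add s t hs ht => simp only [Preadditive.add_comp, map_add, hs, ht, add_zero]
      | smul r s hs => simp only [Linear.smul_comp, map_smul, hs, smul_zero]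
      | arr g =>
        rw [arr_comp]
        refine retract_of_range_ne _ fun h => hl ?_
        rw [range_coface] at h
        have h4 : y ∉ Set.range (g ≫ f) := by
          rintro ⟨p, hp⟩
          have : y ∈ Set.range f := ⟨g p, hp⟩
          rw [hy] at this
          exact this rfl
        rw [h] at h4
        simpa using h4

/-! ### Expansion of `G_1` along the missed point -/

/-- The transposition of a point and the last one. -/
def toLast {m : ℕ} (y : Fin (m + 1)) : (⟨⟨m + 1⟩⟩ : FB) ⟶ ⟨⟨m + 1⟩⟩ :=
  ⟨Equiv.swap y (Fin.last m), (Equiv.swap y (Fin.last m)).bijective⟩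

theorem toLast_comp_toLast {m : ℕ} (y : Fin (m + 1)) : (toLast y).hom ≫ (toLast y).hom = 𝟙 _ := by
  funext p
  exact Equiv.swap_apply_self y (Fin.last m) p

theorem range_comp_toLast {m : ℕ} (y : Fin (m + 1)) {x : FA} (f : x ⟶ ⟨m + 1⟩) {y' : Fin (m + 1)}
    (hf : Set.range f = {y'}ᶜ) :
    Set.range (f ≫ (toLast y).hom) = {Equiv.swap y (Fin.last m) y'}ᶜ := by
  have h1 : Set.range (f ≫ (toLast y).hom) =
    Equiv.swap y (Fin.last m) '' Set.range f := Set.range_comp (Equiv.swap y (Fin.last m)) f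
  rw [h1, hf, Set.image_compl_eq (Equiv.bijective _), Set.image_singleton]

/-- The expansion of a map that misses exactly one point. -/
theorem sum_chop {m : ℕ} {x : FS} (f : x.obj ⟶ ⟨m + 1⟩) {y : Fin (m + 1)}
    (hf : Set.range f = {y}ᶜ) :
    ∑ z : Fin (m + 1), inclS k x ⟨⟨m⟩⟩ (chop k m x (arr k f ≫ arr k (toLast z).hom)) ≫
      arr k ((coface m).hom ≫ (toLast z).hom) = arr k f := by
  -- After `z` is exchanged with the last point, the image is the complement of the last point only
  -- for `z = y`.
  rw [Finset.sum_eq_single y]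
  · rw [arr_comp]
    have h1 := range_comp_toLast y f hf
    rw [Equiv.swap_apply_left] at h1
    obtain ⟨s, hs⟩ := exists_eq_comp_of_range_eq (c := ⟨⟨m⟩⟩) (coface m).property
      (h1.trans (range_coface m).symm)
    have h3 : chop k m x (arr k (f ≫ (toLast y).hom)) = arr k s :=
      retract_of_eq (coface m).property s hs
    rw [h3, inclS_arr, arr_comp]
    congr 1
    refine (Category.assoc ..).symm.trans ?_
    refine (congrArg (· ≫ (toLast y).hom) hs.symm).trans ?_
    rw [Category.assoc, toLast_comp_toLast, Category.comp_id]
  · intro z _ hz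
    rw [arr_comp]
    have h3 : chop k m x (arr k (f ≫ (toLast z).hom)) = 0 := by
      refine retract_of_range_ne _ fun h => hz ?_
      rw [range_coface, range_comp_toLast z f hf] at h
      have h5 := Set.singleton_injective (compl_injective h)
      exact ((Equiv.swap_apply_eq_iff.1 h5).trans (Equiv.swap_apply_right _ _)).symm
    rw [h3, map_zero, Limits.zero_comp]
  · simp

/-- The expansion of an element of `G_1`, modulo `G_0`. -/
theorem sum_chop_sub_mem {m : ℕ} {x : FS} {v : Free.of k x.obj ⟶ Free.of k (⟨m + 1⟩ : FA)}
    (hv : v ∈ filt k 1 x.obj ⟨m + 1⟩) :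
    ∑ z : Fin (m + 1), inclS k x ⟨⟨m⟩⟩ (chop k m x (v ≫ arr k (toLast z).hom)) ≫
      arr k ((coface m).hom ≫ (toLast z).hom) - v ∈ filt k 0 x.obj ⟨m + 1⟩ := by
  refine filt_one_induction (P := fun v => ∑ z : Fin (m + 1),
    inclS k x ⟨⟨m⟩⟩ (chop k m x (v ≫ arr k (toLast z).hom)) ≫
      arr k ((coface m).hom ≫ (toLast z).hom) - v ∈ filt k 0 x.obj ⟨m + 1⟩) ?_ ?_ ?_ ?_ ?_ hv
  · simp
  · intro v w hv hw
    have := add_mem hv hw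
    simp only [Preadditive.add_comp, map_add, Finset.sum_add_distrib]
    convert this using 1
    abel
  · intro r v hv
    have := Submodule.smul_mem _ r hv
    simp only [Linear.smul_comp, map_smul, ← Finset.smul_sum, ← smul_sub]
    exact this
  · intro f hf
    -- A surjection followed by a transposition is still surjective, so the whole sum vanishes and
    -- the difference is `-f`, an element of `G_0`.
    have h1 : ∀ z, chop k m x (arr k f ≫ arr k (toLast z).hom) = 0 := fun z => by
      rw [arr_comp]
      refine (congrArg (chop k m x) (inclS_arr k (surjHom (a := x) (b := ⟨⟨m + 1⟩⟩)
        (f ≫ (toLast z).hom) ?_)).symm).trans (chop_incl _)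
      exact (toLast z).property.2.comp hf
    simp only [h1, map_zero, Limits.zero_comp, Finset.sum_const_zero, zero_sub, neg_mem_iff]
    exact (inclS_arr k (surjHom (a := x) (b := ⟨⟨m + 1⟩⟩) f hf)) ▸ incl_mem_filt k _
  · intro f y hy
    rw [sum_chop f hy, sub_self]
    exact zero_mem _

end Retract

/-! ## Retractions onto bijections and injections -/

section

variable (k : Type u) [CommRing k]

open Classical in
/-- The projection of `k FS` onto `k FB`. -/
def toBijPart (a b : FB) :
    (Free.of k (⟨a.obj⟩ : FS) ⟶ Free.of k (⟨b.obj⟩ : FS)) →ₗ[k] (Free.of k a ⟶ Free.of k b) :=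
  arrLift k fun f => if h : FA.isBij f.hom then arr k ⟨f.hom, h⟩ else 0

open Classical in
/-- The projection of `k FA` onto `k FI`. -/
def toInjPart (a b : FI) :
    (Free.of k a.obj ⟶ Free.of k b.obj) →ₗ[k] (Free.of k a ⟶ Free.of k b) :=
  arrLift k fun f => if h : FA.isInj f then arr k ⟨f, h⟩ else 0

variable {k}

theorem toBijPart_inclBS {a b : FB} (r : Free.of k a ⟶ Free.of k b) :
    toBijPart k a b (inclBS k a b r) = r := by
  induction r using arr_induction with
  | zero => simp
  | add s t hs ht => simp only [map_add, hs, ht]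
  | smul r s hs => simp only [map_smul, hs]
  | arr f =>
    rw [inclBS_arr, toBijPart, arrLift_arr]
    exact dif_pos f.property

/-- Identities in `k FB` are verified inside `k FS`, where coefficients take their values. -/
theorem inclBS_injective (a b : FB) : Function.Injective (inclBS k a b) :=
  Function.LeftInverse.injective toBijPart_inclBS

theorem toInjPart_inclI {a b : FI} (r : Free.of k a ⟶ Free.of k b) :
    toInjPart k a b (inclI k a b r) = r := by
  induction r using arr_induction with
  | zero => simp
  | add s t hs ht => simp only [map_add, hs, ht]
  | smul r s hs => simp only [map_smul, hs]
  | arr f =>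
    rw [inclI_arr, toInjPart, arrLift_arr]
    exact dif_pos f.property

theorem inclI_injective (a b : FI) : Function.Injective (inclI k a b) :=
  Function.LeftInverse.injective toInjPart_inclI

/-- A surjection between sets of the same size is bijective. -/
theorem inclBS_toBijPart {a b : FB} (h : a.obj.card = b.obj.card)
    (s : Free.of k (⟨a.obj⟩ : FS) ⟶ Free.of k (⟨b.obj⟩ : FS)) :
    inclBS k a b (toBijPart k a b s) = s := by
  induction s using arr_induction with
  | zero => simp
  | add s t hs ht => simp only [map_add, hs, ht]
  | smul r s hs => simp only [map_smul, hs]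
  | arr f =>
    have hf : FA.isBij f.hom :=
      (Fintype.bijective_iff_surjective_and_card _).2 ⟨f.property, by simpa using h⟩
    rw [toBijPart, arrLift_arr, dif_pos hf]
    exact inclBS_arr k _

theorem inclBS_comp {a b c : FB} (x : Free.of k a ⟶ Free.of k b) (y : Free.of k b ⟶ Free.of k c) :
    inclBS k a c (x ≫ y) = inclBS k a b x ≫ inclBS k b c y :=
  linHom_comp k bijToSurj x y

end

end FinKoszul

end

noncomputable section

namespace FinKoszul

universe u w

/-! ## Signed systems -/

/-- A bijection between standard finite sets as a morphism of `FB`. -/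
def bijHom {m n : ℕ} (e : Fin m ≃ Fin n) : (⟨⟨m⟩⟩ : FB) ⟶ ⟨⟨n⟩⟩ := ⟨e, e.bijective⟩

theorem exists_bijHom_eq {m n : ℕ} (f : (⟨⟨m⟩⟩ : FB) ⟶ ⟨⟨n⟩⟩) :
    ∃ e : Fin m ≃ Fin n, f = bijHom e :=
  ⟨Equiv.ofBijective f.hom f.property, rfl⟩

/-- The standard finite sets as objects of `k FB`. -/
abbrev pts (k : Type u) (m : ℕ) : Free k FB := Free.of k ⟨⟨m⟩⟩

/-- The class of a bijection in `k FB`. -/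
def bijArr (k : Type u) [CommRing k] {m n : ℕ} (e : Fin m ≃ Fin n) : pts k m ⟶ pts k n :=
  arr k (bijHom e)

theorem bijArr_comp (k : Type u) [CommRing k] {l m n : ℕ} (e : Fin l ≃ Fin m) (e' : Fin m ≃ Fin n) :
    bijArr k e ≫ bijArr k e' = bijArr k (e.trans e') :=
  (arr_comp k (bijHom e) (bijHom e')).trans rfl

theorem bijArr_refl (k : Type u) [CommRing k] (m : ℕ) :
    bijArr k (Equiv.refl (Fin m)) = 𝟙 (pts k m) := rfl

/-- The permutation `α ⊔ β` of `x + n`. -/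
def blockPerm {x n : ℕ} (α : Equiv.Perm (Fin x)) (β : Equiv.Perm (Fin n)) :
    Equiv.Perm (Fin (x + n)) :=
  finSumFinEquiv.permCongr (Equiv.Perm.sumCongr α β)

@[simp]
theorem blockPerm_castAdd {x n : ℕ} (α : Equiv.Perm (Fin x)) (β : Equiv.Perm (Fin n)) (i : Fin x) :
    blockPerm α β (Fin.castAdd n i) = Fin.castAdd n (α i) := by
  simp [blockPerm]

@[simp]
theorem blockPerm_natAdd {x n : ℕ} (α : Equiv.Perm (Fin x)) (β : Equiv.Perm (Fin n)) (i : Fin n) :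
    blockPerm α β (Fin.natAdd x i) = Fin.natAdd x (β i) := by
  simp [blockPerm]

theorem blockPerm_trans {x n : ℕ} (α α' : Equiv.Perm (Fin x)) (β β' : Equiv.Perm (Fin n)) :
    (blockPerm α β).trans (blockPerm α' β') = blockPerm (α.trans α') (β.trans β') := by
  ext i
  induction i using Fin.addCases <;> simp

theorem blockPerm_refl {x n : ℕ} :
    blockPerm (Equiv.refl (Fin x)) (Equiv.refl (Fin n)) = Equiv.refl _ := by
  ext i
  induction i using Fin.addCases <;> simp

theorem blockPerm_refl_swap {x n : ℕ} (i j : Fin n) :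
    blockPerm (Equiv.refl (Fin x)) (Equiv.swap i j) =
      Equiv.swap (Fin.natAdd x i) (Fin.natAdd x j) := by
  rw [blockPerm]
  erw [Equiv.Perm.sumCongr_refl_swap]
  rw [Equiv.permCongr_def, Equiv.symm_trans_swap_trans]
  simp

/-- Naturality of `δ` concerns bijections of the form `f ⊔ 1`; this identity makes it applicable to
permutations of the first block. -/
theorem addHomB_blockPerm {x n : ℕ} (α : Equiv.Perm (Fin x)) :
    addHomB (bijHom (blockPerm α (Equiv.refl (Fin n)))) =
      bijHom (blockPerm α (Equiv.refl (Fin (n + 1)))) := by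
  refine WideSubcategory.hom_ext _ (funext fun i => ?_)
  change addPt (blockPerm α (Equiv.refl (Fin n))) i = blockPerm α (Equiv.refl (Fin (n + 1))) i
  induction i using Fin.lastCases with
  | last =>
    rw [addPt_last]
    exact (blockPerm_natAdd α (Equiv.refl (Fin (n + 1))) (Fin.last n)).symm
  | cast i =>
    rw [addPt_castSucc]
    induction i using Fin.addCases with
    | left i =>
      rw [blockPerm_castAdd]
      exact (blockPerm_castAdd α (Equiv.refl (Fin (n + 1))) i).symm
    | right i =>
      rw [blockPerm_natAdd]
      exact (blockPerm_natAdd α (Equiv.refl (Fin (n + 1))) i.castSucc).symm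

theorem addHomB_swap {n : ℕ} (i : Fin n) :
    addHomB (bijHom (Equiv.swap i.castSucc i.succ)) =
      bijHom (Equiv.swap i.castSucc.castSucc i.castSucc.succ) := by
  refine WideSubcategory.hom_ext _ (funext fun j => ?_)
  change addPt (Equiv.swap i.castSucc i.succ) j = Equiv.swap i.castSucc.castSucc i.castSucc.succ j
  have hi : i.castSucc.succ = i.succ.castSucc := Fin.succ_castSucc i
  rw [hi]
  induction j using Fin.lastCases with
  | last =>
    rw [addPt_last, Equiv.swap_apply_of_ne_of_ne] <;> exact (Fin.castSucc_ne_last _).symm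
  | cast j =>
    rw [addPt_castSucc]
    exact ((Fin.castSucc_injective _).swap_apply _ _ _).symm

variable {k : Type u} [CommRing k]
variable {Q : Type w} [Category.{u} Q] [Preadditive Q]

/-- Morphisms `δ : m + 1 → m` in a category over `k FB` that are natural in bijections and
anticommute. -/
structure SignedSystem (b : Free k FB ⥤ Q) where
  /-- the morphisms -/
  δ : ∀ m : ℕ, b.obj (pts k (m + 1)) ⟶ b.obj (pts k m)
  nat : ∀ {m : ℕ} (f : (⟨⟨m⟩⟩ : FB) ⟶ ⟨⟨m⟩⟩),
    b.map (arr k (addHomB f) : pts k (m + 1) ⟶ pts k (m + 1)) ≫ δ m =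
      δ m ≫ b.map (arr k f : pts k m ⟶ pts k m)
  swap : ∀ m : ℕ, b.map (bijArr k (Equiv.swap (Fin.last m).castSucc (Fin.last m).succ)) ≫
    δ (m + 1) ≫ δ m = -(δ (m + 1) ≫ δ m)

namespace SignedSystem

variable {b : Free k FB ⥤ Q} (S : SignedSystem b)

/-- The iterate `x + n → x` of the morphisms `δ`. -/
def iter (x : ℕ) : ∀ n : ℕ, b.obj (pts k (x + n)) ⟶ b.obj (pts k x)
  | 0 => 𝟙 _
  | n + 1 => S.δ (x + n) ≫ iter x n

theorem iter_succ (x n : ℕ) : S.iter x (n + 1) = S.δ (x + n) ≫ S.iter x n := rfl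

/-- A permutation of the surviving points fixes every removed point, so naturality carries it past
the `δ` one at a time. -/
theorem blockPerm_comp_iter {x : ℕ} (n : ℕ) (α : Equiv.Perm (Fin x)) :
    b.map (bijArr k (blockPerm α (Equiv.refl (Fin n)))) ≫ S.iter x n =
      S.iter x n ≫ b.map (bijArr k α) := by
  induction n with
  | zero =>
    have h : blockPerm α (Equiv.refl (Fin 0)) = α := by
      ext i
      exact congrArg Fin.val (blockPerm_castAdd α (Equiv.refl (Fin 0)) i)
    change b.map (bijArr k (blockPerm α (Equiv.refl (Fin 0)))) ≫ 𝟙 _ = 𝟙 _ ≫ b.map (bijArr k α)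
    rw [Category.id_comp, Category.comp_id, h]
  | succ n ih =>
    rw [iter_succ, Category.assoc, ← ih, ← Category.assoc, ← Category.assoc]
    congr 1
    refine Eq.trans ?_ (S.nat (bijHom (blockPerm α (Equiv.refl (Fin n)))))
    rw [addHomB_blockPerm]
    rfl

/-- The transposition of the last two points is absorbed by the anticommutation of the first two
`δ`. A lower one fixes the last point, passes the first `δ` by naturality, and is treated by
induction. The bound `x ≤ i` keeps it among the removed points. -/
theorem swap_comp_iter (x n : ℕ) (i : Fin (x + n)) (hi : x ≤ i.val) :
    b.map (bijArr k (Equiv.swap i.castSucc i.succ)) ≫ S.iter x (n + 1) = -S.iter x (n + 1) := by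
  induction n with
  | zero => exact absurd i.isLt (not_lt.2 hi)
  | succ n ih =>
    induction i using Fin.lastCases with
    | last =>
      have h : S.iter x (n + 1 + 1) = (S.δ (x + n + 1) ≫ S.δ (x + n)) ≫ S.iter x n :=
        (Category.assoc ..).symm
      rw [h, ← Preadditive.neg_comp, ← S.swap (x + n), Category.assoc, Category.assoc,
        Category.assoc]
      rfl
    | cast i =>
      rw [iter_succ, ← Category.assoc]
      have h1 := S.nat (bijHom (Equiv.swap i.castSucc i.succ))
      rw [addHomB_swap] at h1
      refine (congrArg (· ≫ _) h1).trans ?_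
      rw [Category.assoc, ← Preadditive.comp_neg]
      exact congrArg (_ ≫ ·) (ih i hi)

/-- Adjacent transpositions generate the symmetric group, each of them contributes `-1`, and the
sign is multiplicative. -/
theorem refl_blockPerm_comp_iter (x n : ℕ) (β : Equiv.Perm (Fin n)) :
    b.map (bijArr k (blockPerm (Equiv.refl (Fin x)) β)) ≫ S.iter x n =
      (Equiv.Perm.sign β : ℤ) • S.iter x n := by
  cases n with
  | zero =>
    have h : β = Equiv.refl _ := Subsingleton.elim _ _
    rw [h, blockPerm_refl, bijArr_refl, b.map_id, Category.id_comp, Equiv.Perm.sign_refl]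
    simp
  | succ n =>
    have hβ : β ∈ Submonoid.closure (Set.range fun i : Fin n => Equiv.swap i.castSucc i.succ) := by
      rw [Equiv.Perm.mclosure_swap_castSucc_succ]; trivial
    induction hβ using Submonoid.closure_induction with
    | mem _ h =>
      obtain ⟨i, rfl⟩ := h
      have hne : i.castSucc ≠ i.succ := (Fin.castSucc_lt_succ (i := i)).ne
      simp only [Equiv.Perm.sign_swap hne, Units.val_neg, Units.val_one, neg_smul, one_smul]
      rw [blockPerm_refl_swap]
      exact S.swap_comp_iter x n (Fin.natAdd x i) (by simp)
    | one =>
      have h : blockPerm (Equiv.refl (Fin x)) (1 : Equiv.Perm (Fin (n + 1))) = Equiv.refl _ :=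
        blockPerm_refl
      rw [h, bijArr_refl, b.map_id, Category.id_comp, Equiv.Perm.sign_one]
      simp
    | mul σ τ _ _ hσ hτ =>
      have h : blockPerm (Equiv.refl (Fin x)) (σ * τ) = (blockPerm (Equiv.refl (Fin x)) τ).trans
        (blockPerm (Equiv.refl (Fin x)) σ) := by rw [blockPerm_trans]; rfl
      rw [h, ← bijArr_comp, b.map_comp, Category.assoc, hσ, Preadditive.comp_zsmul, hτ, smul_smul,
        map_mul, Units.val_mul]

theorem blockPerm_comp_iter' {x n : ℕ} (α : Equiv.Perm (Fin x)) (β : Equiv.Perm (Fin n)) :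
    b.map (bijArr k (blockPerm α β)) ≫ S.iter x n =
      (Equiv.Perm.sign β : ℤ) • S.iter x n ≫ b.map (bijArr k α) := by
  have h : blockPerm α β = (blockPerm (Equiv.refl _) β).trans (blockPerm α (Equiv.refl _)) := by
    rw [blockPerm_trans]; rfl
  rw [h, ← bijArr_comp, b.map_comp, Category.assoc, S.blockPerm_comp_iter, ← Category.assoc,
    S.refl_blockPerm_comp_iter, Preadditive.zsmul_comp]

end SignedSystem

/-! ## The anticommutation of coefficients -/

/-- The standard injection `m → m + 2`. -/
def cofaceTwo (m : ℕ) : (⟨m⟩ : FA) ⟶ ⟨m + 2⟩ := (coface m).hom ≫ (coface (m + 1)).hom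

theorem cofaceTwo_injective (m : ℕ) : FA.isInj (cofaceTwo m) :=
  (coface (m + 1)).property.comp (coface m).property

/-- The transposition of the last two points. -/
def swapLast (m : ℕ) : (⟨m + 2⟩ : FA) ⟶ ⟨m + 2⟩ :=
  Equiv.swap (Fin.last m).castSucc (Fin.last m).succ

theorem cofaceTwo_comp_swapLast (m : ℕ) : cofaceTwo m ≫ swapLast m = cofaceTwo m := by
  funext i
  change Equiv.swap (Fin.last m).castSucc (Fin.last m).succ i.castSucc.castSucc =
    i.castSucc.castSucc
  refine Equiv.swap_apply_of_ne_of_ne (fun h => ?_) (fun h => ?_)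
  · have := congrArg Fin.val h; simp at this; omega
  · have := congrArg Fin.val h; simp at this; omega

variable (k) in
/-- The coefficient of the standard injection `m → m + 2`. -/
def chopTwo (m : ℕ) (x : FS) :
    (Free.of k x.obj ⟶ Free.of k (⟨m + 2⟩ : FA)) →ₗ[k] (Free.of k x ⟶ Free.of k ⟨⟨m⟩⟩) :=
  retract k (c := ⟨⟨m⟩⟩) (cofaceTwo m) x

theorem chopTwo_comp_coface {m : ℕ} {x : FS} (f : Free.of k x.obj ⟶ Free.of k (⟨m + 1⟩ : FA)) :
    chopTwo k m x (f ≫ arr k (coface (m + 1)).hom) = chop k m x f :=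
  retract_comp_arr (c := ⟨⟨m⟩⟩) (d := ⟨⟨m + 1⟩⟩) (coface m).property (coface (m + 1)).property f

/-- The exchanged points are exactly those missed by the standard injection `m → m + 2`, so this
injection is unchanged. -/
theorem chopTwo_comp_swapLast {m : ℕ} {x : FS} (f : Free.of k x.obj ⟶ Free.of k (⟨m + 2⟩ : FA)) :
    chopTwo k m x (f ≫ arr k (swapLast m)) = chopTwo k m x f := by
  have h := retract_comp_arr (k := k) (c := ⟨⟨m⟩⟩) (d := ⟨⟨m + 2⟩⟩) (cofaceTwo_injective m)
    (g := swapLast m) (Equiv.injective _) f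
  rw [cofaceTwo_comp_swapLast] at h
  exact h

theorem chopTwo_incl_comp {m : ℕ} {x x' : FS} (p : Free.of k x' ⟶ Free.of k x)
    (f : Free.of k x.obj ⟶ Free.of k (⟨m + 2⟩ : FA)) :
    chopTwo k m x' (inclS k x' x p ≫ f) = p ≫ chopTwo k m x f :=
  retract_incl_comp (cofaceTwo_injective m) p f

theorem last_notMem_range_cofaceTwo (m : ℕ) : (Fin.last m).succ ∉ Set.range (cofaceTwo m) := by
  rintro ⟨i, hi⟩
  have := congrArg Fin.val hi
  change i.val = m + 1 at this
  have h2 : i.val < m := i.isLt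
  omega

theorem castSucc_last_notMem_range_cofaceTwo (m : ℕ) :
    (Fin.last m).castSucc ∉ Set.range (cofaceTwo m) := by
  rintro ⟨i, hi⟩
  have := congrArg Fin.val hi
  change i.val = m at this
  have h2 : i.val < m := i.isLt
  omega

/-- A map of defect at most one hits at least one of the last two points, unlike the standard
injection `m → m + 2`. Hence the coefficient descends to `gr_2`. -/
theorem chopTwo_of_filt_one {m : ℕ} {x : FS} {v : Free.of k x.obj ⟶ Free.of k (⟨m + 2⟩ : FA)}
    (hv : v ∈ filt k 1 x.obj ⟨m + 2⟩) : chopTwo k m x v = 0 := by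
  refine filt_one_induction (P := fun v => chopTwo k m x v = 0) (map_zero _) ?_ ?_ ?_ ?_ hv
  · intro v w hv hw; rw [map_add, hv, hw, add_zero]
  · intro r v hv; rw [map_smul, hv, smul_zero]
  · intro f hf
    refine retract_of_range_ne _ fun h => last_notMem_range_cofaceTwo m ?_
    rw [← h, hf.range_eq]
    trivial
  · intro f y hy
    refine retract_of_range_ne _ fun h => ?_
    rw [hy] at h
    have h1 := last_notMem_range_cofaceTwo m
    have h2 := castSucc_last_notMem_range_cofaceTwo m
    rw [← h] at h1 h2
    simp only [Set.mem_compl_iff, Set.mem_singleton_iff, not_not] at h1 h2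
    have h3 := congrArg Fin.val (h1.trans h2.symm)
    simp at h3

theorem chop_of_range {m : ℕ} {x : FS} {f : x.obj ⟶ (⟨m + 1⟩ : FA)} {y : Fin (m + 1)}
    (hy : Set.range f = {y}ᶜ) (hl : y ≠ Fin.last m) : chop k m x (arr k f) = 0 := by
  refine retract_of_range_ne _ fun h => hl ?_
  rw [range_coface, hy] at h
  exact Set.singleton_injective (compl_injective h)

/-- A map missing only the last point factors through the last coface. Once this coface is stripped,
reading off one further point amounts to reading off both. -/
theorem chop_chop_of_last {m : ℕ} {x x' : FS} (w : Free.of k x'.obj ⟶ Free.of k x.obj)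
    {f : x.obj ⟶ (⟨m + 2⟩ : FA)} (hy : Set.range f = {(Fin.last m).succ}ᶜ) :
    chop k m x' (w ≫ inclS k x ⟨⟨m + 1⟩⟩ (chop k (m + 1) x (arr k f))) =
      chopTwo k m x' (w ≫ arr k f) := by
  obtain ⟨s, rfl⟩ := exists_eq_comp_of_range_eq (c := ⟨⟨m + 1⟩⟩) (coface (m + 1)).property
    (hy.trans (range_coface (m + 1)).symm)
  have h3 : chop k (m + 1) x (arr k (s.hom ≫ (coface (m + 1)).hom)) = arr k s :=
    retract_of_eq (coface (m + 1)).property s rfl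
  rw [h3, inclS_arr, ← arr_comp, ← Category.assoc]
  exact (chopTwo_comp_coface _).symm

/-- Removing the last two points in both orders. -/
theorem chop_swap_add_chop {m : ℕ} {x x' : FS} {w : Free.of k x'.obj ⟶ Free.of k x.obj}
    (hw : w ∈ filt k 1 x'.obj x.obj) {v : Free.of k x.obj ⟶ Free.of k (⟨m + 2⟩ : FA)}
    (hv : v ∈ filt k 1 x.obj ⟨m + 2⟩) :
    chop k m x' (w ≫ inclS k x ⟨⟨m + 1⟩⟩ (chop k (m + 1) x (v ≫ arr k (swapLast m)))) +
      chop k m x' (w ≫ inclS k x ⟨⟨m + 1⟩⟩ (chop k (m + 1) x v)) = chopTwo k m x' (w ≫ v) := by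
  refine filt_one_induction (P := fun v =>
    chop k m x' (w ≫ inclS k x ⟨⟨m + 1⟩⟩ (chop k (m + 1) x (v ≫ arr k (swapLast m)))) +
      chop k m x' (w ≫ inclS k x ⟨⟨m + 1⟩⟩ (chop k (m + 1) x v)) = chopTwo k m x' (w ≫ v))
    ?_ ?_ ?_ ?_ ?_ hv
  · simp
  · intro v v' h h'
    simp only [Preadditive.comp_add, Preadditive.add_comp, map_add, ← h, ← h']
    abel
  · intro r v h
    simp only [Linear.comp_smul, Linear.smul_comp, map_smul, ← h, smul_add]
  · intro f hf
    have h1 : ∀ g : x.obj ⟶ (⟨m + 2⟩ : FA), FA.isSurj g → chop k (m + 1) x (arr k g) = 0 :=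
      fun g hg => (congrArg (chop k (m + 1) x)
        (inclS_arr k (surjHom (a := x) (b := ⟨⟨m + 2⟩⟩) g hg)).symm).trans (chop_incl _)
    -- `w` has defect at most one and a surjection adds none, so the composite misses too few points
    -- for `chopTwo`.
    have h2 : w ≫ arr k f ∈ filt k 1 x'.obj ⟨m + 2⟩ := by
      have := comp_mem_filt k hw (incl_mem_filt k (arr k (surjHom (a := x) (b := ⟨⟨m + 2⟩⟩) f hf)))
      rw [inclS_arr, zero_add] at this
      exact this
    have h3 := h1 (f ≫ swapLast m) (Function.Surjective.comp (Equiv.surjective _) hf)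
    rw [arr_comp, h1 f hf, h3, chopTwo_of_filt_one h2]
    simp
  · intro f y hy
    have hs : Set.range (f ≫ swapLast m) =
        {Equiv.swap (Fin.last m).castSucc (Fin.last m).succ y}ᶜ := by
      have h1 : Set.range (f ≫ swapLast m) =
        Equiv.swap (Fin.last m).castSucc (Fin.last m).succ '' Set.range f :=
          Set.range_comp (Equiv.swap _ _) f
      rw [h1, hy, Set.image_compl_eq (Equiv.bijective _), Set.image_singleton]
    have hne : (Fin.last m).castSucc ≠ (Fin.last m).succ := (Fin.castSucc_lt_succ).ne
    rw [arr_comp]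
    -- The missed point decides which term survives: the last point leaves the second term, the
    -- point before it leaves the first one. Any other missed point lies in the image of the
    -- standard injection `m → m + 2` and is missed by the composite, so everything vanishes.
    by_cases h1 : y = (Fin.last m).succ
    · subst h1
      rw [Equiv.swap_apply_right] at hs
      rw [chop_chop_of_last w hy, chop_of_range hs hne]
      simp
    · by_cases h2 : y = (Fin.last m).castSucc
      · subst h2
        rw [Equiv.swap_apply_left] at hs
        rw [chop_chop_of_last w hs, chop_of_range hy h1, ← arr_comp, ← Category.assoc,
          chopTwo_comp_swapLast]
        simp
      · rw [Equiv.swap_apply_of_ne_of_ne h2 h1] at hs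
        rw [chop_of_range hs h1, chop_of_range hy h1]
        have h3 : chopTwo k m x' (w ≫ arr k f) = 0 := by
          clear hw
          induction w using arr_induction with
          | zero => simp
          | add s t hs ht => simp only [Preadditive.add_comp, map_add, hs, ht, add_zero]
          | smul r s hs => simp only [Linear.smul_comp, map_smul, hs, smul_zero]
          | arr g =>
            rw [arr_comp]
            refine retract_of_range_ne _ fun h => ?_
            have h4 : y ∉ Set.range (g ≫ f) := by
              rintro ⟨p, hp⟩
              have : y ∈ Set.range f := ⟨g p, hp⟩
              rw [hy] at this
              exact this rfl
            rw [h] at h4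
            refine h4 ⟨⟨y.val, ?_⟩, Fin.ext rfl⟩
            have h5 : y.val < m + 2 := y.isLt
            have h6 : y.val ≠ m + 1 := fun h => h1 (Fin.ext h)
            have h7 : y.val ≠ m := fun h => h2 (Fin.ext h)
            change y.val < m
            omega
        rw [h3]
        simp

end FinKoszul

end

noncomputable section

namespace FinKoszul

universe u w

/-! ## The signed system in the quadratic dual of `k FI` -/

theorem Bimod.rightDual_ext {k : Type u} [CommRing k] {C D : Type}
    [Category.{u} C] [Preadditive C] [Linear k C] [Category.{u} D] [Preadditive D] [Linear k D]
    {V : Bimod k C D} {b : D} {c : C} {φ ψ : V.rightDual.X b c}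
    (h : ∀ (a : C) (v : V.X a b), ev φ v = ev ψ v) : φ = ψ :=
  Subtype.ext (funext fun a => LinearMap.ext (h a))

variable {k : Type u} [CommRing k]

/-- `f ⊔ 1` fixes the last point, so it preserves the maps missing exactly that point and acts on
the rest by `f`. -/
theorem chop_comp_addHomB {m : ℕ} {x : FS} (v : Free.of k x.obj ⟶ Free.of k (⟨m + 1⟩ : FA))
    (f : (⟨⟨m⟩⟩ : FB) ⟶ ⟨⟨m⟩⟩) :
    chop k m x (v ≫ arr k (addHomB f).hom) = chop k m x v ≫ inclBS k ⟨⟨m⟩⟩ ⟨⟨m⟩⟩ (arr k f) := by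
  have hc : (coface m).hom ≫ (addHomB f).hom = f.hom ≫ (coface m).hom :=
    funext fun i => addPt_castSucc f.hom i
  induction v using arr_induction with
  | zero => simp
  | add s t hs ht => simp only [Preadditive.add_comp, map_add, hs, ht]
  | smul r s hs => simp only [Linear.smul_comp, map_smul, hs]
  | arr g =>
    rw [arr_comp, inclBS_arr]
    by_cases h : Set.range g = Set.range (coface m).hom
    · obtain ⟨s, rfl⟩ := exists_eq_comp_of_range_eq (c := ⟨⟨m⟩⟩) (coface m).property h
      have h1 : chop k m x (arr k (s.hom ≫ (coface m).hom)) = arr k s :=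
        retract_of_eq (coface m).property s rfl
      rw [h1, arr_comp]
      refine retract_of_eq (coface m).property
        (s ≫ surjHom (a := ⟨⟨m⟩⟩) (b := ⟨⟨m⟩⟩) f.hom f.property.2) ?_
      rw [Category.assoc, hc]
      rfl
    · have h1 : chop k m x (arr k g) = 0 := retract_of_range_ne _ h
      rw [h1, Limits.zero_comp]
      refine retract_of_range_ne _ fun h' => h ?_
      refine (addHomB f).property.1.image_injective ?_
      have h2 : (addHomB f).hom '' Set.range g = Set.range (g ≫ (addHomB f).hom) :=
        (Set.range_comp _ _).symm
      have h3 : (addHomB f).hom '' Set.range (coface m).hom =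
        Set.range ((coface m).hom ≫ (addHomB f).hom) := (Set.range_comp _ _).symm
      rw [h2, h3, hc, h']
      exact (Function.Surjective.range_comp f.property.2 _).symm

theorem chop_addI {m n : ℕ} (y : Free.of k (⟨⟨n⟩⟩ : FI) ⟶ Free.of k ⟨⟨m⟩⟩) :
    chop k m ⟨⟨n + 1⟩⟩ (inclI k ⟨⟨n + 1⟩⟩ ⟨⟨m + 1⟩⟩ (addI k n m y)) = 0 := by
  induction y using arr_induction with
  | zero => simp
  | add s t hs ht => simp only [map_add, hs, ht, add_zero]
  | smul r s hs => simp only [map_smul, hs, smul_zero]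
  | arr f =>
    rw [addI_arr, inclI_arr]
    refine retract_of_range_ne _ fun h => ?_
    rw [range_coface] at h
    have h1 : Fin.last m ∈ Set.range (addHomI f).hom := ⟨Fin.last n, addPt_last f.hom⟩
    rw [h] at h1
    exact h1 rfl

theorem chop_coface (m : ℕ) :
    chop k m ⟨⟨m⟩⟩ (inclI k ⟨⟨m⟩⟩ ⟨⟨m + 1⟩⟩ (arr k (coface m))) = 𝟙 _ := by
  rw [inclI_arr]
  exact retract_of_eq (coface m).property (x := ⟨⟨m⟩⟩) (c := ⟨⟨m⟩⟩) (𝟙 _) rfl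

/-- Only the leading coface misses the last point; every other summand has the form `g ⊔ 1` and hits
it. This normalizes the chain, so that `δ` takes the value one on each step. -/
theorem chop_altCoface (x n : ℕ) :
    chop k (x + n) ⟨⟨x + n⟩⟩ (inclI k ⟨⟨x + n⟩⟩ ⟨⟨x + n + 1⟩⟩ (altCoface k x n)) = 𝟙 _ := by
  cases n with
  | zero => exact chop_coface x
  | succ n =>
    rw [altCoface_succ]
    exact (congrArg _ (map_sub (inclI k _ _) _ _)).trans ((map_sub (chop k _ _) _ _).trans
      ((congrArg₂ _ (chop_coface (x + n + 1)) (chop_addI (altCoface k x n))).trans (sub_zero _)))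

theorem inclBS_id (a : FB) : inclBS k a a (𝟙 (Free.of k a)) = 𝟙 _ := linHom_id k bijToSurj a

variable (k) in
/-- The inclusion of `k FI^[n]` into `k FA`. -/
def injIncl (n : ℕ) (a b : Free k FB) : (injPart k n).X a b →ₗ[k]
    (Free.of k (WideSubcategory.obj a : FA) ⟶ Free.of k (WideSubcategory.obj b : FA)) :=
  inclI k ⟨WideSubcategory.obj a⟩ ⟨WideSubcategory.obj b⟩ ∘ₗ (injDegree k n a b).subtype

theorem injIncl_injective (n : ℕ) (a b : Free k FB) : Function.Injective (injIncl k n a b) :=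
  (inclI_injective _ _).comp Subtype.val_injective

theorem injIncl_ract {n : ℕ} {a a' b : Free k FB} (f : a' ⟶ a) (v : (injPart k n).X a b) :
    injIncl k n a' b ((injPart k n).ract b f v) =
      inclS k ⟨WideSubcategory.obj a'⟩ ⟨WideSubcategory.obj a⟩ (inclBS k a' a f) ≫
        injIncl k n a b v :=
  (linHom_comp k injToAll ((bijInj k).map f) v.1).trans
    (congrArg (· ≫ injIncl k n a b v) ((inclI_inclBI k f).trans (inclS_inclBS k f).symm))

theorem injIncl_lact {n : ℕ} {a b b' : Free k FB} (g : b ⟶ b') (v : (injPart k n).X a b) :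
    injIncl k n a b' ((injPart k n).lact a g v) = injIncl k n a b v ≫
      inclS k ⟨WideSubcategory.obj b⟩ ⟨WideSubcategory.obj b'⟩ (inclBS k b b' g) :=
  (linHom_comp k injToAll v.1 ((bijInj k).map g)).trans
    (congrArg (injIncl k n a b v ≫ ·) ((inclI_inclBI k g).trans (inclS_inclBS k g).symm))

theorem injIncl_mul {m n : ℕ} {a b c : Free k FB} (v : (injPart k m).X b c)
    (w : (injPart k n).X a b) :
    injIncl k (m + n) a c (injMul k m n a b c v w) = injIncl k n a b w ≫ injIncl k m b c v :=
  linHom_comp k injToAll w.1 v.1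

theorem injIncl_mem_filt {a b : Free k FB} (v : (injPart k 1).X a b) :
    injIncl k 1 a b v ∈ filt k 1 (WideSubcategory.obj a) (WideSubcategory.obj b) := by
  rcases v.2 with h | h
  · exact inclI_mem_filt k (a := ⟨WideSubcategory.obj a⟩) (b := ⟨WideSubcategory.obj b⟩) h v.1
  · have h0 : v = 0 := Subtype.ext h
    rw [h0, map_zero]
    exact zero_mem _

theorem rightAug_injIncl {a b : Free k FB} (v : (injPart k 1).X a b) :
    rightAug k ⟨WideSubcategory.obj a⟩ ⟨WideSubcategory.obj b⟩ (injIncl k 1 a b v) = 0 := by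
  rcases v.2 with h | h
  · have h' : (WideSubcategory.obj a).card < (WideSubcategory.obj b).card := by
      rw [h]; exact Nat.lt_succ_self _
    exact rightAug_inclI (a := ⟨WideSubcategory.obj a⟩) (b := ⟨WideSubcategory.obj b⟩) h' v.1
  · have h0 : v = 0 := Subtype.ext h
    rw [h0, map_zero, map_zero]

/-- The projection onto `k FB` loses nothing on elements of degree zero. -/
theorem inclBS_toBijPart_map {n : ℕ} {a b : Free k FB} (c : FB)
    (h : (WideSubcategory.obj b).card = c.obj.card + n)
    (L : (Free.of k (WideSubcategory.obj a : FA) ⟶ Free.of k (WideSubcategory.obj b : FA)) →ₗ[k]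
      (Free.of k (⟨WideSubcategory.obj a⟩ : FS) ⟶ Free.of k (⟨c.obj⟩ : FS)))
    (v : (injPart k n).X a b) :
    inclBS k a c (toBijPart k a c (L (injIncl k n a b v))) = L (injIncl k n a b v) := by
  rcases v.2 with hv | hv
  · have h1 : (WideSubcategory.obj a).card = c.obj.card := by
      rw [h] at hv
      exact (Nat.add_right_cancel hv).symm
    exact inclBS_toBijPart (a := a) (b := c) h1 _
  · have h0 : v = 0 := Subtype.ext hv
    rw [h0, map_zero, map_zero]
    exact (congrArg _ (map_zero _)).trans (map_zero _)

/-- The map `k FI^[1](a, m + 1) → k FB(a, m)` that takes the coefficient of the standard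
injection. -/
def injChop (k : Type u) [CommRing k] (m : ℕ) (a : Free k FB) :
    (injPart k 1).X a (pts k (m + 1)) →ₗ[k] (a ⟶ pts k m) :=
  toBijPart k a ⟨⟨m⟩⟩ ∘ₗ chop k m ⟨WideSubcategory.obj a⟩ ∘ₗ injIncl k 1 a (pts k (m + 1))

theorem inclBS_injChop {m : ℕ} {a : Free k FB} (v : (injPart k 1).X a (pts k (m + 1))) :
    inclBS k a ⟨⟨m⟩⟩ (injChop k m a v) =
      chop k m ⟨WideSubcategory.obj a⟩ (injIncl k 1 a (pts k (m + 1)) v) :=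
  inclBS_toBijPart_map (b := pts k (m + 1)) ⟨⟨m⟩⟩ rfl (chop k m ⟨WideSubcategory.obj a⟩) v

/-- The map `k FI^[2](a, m + 2) → k FB(a, m)` that takes the coefficient of the standard
injection. -/
def injChopTwo (k : Type u) [CommRing k] (m : ℕ) (a : Free k FB) :
    (injPart k (1 + 1)).X a (pts k (m + 2)) →ₗ[k] (a ⟶ pts k m) :=
  toBijPart k a ⟨⟨m⟩⟩ ∘ₗ chopTwo k m ⟨WideSubcategory.obj a⟩ ∘ₗ injIncl k (1 + 1) a (pts k (m + 2))

theorem inclBS_injChopTwo {m : ℕ} {a : Free k FB} (v : (injPart k (1 + 1)).X a (pts k (m + 2))) :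
    inclBS k a ⟨⟨m⟩⟩ (injChopTwo k m a v) =
      chopTwo k m ⟨WideSubcategory.obj a⟩ (injIncl k (1 + 1) a (pts k (m + 2)) v) :=
  inclBS_toBijPart_map (b := pts k (m + 2)) ⟨⟨m⟩⟩ rfl (chopTwo k m ⟨WideSubcategory.obj a⟩) v

attribute [local irreducible] chop chopTwo toBijPart injIncl injChop injChopTwo inclBS inclS

theorem injChop_ract {m : ℕ} {a a' : Free k FB} (f : a' ⟶ a)
    (v : (injPart k 1).X a (pts k (m + 1))) :
    injChop k m a' ((injPart k 1).ract (pts k (m + 1)) f v) = f ≫ injChop k m a v := by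
  refine inclBS_injective (k := k) a' ⟨⟨m⟩⟩ ?_
  calc inclBS k a' ⟨⟨m⟩⟩ (injChop k m a' ((injPart k 1).ract (pts k (m + 1)) f v))
    _ = chop k m ⟨WideSubcategory.obj a'⟩ (injIncl k 1 a' (pts k (m + 1))
        ((injPart k 1).ract (pts k (m + 1)) f v)) := inclBS_injChop _
    _ = chop k m ⟨WideSubcategory.obj a'⟩ (inclS k ⟨WideSubcategory.obj a'⟩
        ⟨WideSubcategory.obj a⟩ (inclBS k a' a f) ≫ injIncl k 1 a (pts k (m + 1)) v) :=
      congrArg (chop k m ⟨WideSubcategory.obj a'⟩) (injIncl_ract f v)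
    _ = inclBS k a' a f ≫ chop k m ⟨WideSubcategory.obj a⟩ (injIncl k 1 a (pts k (m + 1)) v) :=
      chop_incl_comp (x := ⟨WideSubcategory.obj a⟩) (x' := ⟨WideSubcategory.obj a'⟩) _ _
    _ = inclBS k a' a f ≫ inclBS k a ⟨⟨m⟩⟩ (injChop k m a v) :=
      congrArg (inclBS k a' a f ≫ ·) (inclBS_injChop v).symm
    _ = inclBS k a' ⟨⟨m⟩⟩ (f ≫ injChop k m a v) := (inclBS_comp f _).symm

theorem injChopTwo_ract {m : ℕ} {a a' : Free k FB} (f : a' ⟶ a)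
    (v : (injPart k (1 + 1)).X a (pts k (m + 2))) :
    injChopTwo k m a' ((injPart k (1 + 1)).ract (pts k (m + 2)) f v) = f ≫ injChopTwo k m a v := by
  refine inclBS_injective (k := k) a' ⟨⟨m⟩⟩ ?_
  calc inclBS k a' ⟨⟨m⟩⟩ (injChopTwo k m a' ((injPart k (1 + 1)).ract (pts k (m + 2)) f v))
    _ = chopTwo k m ⟨WideSubcategory.obj a'⟩ (injIncl k (1 + 1) a' (pts k (m + 2))
        ((injPart k (1 + 1)).ract (pts k (m + 2)) f v)) := inclBS_injChopTwo _
    _ = chopTwo k m ⟨WideSubcategory.obj a'⟩ (inclS k ⟨WideSubcategory.obj a'⟩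
        ⟨WideSubcategory.obj a⟩ (inclBS k a' a f) ≫ injIncl k (1 + 1) a (pts k (m + 2)) v) :=
      congrArg (chopTwo k m ⟨WideSubcategory.obj a'⟩) (injIncl_ract f v)
    _ = inclBS k a' a f ≫
        chopTwo k m ⟨WideSubcategory.obj a⟩ (injIncl k (1 + 1) a (pts k (m + 2)) v) :=
      chopTwo_incl_comp (x := ⟨WideSubcategory.obj a⟩) (x' := ⟨WideSubcategory.obj a'⟩) _ _
    _ = inclBS k a' a f ≫ inclBS k a ⟨⟨m⟩⟩ (injChopTwo k m a v) :=
      congrArg (inclBS k a' a f ≫ ·) (inclBS_injChopTwo v).symm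
    _ = inclBS k a' ⟨⟨m⟩⟩ (f ≫ injChopTwo k m a v) := (inclBS_comp f _).symm

variable (k) in
/-- The functional on `k FI^[1]` that takes the coefficient of the standard injection. -/
def injDelta (m : ℕ) : (injPart k 1).rightDual.X (pts k (m + 1)) (pts k m) :=
  ⟨injChop k m, injChop_ract⟩

variable (k) in
/-- The functional on `k FI^[2]` that takes the coefficient of the standard injection. -/
def injDeltaTwo (m : ℕ) : (injPart k (1 + 1)).rightDual.X (pts k (m + 2)) (pts k m) :=
  ⟨injChopTwo k m, injChopTwo_ract⟩

theorem inclS_inclBS_arr {a b : FB} (f : a ⟶ b) :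
    inclS k ⟨a.obj⟩ ⟨b.obj⟩ (inclBS k a b (arr k f)) = arr k f.hom := by
  rw [inclS_inclBS, inclB_arr]

/-- The coefficient after a bijection. -/
theorem inclBS_injChop_lact_arr {m n : ℕ} {a : Free k FB} (v : (injPart k 1).X a (pts k n))
    (f : (⟨⟨n⟩⟩ : FB) ⟶ ⟨⟨m + 1⟩⟩) :
    inclBS k a ⟨⟨m⟩⟩ (injChop k m a ((injPart k 1).lact a (b := pts k n) (b' := pts k (m + 1))
      (arr k f) v)) = chop k m ⟨WideSubcategory.obj a⟩ (injIncl k 1 a (pts k n) v ≫ arr k f.hom) :=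
  (inclBS_injChop _).trans (congrArg (chop k m ⟨WideSubcategory.obj a⟩)
    ((injIncl_lact (b := pts k n) (b' := pts k (m + 1)) (arr k f) v).trans
      (congrArg (injIncl k 1 a (pts k n) v ≫ ·) (inclS_inclBS_arr f))))

/-- This is `chop_swap_add_chop` read in `k FB`, as elements of `k FI^[1]` lie in `G_1` after
inclusion into `k FA`. -/
theorem injDelta_pairing {m : ℕ} {x x' : Free k FB} (v : (injPart k 1).X x' (pts k (m + 2)))
    (w : (injPart k 1).X x x') :
    injChop k m x ((injPart k 1).lact x (injChop k (m + 1) x' ((injPart k 1).lact x'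
      (bijArr k (Equiv.swap (Fin.last m).castSucc (Fin.last m).succ)) v)) w) +
    injChop k m x ((injPart k 1).lact x (injChop k (m + 1) x' v) w) =
      injChopTwo k m x (injMul k 1 1 x x' (pts k (m + 2)) v w) := by
  refine inclBS_injective (k := k) x ⟨⟨m⟩⟩ ?_
  have key : ∀ r : x' ⟶ pts k (m + 1),
      inclBS k x ⟨⟨m⟩⟩ (injChop k m x ((injPart k 1).lact x r w)) =
      chop k m ⟨WideSubcategory.obj x⟩ (injIncl k 1 x x' w ≫
        inclS k ⟨WideSubcategory.obj x'⟩ ⟨⟨m + 1⟩⟩ (inclBS k x' ⟨⟨m + 1⟩⟩ r)) := fun r =>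
    (inclBS_injChop _).trans (congrArg (chop k m ⟨WideSubcategory.obj x⟩) (injIncl_lact r w))
  have h3 := (inclBS_injChopTwo (injMul k 1 1 x x' (pts k (m + 2)) v w)).trans
    (congrArg (chopTwo k m ⟨WideSubcategory.obj x⟩) (injIncl_mul v w))
  refine (map_add (inclBS k x ⟨⟨m⟩⟩) _ _).trans (Eq.trans ?_ h3.symm)
  refine Eq.trans ?_ (chop_swap_add_chop (x := ⟨WideSubcategory.obj x'⟩)
    (x' := ⟨WideSubcategory.obj x⟩) (injIncl_mem_filt w) (injIncl_mem_filt v))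
  refine congrArg₂ (· + ·) ((key _).trans ?_) ((key _).trans ?_)
  · refine congrArg (fun z => chop k m ⟨WideSubcategory.obj x⟩ (injIncl k 1 x x' w ≫
      inclS k ⟨WideSubcategory.obj x'⟩ ⟨⟨m + 1⟩⟩ z)) ?_
    exact inclBS_injChop_lact_arr v (bijHom (Equiv.swap (Fin.last m).castSucc (Fin.last m).succ))
  · refine congrArg (fun z => chop k m ⟨WideSubcategory.obj x⟩ (injIncl k 1 x x' w ≫
      inclS k ⟨WideSubcategory.obj x'⟩ ⟨⟨m + 1⟩⟩ z)) ?_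
    exact inclBS_injChop v

/-- On `v ⊗ w` the functional takes the coefficient in `v w` of the injection missing the last two
points, so it factors through the product. Anticommutation of the `δ` is therefore one of the
relations of the quadratic dual. -/
theorem injDelta_mem_perp (m : ℕ) :
    Bimod.tmul (injPart k 1).rightDual (injPart k 1).rightDual (injDelta k m)
      ((injPart k 1).rightDual.ract _
        (bijArr k (Equiv.swap (Fin.last m).castSucc (Fin.last m).succ)) (injDelta k (m + 1))) +
      Bimod.tmul (injPart k 1).rightDual (injPart k 1).rightDual (injDelta k m)
        (injDelta k (m + 1)) ∈
      (injPart k 1).perp (injPart k (1 + 1)) (fun {x x' a} => injMul k 1 1 x x' a)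
        (pts k (m + 2)) (pts k m) :=
  ⟨injDeltaTwo k m, fun _ _ v w => (map_add _ _ _).trans
    ((congrArg₂ (· + ·) (Bimod.pairing_tmul _ _ _ _ _) (Bimod.pairing_tmul _ _ _ _ _)).trans
      (injDelta_pairing v w))⟩

variable (k) in
/-- The signed system in `k FI^⊥`. -/
def injSystem : SignedSystem (injDualBase k) where
  δ m := injDualGen k (injDelta k m)
  nat {m} f := by
    refine (QuadCat.base_comp_gen _ _).trans
      (Eq.trans (congrArg _ ?_) (QuadCat.gen_comp_base _ _).symm)
    refine Bimod.rightDual_ext fun a v => ?_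
    refine inclBS_injective (k := k) a ⟨⟨m⟩⟩ ?_
    refine (inclBS_injChop_lact_arr v (addHomB f)).trans ((chop_comp_addHomB _ f).trans ?_)
    refine Eq.trans ?_ (inclBS_comp (a := a) (b := ⟨⟨m⟩⟩) (c := ⟨⟨m⟩⟩) (injChop k m a v)
      (arr k f)).symm
    exact congrArg (· ≫ inclBS k ⟨⟨m⟩⟩ ⟨⟨m⟩⟩ (arr k f)) (inclBS_injChop v).symm
  swap m := by
    have h := QuadCat.compTwo_gen_eq_zero (injDelta_mem_perp (k := k) m)
    rw [map_add, QuadCat.compTwo_tmul, QuadCat.compTwo_tmul, add_eq_zero_iff_eq_neg] at h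
    refine (Category.assoc ..).symm.trans (Eq.trans ?_ h)
    exact congrArg (· ≫ _) (QuadCat.base_comp_gen _ _)

/-! ### Values on chains -/

variable (k) in
/-- The chain of alternating sums in `k FI`. -/
def injChain (x : ℕ) : RightQuadDual.Chain (injPart k 1) (injPart k (1 + 1))
    (fun {x x' a} => injMul k 1 1 x x' a) where
  X n := pts k (x + n)
  D n := ⟨altCoface k x n, Or.inl rfl⟩
  mul_eq_zero n a u := by
    refine Subtype.ext ?_
    refine (Category.assoc (obj := Free k FI) (altCoface k x n) (altCoface k x (n + 1))
      ((bijInj k).map u)).symm.trans ?_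
    exact (congrArg (· ≫ (bijInj k).map u) (altCoface_comp x n)).trans Limits.zero_comp

theorem injIncl_D (x n : ℕ) : injIncl k 1 (pts k (x + n)) (pts k (x + n + 1)) ((injChain k x).D n) =
    inclI k ⟨⟨x + n⟩⟩ ⟨⟨x + n + 1⟩⟩ (altCoface k x n) := by
  unfold injIncl
  rfl

theorem iter_mem_degree (x n : ℕ) : (injSystem k).iter x n ∈ injDualDegree k n _ _ := by
  induction n with
  | zero => exact QuadCat.base_mem_degree (𝟙 (pts k x))
  | succ n ih =>
    have := QuadCat.comp_mem_degree (QuadCat.gen_mem_degree (injDelta k (x + n))) ih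
    rwa [add_comm 1 n] at this

theorem injDelta_altCoface (x n : ℕ) :
    Bimod.ev (injDelta k (x + n)) ((injPart k 1).lact _ (𝟙 _) ((injChain k x).D n)) =
      𝟙 (pts k (x + n)) := by
  refine (congrArg (injChop k (x + n) (pts k (x + n)))
    ((injPart k 1).lact_id _ _ ((injChain k x).D n))).trans ?_
  refine inclBS_injective (k := k) ⟨⟨x + n⟩⟩ ⟨⟨x + n⟩⟩ ?_
  refine (inclBS_injChop _).trans (Eq.trans ?_ (inclBS_id _).symm)
  exact (congrArg (chop k (x + n) ⟨⟨x + n⟩⟩) (injIncl_D x n)).trans (chop_altCoface x n)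

/-- Each `δ` takes the value one on its step of the chain, so the iterate descends the whole chain
with value one. -/
theorem value_id_iter (x n : ℕ) :
    RightQuadDual.value (injChain k x) n (𝟙 (pts k (x + n))) ((injSystem k).iter x n) =
      𝟙 (pts k x) := by
  induction n with
  | zero =>
    have h := RightQuadDual.rep_base_single (injChain k x) (𝟙 (pts k x)) 0 (𝟙 (pts k x))
    refine (congrFun h 0).trans ?_
    refine (Pi.single_eq_same (M := fun m => ((injChain k x).X m ⟶ pts k x)) 0 _).trans ?_
    exact Category.comp_id (𝟙 (pts k x))
  | succ n ih =>
    refine (RightQuadDual.value_gen_comp (injChain k x) (injDelta k (x + n)) n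
      (𝟙 (pts k (x + n + 1))) _).trans ?_
    refine Eq.trans ?_ ih
    exact congrArg (fun u => RightQuadDual.value (injChain k x) n u _) (injDelta_altCoface x n)

/-- The behaviour of the iterate under block permutations passes to its values and reduces them to
the normalized value at the identity. -/
theorem value_blockPerm_iter {x n : ℕ} (α : Equiv.Perm (Fin x)) (β : Equiv.Perm (Fin n)) :
    RightQuadDual.value (injChain k x) n (bijArr k (blockPerm α β)) ((injSystem k).iter x n) =
      (Equiv.Perm.sign β : ℤ) • bijArr k α := by
  have h1 := RightQuadDual.value_base_comp (injChain k x) (bijArr k (blockPerm α β)) n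
    (𝟙 (pts k (x + n))) ((injSystem k).iter x n)
  refine (h1.trans (congrArg (fun u => RightQuadDual.value (injChain k x) n u _)
    (Category.id_comp (bijArr k (blockPerm α β))))).symm.trans ?_
  refine (congrArg (RightQuadDual.value (injChain k x) n (𝟙 (pts k (x + n))))
    ((injSystem k).blockPerm_comp_iter' α β)).trans ?_
  rw [map_zsmul]
  refine congrArg (_ • ·) ?_
  refine (RightQuadDual.value_comp_base (injChain k x) n (𝟙 (pts k (x + n))) _ _).trans ?_
  exact (congrArg (· ≫ bijArr k α) (value_id_iter x n)).trans (Category.id_comp _)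

/-- Each recursive step of the alternating sum adds a point at the end and never moves the first `x`
points. This is what forces values on bijections mixing the blocks to vanish. -/
theorem altCoface_mem_span (x n : ℕ) : altCoface k x n ∈ Submodule.span k
    {v | ∃ g : (⟨⟨x + n⟩⟩ : FI) ⟶ ⟨⟨x + n + 1⟩⟩,
      (∀ p : Fin (x + n), p.val < x → (g.hom p : Fin (x + n + 1)).val = p.val) ∧ v = arr k g} := by
  have hc : ∀ n, arr k (coface (x + n)) ∈ Submodule.span k
    {v | ∃ g : (⟨⟨x + n⟩⟩ : FI) ⟶ ⟨⟨x + n + 1⟩⟩,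
      (∀ p : Fin (x + n), p.val < x → (g.hom p : Fin (x + n + 1)).val = p.val) ∧ v = arr k g} :=
    fun n => Submodule.subset_span ⟨_, fun p _ => rfl, rfl⟩
  induction n with
  | zero => exact hc 0
  | succ n ih =>
    rw [altCoface_succ]
    refine sub_mem (hc (n + 1)) ?_
    refine (Submodule.span_le (p := Submodule.comap (addI k (x + n) (x + n + 1))
      (Submodule.span k _))).2 ?_ ih
    rintro _ ⟨g, hg, rfl⟩
    change addI k (x + n) (x + n + 1) (arr k g) ∈ Submodule.span k _
    rw [addI_arr]
    refine Submodule.subset_span ⟨_, fun p hp => ?_, rfl⟩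
    change (addPt g.hom p).val = p.val
    induction p using Fin.lastCases with
    | last => exact absurd hp (by simp)
    | cast p =>
      rw [addPt_castSucc]
      exact hg p hp

end FinKoszul

end

noncomputable section

namespace FinKoszul

universe u w

/-! ## The reconstruction formula -/

theorem RightQuadDual.value_zero_left {k : Type u} [CommRing k] {C : Type} [Category.{u} C]
    [Preadditive C] [Linear k C] {V B₂ : Bimod k C C}
    {μ : ∀ {x x' a : C}, V.X x' a →ₗ[k] V.X x x' →ₗ[k] B₂.X x a} (S : Chain V B₂ μ)
    (n : ℕ) {a b : C}
    (z : (QuadCat.base V.rightDual (V.perp B₂ μ)).obj a ⟶ (QuadCat.base _ (V.perp B₂ μ)).obj b) :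
    value S n 0 z = 0 := by
  rw [value_def, Pi.single_zero, map_zero]
  rfl

theorem RightQuadDual.value_add_left {k : Type u} [CommRing k] {C : Type} [Category.{u} C]
    [Preadditive C] [Linear k C] {V B₂ : Bimod k C C}
    {μ : ∀ {x x' a : C}, V.X x' a →ₗ[k] V.X x x' →ₗ[k] B₂.X x a} (S : Chain V B₂ μ)
    (n : ℕ) {a b : C} (u u' : S.X n ⟶ a)
    (z : (QuadCat.base V.rightDual (V.perp B₂ μ)).obj a ⟶ (QuadCat.base _ (V.perp B₂ μ)).obj b) :
    value S n (u + u') z = value S n u z + value S n u' z := by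
  rw [value_def, Pi.single_add, map_add]
  rfl

theorem RightQuadDual.value_smul_left {k : Type u} [CommRing k] {C : Type} [Category.{u} C]
    [Preadditive C] [Linear k C] {V B₂ : Bimod k C C}
    {μ : ∀ {x x' a : C}, V.X x' a →ₗ[k] V.X x x' →ₗ[k] B₂.X x a} (S : Chain V B₂ μ)
    (n : ℕ) {a b : C} (r : k) (u : S.X n ⟶ a)
    (z : (QuadCat.base V.rightDual (V.perp B₂ μ)).obj a ⟶ (QuadCat.base _ (V.perp B₂ μ)).obj b) :
    value S n (r • u) z = r • value S n u z := by
  rw [value_def, Pi.single_smul, map_smul]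
  rfl

variable {k : Type u} [CommRing k]

variable (k) in
/-- The elements of `k FI^[1]` between standard sets. -/
def injMk (n : ℕ) : (Free.of k (⟨⟨n⟩⟩ : FI) ⟶ Free.of k (⟨⟨n + 1⟩⟩ : FI)) →ₗ[k]
    (injPart k 1).X (pts k n) (pts k (n + 1)) where
  toFun v := ⟨v, Or.inl rfl⟩
  map_add' _ _ := rfl
  map_smul' _ _ := rfl

theorem injIncl_injMk {n : ℕ} (v : Free.of k (⟨⟨n⟩⟩ : FI) ⟶ Free.of k (⟨⟨n + 1⟩⟩ : FI)) :
    injIncl k 1 (pts k n) (pts k (n + 1)) (injMk k n v) = inclI k ⟨⟨n⟩⟩ ⟨⟨n + 1⟩⟩ v := rfl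

/-- The coefficient of an injection is a bijection or zero. -/
theorem injChop_injMk_arr {n : ℕ} (f : (⟨⟨n + 1⟩⟩ : FB) ⟶ ⟨⟨n + 1⟩⟩)
    (g : (⟨⟨n⟩⟩ : FI) ⟶ ⟨⟨n + 1⟩⟩) :
    injChop k n (pts k n) ((injPart k 1).lact (pts k n) (b := pts k (n + 1)) (b' := pts k (n + 1))
      (arr k f) (injMk k n (arr k g))) = 0 ∨
    ∃ f' : (⟨⟨n⟩⟩ : FB) ⟶ ⟨⟨n⟩⟩, g.hom ≫ f.hom = f'.hom ≫ (coface n).hom ∧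
      injChop k n (pts k n) ((injPart k 1).lact (pts k n) (b := pts k (n + 1))
        (b' := pts k (n + 1)) (arr k f) (injMk k n (arr k g))) = arr k f' := by
  have h1 : inclBS k (pts k n) ⟨⟨n⟩⟩ (injChop k n (pts k n) ((injPart k 1).lact (pts k n)
      (b := pts k (n + 1)) (b' := pts k (n + 1)) (arr k f) (injMk k n (arr k g)))) =
      chop k n ⟨⟨n⟩⟩ (arr k (g.hom ≫ f.hom)) := by
    refine (inclBS_injChop_lact_arr (a := pts k n) (injMk k n (arr k g)) f).trans ?_
    refine congrArg (chop k n ⟨⟨n⟩⟩) ?_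
    refine Eq.trans ?_ (arr_comp k g.hom f.hom)
    exact congrArg (· ≫ arr k f.hom) ((injIncl_injMk _).trans (inclI_arr k g))
  by_cases h : Set.range (g.hom ≫ f.hom) = Set.range (coface n).hom
  · right
    obtain ⟨s, hs⟩ := exists_eq_comp_of_range_eq (c := ⟨⟨n⟩⟩) (x := ⟨⟨n⟩⟩) (coface n).property h
    refine ⟨⟨s.hom, Finite.injective_iff_bijective.1
      (Finite.injective_iff_surjective.2 s.property)⟩, hs, ?_⟩
    refine inclBS_injective (k := k) (pts k n) ⟨⟨n⟩⟩ (h1.trans (Eq.trans ?_ (inclBS_arr k _).symm))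
    exact retract_of_eq (coface n).property s hs
  · left
    refine inclBS_injective (k := k) (pts k n) ⟨⟨n⟩⟩ (h1.trans (Eq.trans ?_ (map_zero _).symm))
    exact retract_of_range_ne _ h

/-- The value of the iterate on a bijection that does not respect the blocks. -/
theorem value_iter_eq_zero {x n : ℕ} (f : (⟨⟨x + n⟩⟩ : FB) ⟶ ⟨⟨x + n⟩⟩) (p : Fin (x + n))
    (hp : p.val < x) (hf : x ≤ (f.hom p : Fin (x + n)).val) :
    RightQuadDual.value (injChain k x) n (arr k f : pts k (x + n) ⟶ pts k (x + n))
      ((injSystem k).iter x n) = 0 := by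
  induction n with
  | zero => exact absurd (f.hom p : Fin x).isLt (not_lt.2 hf)
  | succ n ih =>
    refine (RightQuadDual.value_gen_comp (injChain k x) (injDelta k (x + n)) n
      (arr k f : pts k (x + n + 1) ⟶ pts k (x + n + 1)) _).trans ?_
    let L : (Free.of k (⟨⟨x + n⟩⟩ : FI) ⟶ Free.of k (⟨⟨x + n + 1⟩⟩ : FI)) →ₗ[k]
        (pts k (x + n) ⟶ pts k (x + n)) := injChop k (x + n) (pts k (x + n)) ∘ₗ
      (injPart k 1).lact (pts k (x + n)) (b := pts k (x + n + 1)) (b' := pts k (x + n + 1))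
        (arr k f) ∘ₗ injMk k (x + n)
    change RightQuadDual.value (injChain k x) n (L (altCoface k x n)) _ = 0
    -- One `δ` replaces `f` by the coefficient `f'` of a summand `g` of the chain followed by `f`.
    -- Since `g` fixes the points below `x`, `f'` still sends `p` out of the first block, and
    -- induction applies.
    have key : ∀ v ∈ Submodule.span k {v | ∃ g : (⟨⟨x + n⟩⟩ : FI) ⟶ ⟨⟨x + n + 1⟩⟩,
          (∀ p : Fin (x + n), p.val < x → (g.hom p : Fin (x + n + 1)).val = p.val) ∧
            v = arr k g},
        RightQuadDual.value (injChain k x) n (L v) ((injSystem k).iter x n) = 0 := by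
      intro v hv
      induction hv using Submodule.span_induction with
      | zero => rw [map_zero]; exact RightQuadDual.value_zero_left _ _ _
      | add v w _ _ hv hw =>
        rw [map_add]
        refine (RightQuadDual.value_add_left (injChain k x) n (L v) (L w) _).trans ?_
        rw [hv, hw, add_zero]
      | smul r v _ hv =>
        rw [map_smul]
        refine (RightQuadDual.value_smul_left (injChain k x) n r (L v) _).trans ?_
        rw [hv, smul_zero]
      | mem v hv =>
        obtain ⟨g, hg, rfl⟩ := hv
        rcases injChop_injMk_arr (k := k) f g with h | ⟨f', h1, h2⟩
        · refine (congrArg (fun u => RightQuadDual.value (injChain k x) n u _) h).trans ?_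
          exact RightQuadDual.value_zero_left _ _ _
        · refine (congrArg (fun u => RightQuadDual.value (injChain k x) n u _) h2).trans ?_
          let p' : Fin (x + n) := ⟨p.val, by omega⟩
          refine ih f' p' hp ?_
          have h3 : (f.hom (g.hom p') : Fin (x + n + 1)) = (f'.hom p' : Fin (x + n)).castSucc :=
            congrFun h1 p'
          have h4 : (g.hom p' : Fin (x + n + 1)) = p := Fin.ext (hg p' hp)
          rw [h4] at h3
          have h5 := congrArg Fin.val h3
          rw [Fin.val_castSucc] at h5
          exact h5 ▸ hf
    exact key _ (altCoface_mem_span x n)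

/-- By finiteness, a permutation that maps the first block into itself also preserves the second
one. -/
theorem exists_blockPerm {x n : ℕ} (e : Equiv.Perm (Fin (x + n)))
    (he : ∀ p : Fin (x + n), p.val < x → (e p).val < x) : ∃ α β, e = blockPerm α β := by
  let σ : Equiv.Perm (Fin x ⊕ Fin n) := finSumFinEquiv.symm.permCongr e
  have hσ : Set.MapsTo σ (Set.range Sum.inl) (Set.range Sum.inl) := by
    rintro _ ⟨i, rfl⟩
    have h1 : (e (Fin.castAdd n i)).val < x := he _ i.isLt
    refine ⟨⟨_, h1⟩, ?_⟩
    refine finSumFinEquiv.injective ?_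
    simp only [σ, Equiv.permCongr_apply, Equiv.symm_symm, Equiv.apply_symm_apply,
      finSumFinEquiv_apply_left]
    rfl
  obtain ⟨⟨α, β⟩, h⟩ := Equiv.Perm.mem_sumCongrHom_range_of_perm_mapsTo_inl hσ
  refine ⟨α, β, ?_⟩
  have h2 : Equiv.Perm.sumCongr α β = σ := h
  rw [blockPerm, h2]
  ext i
  simp [σ]

/-! ### Numbering a finite set along a subset -/

/-- The numbering of a finite set that lists a subset first. -/
def splitEquiv {a : ℕ} (s : Finset (Fin a)) : Fin (s.card + sᶜ.card) ≃ Fin a :=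
  finSumFinEquiv.symm.trans (finSumEquivOfFinset rfl rfl)

theorem splitEquiv_mem {a : ℕ} (s : Finset (Fin a)) (p : Fin (s.card + sᶜ.card)) :
    splitEquiv s p ∈ s ↔ p.val < s.card := by
  induction p using Fin.addCases with
  | left i => simp [splitEquiv]
  | right i =>
    have h := Finset.orderEmbOfFin_mem sᶜ rfl i
    rw [Finset.mem_compl] at h
    simpa [splitEquiv] using h

variable (k) in
/-- The value of a morphism of `k FI^⊥` on the chain attached to a subset. -/
def injCoeff {a : ℕ} (s : Finset (Fin a)) (c : Free k FB) :
    ((injDualBase k).obj (pts k a) ⟶ (injDualBase k).obj c) →ₗ[k] (pts k s.card ⟶ c) :=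
  RightQuadDual.value (injChain k s.card) sᶜ.card (bijArr k (splitEquiv s))

namespace SignedSystem

variable {Q : Type w} [Category.{u} Q] [Preadditive Q] {b : Free k FB ⥤ Q} [b.Additive]
  (S : SignedSystem b)

/-- One term of the reconstruction formula. -/
def term {x n x' n' : ℕ} (e : Fin (x' + n') ≃ Fin (x + n)) :
    b.obj (pts k (x + n)) ⟶ b.obj (pts k x) :=
  b.map (bijArr k e.symm) ≫ S.iter x' n' ≫ b.map (show pts k x' ⟶ pts k x from
    RightQuadDual.value (injChain k x') n' (bijArr k e) ((injSystem k).iter x n))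

theorem term_of_ne {x n x' n' : ℕ} (h : n' ≠ n) (e : Fin (x' + n') ≃ Fin (x + n)) :
    S.term e = 0 := by
  have h1 := RightQuadDual.value_eq_zero (injChain k x') h (bijArr k e) (iter_mem_degree x n)
  have h2 : S.term e = b.map (bijArr k e.symm) ≫ S.iter x' n' ≫ b.map 0 :=
    congrArg (fun r => b.map (bijArr k e.symm) ≫ S.iter x' n' ≫ b.map r) h1
  rw [h2, b.map_zero, Limits.comp_zero, Limits.comp_zero]

theorem term_of_not_mapsTo {x n : ℕ} (e : Fin (x + n) ≃ Fin (x + n)) (p : Fin (x + n))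
    (hp : p.val < x) (he : x ≤ (e p).val) : S.term e = 0 := by
  have h1 := value_iter_eq_zero (k := k) (bijHom e) p hp he
  have h2 : S.term e = b.map (bijArr k e.symm) ≫ S.iter x n ≫ b.map 0 :=
    congrArg (fun r => b.map (bijArr k e.symm) ≫ S.iter x n ≫ b.map r) h1
  rw [h2, b.map_zero, Limits.comp_zero, Limits.comp_zero]

/-- Here `e` splits as `α ⊔ β`, and the value is the sign of `β` times `α`. Moved back through the
iterate, these factors reassemble to `e`, which cancels the leading inverse. -/
theorem term_of_mapsTo {x n : ℕ} (e : Fin (x + n) ≃ Fin (x + n))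
    (he : ∀ p : Fin (x + n), p.val < x → (e p).val < x) : S.term e = S.iter x n := by
  obtain ⟨α, β, rfl⟩ := exists_blockPerm e he
  have h1 := value_blockPerm_iter (k := k) α β
  have h2 : S.term (blockPerm α β) = b.map (bijArr k (blockPerm α β).symm) ≫ S.iter x n ≫
      b.map ((Equiv.Perm.sign β : ℤ) • bijArr k α) :=
    congrArg (fun r => b.map (bijArr k (blockPerm α β).symm) ≫ S.iter x n ≫ b.map r) h1
  rw [h2, b.map_zsmul, Preadditive.comp_zsmul, ← S.blockPerm_comp_iter', ← Category.assoc,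
    ← b.map_comp, bijArr_comp, Equiv.symm_trans_self, bijArr_refl, b.map_id, Category.id_comp]

/-- Only one subset contributes, the preimage of the first `x` points. A complement of the wrong
size is excluded by degree, and any other subset of the right size contains a point that is sent out
of the first block. -/
theorem sum_term {a x n : ℕ} (t : Fin a ≃ Fin (x + n)) :
    ∑ s : Finset (Fin a), S.term ((splitEquiv s).trans t) = S.iter x n := by
  let s₀ : Finset (Fin a) := Finset.univ.filter fun p => (t p).val < x
  have hs₀ : s₀.card = x := by
    have h : s₀.map t.toEmbedding = Finset.univ.map (Fin.castAddEmb n) := by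
      ext q
      simp only [s₀, Finset.mem_map, Finset.mem_filter, Finset.mem_univ, true_and,
        Equiv.coe_toEmbedding]
      constructor
      · rintro ⟨p, hp, rfl⟩
        exact ⟨⟨_, hp⟩, rfl⟩
      · rintro ⟨i, rfl⟩
        exact ⟨t.symm (Fin.castAdd n i), by simp, by simp⟩
    rw [← Finset.card_map t.toEmbedding, h, Finset.card_map, Finset.card_univ, Fintype.card_fin]
  have ha : a = x + n := by simpa using Fintype.card_congr t
  have hcard : ∀ s : Finset (Fin a), s.card + sᶜ.card = x + n := fun s => by
    rw [Finset.card_add_card_compl, Fintype.card_fin, ha]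
  have hiff : ∀ p, p ∈ s₀ ↔ (t p).val < x := fun p => by simp [s₀]
  -- The two cardinalities become variables, so that they can be replaced by `x` and `n` without
  -- changing the term.
  have hterm : ∀ s : Finset (Fin a), ∀ x' n' (h' : x' = s.card) (h'' : n' = sᶜ.card),
      S.term ((splitEquiv s).trans t) =
        S.term (((finCongr (by rw [h', h''])).trans (splitEquiv s)).trans t :
          Fin (x' + n') ≃ Fin (x + n)) := by
    rintro s _ _ rfl rfl
    rfl
  rw [Finset.sum_eq_single s₀]
  · have h1 : n = s₀ᶜ.card := by have := hcard s₀; omega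
    rw [hterm s₀ x n hs₀.symm h1]
    refine S.term_of_mapsTo _ fun p hp => ?_
    refine (hiff _).1 ((splitEquiv_mem s₀ _).2 ?_)
    exact lt_of_lt_of_eq hp hs₀.symm
  · intro s _ hs
    by_cases hn : sᶜ.card = n
    · have hx : s.card = x := by have := hcard s; omega
      rw [hterm s x n hx.symm hn.symm]
      have h2 : ¬ s ⊆ s₀ := fun h => hs (Finset.eq_of_subset_of_card_le h (by rw [hx, hs₀]))
      obtain ⟨q, hq, hq'⟩ := Finset.not_subset.1 h2
      obtain ⟨p, rfl⟩ := (splitEquiv s).surjective q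
      have h3 : s.card + sᶜ.card = x + n := by rw [hx, hn]
      refine S.term_of_not_mapsTo _ (finCongr h3 p) ?_ ?_
      · exact lt_of_lt_of_eq ((splitEquiv_mem s p).1 hq) hx
      · rw [hiff, not_lt] at hq'
        simpa using hq'
    · exact S.term_of_ne hn _
  · simp

/-- The expansion of a bijection followed by an iterate along the subsets of its source. -/
theorem reconstruct [Linear k Q] [b.Linear k] {a x n : ℕ} (τ : pts k a ⟶ pts k (x + n)) :
    ∑ s : Finset (Fin a), b.map (bijArr k (splitEquiv s).symm) ≫ S.iter s.card sᶜ.card ≫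
      b.map (injCoeff k s (pts k x) ((injDualBase k).map τ ≫ (injSystem k).iter x n)) =
    b.map τ ≫ S.iter x n := by
  let L : Finset (Fin a) → (pts k a ⟶ pts k (x + n)) → (b.obj (pts k a) ⟶ b.obj (pts k x)) :=
    fun s τ => b.map (bijArr k (splitEquiv s).symm) ≫ S.iter s.card sᶜ.card ≫
      b.map (injCoeff k s (pts k x) ((injDualBase k).map τ ≫ (injSystem k).iter x n))
  change ∑ s, L s τ = _
  have hL0 : ∀ s, L s 0 = 0 := fun s => by
    simp only [L, Functor.map_zero, Limits.zero_comp, map_zero, Limits.comp_zero]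
  have hLadd : ∀ s τ τ', L s (τ + τ') = L s τ + L s τ' := fun s τ τ' => by
    simp only [L, Functor.map_add, Preadditive.add_comp, map_add, Preadditive.comp_add]
  have hLsmul : ∀ s (r : k) τ, L s (r • τ) = r • L s τ := fun s r τ => by
    simp only [L, Functor.map_smul, Linear.smul_comp, map_smul, Linear.comp_smul]
  induction τ using arr_induction with
  | zero =>
    refine (Finset.sum_eq_zero fun s _ => hL0 s).trans ?_
    rw [b.map_zero, Limits.zero_comp]
  | add τ τ' h h' =>
    refine (Finset.sum_congr rfl fun s _ => hLadd s τ τ').trans ?_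
    rw [Finset.sum_add_distrib, h, h', b.map_add, Preadditive.add_comp]
  | smul r τ h =>
    refine (Finset.sum_congr rfl fun s _ => hLsmul s r τ).trans ?_
    rw [← Finset.smul_sum, h, b.map_smul, Linear.smul_comp]
  | arr f =>
    obtain ⟨t, rfl⟩ := exists_bijHom_eq f
    -- Absorbing `t` into the numbering of the source yields the terms of `sum_term`, up to the
    -- common left factor `t`.
    have h1 : ∀ s, L s (bijArr k t) = b.map (bijArr k t) ≫ S.term ((splitEquiv s).trans t) := by
      intro s
      have h2 := RightQuadDual.value_base_comp (injChain k s.card) (bijArr k t) sᶜ.card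
        (bijArr k (splitEquiv s)) ((injSystem k).iter x n)
      have h3 := congrArg (fun u => RightQuadDual.value (injChain k s.card) sᶜ.card u
        ((injSystem k).iter x n)) (bijArr_comp k (splitEquiv s) t)
      have h4 : bijArr k (splitEquiv s).symm =
          bijArr k t ≫ bijArr k ((splitEquiv s).trans t).symm := by
        rw [bijArr_comp]
        congr 1
        ext p
        simp
      refine (congrArg (fun r => b.map (bijArr k (splitEquiv s).symm) ≫ S.iter s.card sᶜ.card ≫
        b.map r) (h2.trans h3)).trans ?_
      rw [h4, b.map_comp, Category.assoc]
      rfl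
    refine (Finset.sum_congr rfl fun s _ => h1 s).trans ?_
    rw [← Preadditive.comp_sum, S.sum_term]
    rfl

end SignedSystem

end FinKoszul

end

noncomputable section

namespace FinKoszul

universe u w

/-! ## Spanning by iterates -/

namespace SignedSystem

variable {k : Type u} [CommRing k]

section

variable {Q : Type w} [Category.{u} Q] [Preadditive Q] {b : Free k FB ⥤ Q} (S : SignedSystem b)

theorem cast_comp_δ {p q : ℕ} (h : p = q) :
    b.map (bijArr k (finCongr (congrArg (· + 1) h))) ≫ S.δ q =
      S.δ p ≫ b.map (bijArr k (finCongr h)) := by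
  subst h
  have h1 : bijArr k (finCongr (congrArg (· + 1) (rfl : p = p))) = 𝟙 _ := rfl
  have h2 : bijArr k (finCongr (rfl : p = p)) = 𝟙 _ := rfl
  rw [h1, h2, b.map_id, b.map_id, Category.comp_id]
  exact Category.id_comp _

/-- A `δ` after an iterate lengthens it at its lower end. The bijection is the identity of the
underlying sets, needed because the sizes `(m + 1) + n` and `m + (n + 1)` are different expressions.
-/
theorem iter_comp_δ (m n : ℕ) : S.iter (m + 1) n ≫ S.δ m =
    b.map (bijArr k (finCongr (Nat.succ_add_eq_add_succ m n))) ≫ S.iter m (n + 1) := by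
  induction n with
  | zero =>
    have h1 : bijArr k (finCongr (Nat.succ_add_eq_add_succ m 0)) = 𝟙 _ := rfl
    rw [h1, b.map_id]
    exact (Category.id_comp _).trans
      ((Category.comp_id _).symm.trans (Category.id_comp _).symm)
  | succ n ih =>
    rw [iter_succ, Category.assoc, ih, ← Category.assoc]
    exact (congrArg (· ≫ S.iter m (n + 1))
      (S.cast_comp_δ (Nat.succ_add_eq_add_succ m n)).symm).trans (Category.assoc ..)

end

variable {C : Type} [Category.{u} C] [Preadditive C] [Linear k C] {V : Bimod k C C}
  {I : ∀ a c : C, Submodule k (Bimod.TensorX V V a c)} {F : Free k FB ⥤ C}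
  (S : SignedSystem (F ⋙ QuadCat.base V I))

/-- The span of the composites of iterates with morphisms of degree zero. -/
def iterSpan (a : ℕ) (c : C) :
    Submodule k ((QuadCat.base V I).obj (F.obj (pts k a)) ⟶ (QuadCat.base V I).obj c) :=
  Submodule.span k {z | ∃ (x n : ℕ) (τ : pts k a ⟶ pts k (x + n)) (t : F.obj (pts k x) ⟶ c),
    z = (QuadCat.base V I).map (F.map τ) ≫ S.iter x n ≫ (QuadCat.base V I).map t}

/-- The generators are spanned by the composites of the `δ` with morphisms of degree zero. -/
structure Generating : Prop where
  eq_zero : ∀ {c : C} (φ : V.X (F.obj (pts k 0)) c), φ = 0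
  mem_span : ∀ {m : ℕ} {c : C} (φ : V.X (F.obj (pts k (m + 1))) c),
    QuadCat.gen V I φ ∈ Submodule.span k {z | ∃ (α : Equiv.Perm (Fin (m + 1)))
      (t : F.obj (pts k m) ⟶ c),
      z = (QuadCat.base V I).map (F.map (bijArr k α)) ≫ S.δ m ≫ (QuadCat.base V I).map t}

variable {S}

/-- The degree zero factor `t` is absorbed into the generator, which is then expanded in terms
"permutation, `δ`, morphism of degree zero". The permutation passes to the left of the iterate by
naturality, and the `δ` lengthens the iterate by one. -/
theorem comp_gen_mem_iterSpan (hS : S.Generating) {a : ℕ} {c d : C}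
    {w : (QuadCat.base V I).obj (F.obj (pts k a)) ⟶ (QuadCat.base V I).obj c}
    (hw : w ∈ S.iterSpan a c) (φ : V.X c d) : w ≫ QuadCat.gen V I φ ∈ S.iterSpan a d := by
  induction hw using Submodule.span_induction with
  | zero => rw [Limits.zero_comp]; exact zero_mem _
  | add v w _ _ hv hw => rw [Preadditive.add_comp]; exact add_mem hv hw
  | smul r v _ hv => rw [Linear.smul_comp]; exact Submodule.smul_mem _ r hv
  | mem w hw =>
    obtain ⟨x, n, τ, t, rfl⟩ := hw
    rw [Category.assoc, Category.assoc, QuadCat.base_comp_gen]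
    generalize V.ract d t φ = ψ
    cases x with
    | zero =>
      rw [hS.eq_zero ψ, map_zero, Limits.comp_zero, Limits.comp_zero]
      exact zero_mem _
    | succ m =>
      have hψ := hS.mem_span ψ
      generalize QuadCat.gen V I ψ = z at hψ ⊢
      induction hψ using Submodule.span_induction with
      | zero => rw [Limits.comp_zero, Limits.comp_zero]; exact zero_mem _
      | add v w _ _ hv hw =>
        rw [Preadditive.comp_add, Preadditive.comp_add]; exact add_mem hv hw
      | smul r v _ hv =>
        rw [Linear.comp_smul, Linear.comp_smul]; exact Submodule.smul_mem _ r hv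
      | mem v hv =>
        obtain ⟨α, t', rfl⟩ := hv
        refine Submodule.subset_span ⟨m, n + 1, τ ≫ bijArr k (blockPerm α (Equiv.refl (Fin n))) ≫
          bijArr k (finCongr (Nat.succ_add_eq_add_succ m n)), t', ?_⟩
        rw [F.map_comp, F.map_comp, (QuadCat.base V I).map_comp, (QuadCat.base V I).map_comp]
        have h1 := S.iter_comp_δ m n
        have h2 := S.blockPerm_comp_iter n α
        simp only [Functor.comp_map] at h1 h2
        simp only [Category.assoc]
        congr 1
        refine (Category.assoc (S.iter (m + 1) n) _ _).symm.trans ?_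
        refine (congrArg (· ≫ _) h2.symm).trans ?_
        refine (Category.assoc _ (S.iter (m + 1) n) _).trans ?_
        congr 1
        refine (Category.assoc (S.iter (m + 1) n) _ _).symm.trans ?_
        refine (congrArg (· ≫ _) h1).trans ?_
        exact Category.assoc ..

/-- The span contains the identity and is stable under postcomposition with morphisms of degree zero
and generators, which together produce every morphism. -/
theorem mem_iterSpan (hS : S.Generating) {a : ℕ} {c : C}
    (z : (QuadCat.base V I).obj (F.obj (pts k a)) ⟶ (QuadCat.base V I).obj c) :
    z ∈ S.iterSpan a c := by
  have key : ∀ {c d : C} (z : (QuadCat.base V I).obj c ⟶ (QuadCat.base V I).obj d) (a : ℕ)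
      (w : (QuadCat.base V I).obj (F.obj (pts k a)) ⟶ (QuadCat.base V I).obj c),
      w ∈ S.iterSpan a c → w ≫ z ∈ S.iterSpan a d := by
    intro c d z
    refine QuadCat.hom_induction (P := fun {c d} z => ∀ (a : ℕ)
      (w : (QuadCat.base V I).obj (F.obj (pts k a)) ⟶ (QuadCat.base V I).obj c),
      w ∈ S.iterSpan a c → w ≫ z ∈ S.iterSpan a d) (fun f a w hw => ?_)
      (fun φ a w hw => comp_gen_mem_iterSpan hS hw φ) (fun x y hx hy a w hw => ?_)
      (fun r x hx a w hw => ?_) (fun x y hx hy a w hw => ?_) z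
    · induction hw using Submodule.span_induction with
      | zero => rw [Limits.zero_comp]; exact zero_mem _
      | add v w _ _ hv hw => rw [Preadditive.add_comp]; exact add_mem hv hw
      | smul r v _ hv => rw [Linear.smul_comp]; exact Submodule.smul_mem _ r hv
      | mem w hw =>
        obtain ⟨x, n, τ, t, rfl⟩ := hw
        refine Submodule.subset_span ⟨x, n, τ, t ≫ f, ?_⟩
        rw [Category.assoc, Category.assoc, Functor.map_comp]
    · rw [Preadditive.comp_add]; exact add_mem (hx a w hw) (hy a w hw)
    · rw [Linear.comp_smul]; exact Submodule.smul_mem _ r (hx a w hw)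
    · rw [← Category.assoc]; exact hy a _ (hx a w hw)
  have h := key z a (𝟙 _) (Submodule.subset_span ⟨a, 0, 𝟙 _, 𝟙 _, ?_⟩)
  · rwa [Category.id_comp] at h
  · rw [F.map_id, (QuadCat.base V I).map_id]
    exact ((Category.id_comp _).trans (Category.id_comp _)).symm

/-- The expansion of a morphism along the subsets of its source. -/
theorem eq_sum_of_coeff [F.Additive] [F.Linear k] (hS : S.Generating) {a : ℕ} {c : C}
    (coeff : ∀ s : Finset (Fin a), ((QuadCat.base V I).obj (F.obj (pts k a)) ⟶
      (QuadCat.base V I).obj c) →ₗ[k] (F.obj (pts k s.card) ⟶ c))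
    (hcoeff : ∀ (s : Finset (Fin a)) (x n : ℕ) (τ : pts k a ⟶ pts k (x + n))
      (t : F.obj (pts k x) ⟶ c),
      coeff s ((QuadCat.base V I).map (F.map τ) ≫ S.iter x n ≫ (QuadCat.base V I).map t) =
        F.map (injCoeff k s (pts k x) ((injDualBase k).map τ ≫ (injSystem k).iter x n)) ≫ t)
    (z : (QuadCat.base V I).obj (F.obj (pts k a)) ⟶ (QuadCat.base V I).obj c) :
    ∑ s : Finset (Fin a), (QuadCat.base V I).map (F.map (bijArr k (splitEquiv s).symm)) ≫
      S.iter s.card sᶜ.card ≫ (QuadCat.base V I).map (coeff s z) = z := by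
  have hz := mem_iterSpan hS z
  induction hz using Submodule.span_induction with
  | zero => simp
  | add v w _ _ hv hw =>
    simp only [map_add, Functor.map_add, Preadditive.comp_add, Finset.sum_add_distrib]
    rw [hv, hw]
  | smul r v _ hv =>
    simp only [map_smul, Functor.map_smul, Linear.comp_smul, ← Finset.smul_sum]
    rw [hv]
  | mem z hz =>
    obtain ⟨x, n, τ, t, rfl⟩ := hz
    -- By `hcoeff` the coefficients of a spanning element are those of an iterate in `k FI^⊥`
    -- followed by `t`, so the expansion is that of `reconstruct` followed by `t`.
    have h := S.reconstruct τ
    refine Eq.trans ?_ ((congrArg (· ≫ (QuadCat.base V I).map t) h).trans (Category.assoc ..))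
    rw [Preadditive.sum_comp]
    refine Finset.sum_congr rfl fun s _ => ?_
    rw [hcoeff, Functor.map_comp]
    simp only [Category.assoc, Functor.comp_map]

end SignedSystem

/-! ## Dual bases -/

/-- The expansion of a functional in a dual basis. -/
theorem Bimod.eq_sum_of_dualBasis {k : Type u} [CommRing k] {C D : Type} [Category.{u} C]
    [Preadditive C] [Linear k C] [Category.{u} D] [Preadditive D] [Linear k D] {V : Bimod k C D}
    {ι : Type} [Fintype ι] {d : D} {c : ι → C} (v : ∀ j, V.X (c j) d)
    (φ : ∀ j, V.rightDual.X d (c j))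
    (h : ∀ (a : C) (w : V.X a d), ∑ j, V.ract d (ev (φ j) w) (v j) = w) {e : C}
    (ψ : V.rightDual.X d e) : ∑ j, V.rightDual.lact d (ev ψ (v j)) (φ j) = ψ := by
  refine rightDual_ext fun a w => ?_
  rw [map_sum, LinearMap.sum_apply]
  refine Eq.trans ?_ (congrArg (ev ψ) (h a w))
  rw [map_sum]
  exact Finset.sum_congr rfl fun j _ => (ψ.2 _ _).symm

variable {k : Type u} [CommRing k]

/-- A map of defect zero is surjective, so `G_0` is the image of `k FS`, and `ε` inverts the
inclusion there. -/
theorem filt_zero_eq {x : FS} {a : FS} {v : Free.of k x.obj ⟶ Free.of k a.obj}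
    (hv : v ∈ filt k 0 x.obj a.obj) : inclS k x a (rightAug k x a v) = v := by
  induction hv using Submodule.span_induction with
  | zero => simp
  | add v w _ _ hv hw => rw [map_add, map_add, hv, hw]
  | smul r v _ hv => rw [map_smul, map_smul, hv]
  | mem v hv =>
    obtain ⟨f, hf, rfl⟩ := hv
    rw [mem_filtSet_iff] at hf
    have h1 : (Set.range f)ᶜ.ncard = 0 := by omega
    rw [Set.ncard_eq_zero] at h1
    have h2 : FA.isSurj f := Set.range_eq_univ.1 (Set.compl_empty_iff.1 h1)
    rw [rightAug_of_surj k f h2, inclS_arr]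
    rfl

variable (k) in
/-- The injection of `k FI^[1]` that misses the point `y`. -/
def cofaceAt {m : ℕ} (y : Fin (m + 1)) : (injPart k 1).X (pts k m) (pts k (m + 1)) :=
  (injPart k 1).lact (pts k m) (b := pts k (m + 1)) (b' := pts k (m + 1)) (arr k (toLast y))
    (injMk k m (arr k (coface m)))

theorem injIncl_cofaceAt {m : ℕ} (y : Fin (m + 1)) :
    injIncl k 1 (pts k m) (pts k (m + 1)) (cofaceAt k y) =
      arr k ((coface m).hom ≫ (toLast y).hom) := by
  refine (injIncl_lact (a := pts k m) (b := pts k (m + 1)) (b' := pts k (m + 1)) _ _).trans ?_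
  refine Eq.trans ?_ (arr_comp k _ _)
  exact congrArg₂ (· ≫ ·) ((injIncl_injMk _).trans (inclI_arr k _)) (inclS_inclBS_arr _)

variable (k) in
/-- The functional that takes the coefficient of the injection that misses the point `y`. -/
def injDeltaAt {m : ℕ} (y : Fin (m + 1)) : (injPart k 1).rightDual.X (pts k (m + 1)) (pts k m) :=
  (injPart k 1).rightDual.ract (pts k m) (a := pts k (m + 1)) (a' := pts k (m + 1))
    (arr k (toLast y)) (injDelta k m)

theorem inclBS_ev_injDeltaAt {m : ℕ} (y : Fin (m + 1)) {a : Free k FB}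
    (v : (injPart k 1).X a (pts k (m + 1))) :
    inclBS k a ⟨⟨m⟩⟩ (Bimod.ev (injDeltaAt k y) v) = chop k m ⟨WideSubcategory.obj a⟩
      (injIncl k 1 a (pts k (m + 1)) v ≫ arr k (toLast y).hom) :=
  inclBS_injChop_lact_arr v (toLast y)

theorem injIncl_sum {m : ℕ} {a : Free k FB} (w : (injPart k 1).X a (pts k (m + 1))) :
    injIncl k 1 a (pts k (m + 1)) (∑ y, (injPart k 1).ract (pts k (m + 1))
      (Bimod.ev (injDeltaAt k y) w) (cofaceAt k y)) =
    ∑ y : Fin (m + 1), inclS k ⟨WideSubcategory.obj a⟩ ⟨⟨m⟩⟩ (chop k m ⟨WideSubcategory.obj a⟩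
      (injIncl k 1 a (pts k (m + 1)) w ≫ arr k (toLast y).hom)) ≫
      arr k ((coface m).hom ≫ (toLast y).hom) := by
  rw [map_sum]
  refine Finset.sum_congr rfl fun y _ => ?_
  refine (injIncl_ract (a := pts k m) (b := pts k (m + 1)) _ _).trans ?_
  exact congrArg₂ (· ≫ ·) (congrArg (inclS k ⟨WideSubcategory.obj a⟩ ⟨⟨m⟩⟩)
    (inclBS_ev_injDeltaAt y w)) (injIncl_cofaceAt y)

/-- Modulo `G_0` the expansion is `sum_chop_sub_mem`. The difference of the two sides still comes
from `k FI^[1]`, where `ε` vanishes, and an element of `G_0` killed by `ε` is zero. -/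
theorem inj_dualBasis {m : ℕ} (a : Free k FB) (w : (injPart k 1).X a (pts k (m + 1))) :
    ∑ y, (injPart k 1).ract (pts k (m + 1)) (Bimod.ev (injDeltaAt k y) w) (cofaceAt k y) = w := by
  rw [← sub_eq_zero]
  refine injIncl_injective (k := k) 1 a (pts k (m + 1)) ?_
  have h1 := sum_chop_sub_mem (x := ⟨WideSubcategory.obj a⟩) (injIncl_mem_filt w)
  have h2 := (map_sub (injIncl k 1 a (pts k (m + 1))) (∑ y, (injPart k 1).ract (pts k (m + 1))
    (Bimod.ev (injDeltaAt k y) w) (cofaceAt k y)) w).trans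
      (congrArg (· - injIncl k 1 a (pts k (m + 1)) w) (injIncl_sum w))
  rw [map_zero]
  refine h2.trans ((filt_zero_eq (x := ⟨WideSubcategory.obj a⟩) (a := ⟨⟨m + 1⟩⟩) h1).symm.trans ?_)
  refine (congrArg _ (congrArg _ h2.symm)).trans ?_
  refine (congrArg _ (rightAug_injIncl _)).trans (map_zero _)

theorem injPart_pts_zero {a : Free k FB} (v : (injPart k 1).X a (pts k 0)) : v = 0 := by
  rcases v.2 with h | h
  · exact absurd h.symm (Nat.succ_ne_zero _)
  · exact Subtype.ext h

/-- Dual bases exist at every object. -/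
theorem exists_isDualBasis (d : Free k FB) :
    ∃ (n : ℕ) (c : Fin n → Free k FB) (v : ∀ j, (injPart k 1).X (c j) d)
      (φ : ∀ j, (injPart k 1).rightDual.X d (c j)), IsDualBasis v φ := by
  obtain ⟨⟨n⟩⟩ := d
  cases n with
  | zero =>
    exact ⟨0, Fin.elim0, fun j => j.elim0, fun j => j.elim0, fun a w =>
      (injPart_pts_zero (a := a) _).trans (injPart_pts_zero (a := a) w).symm⟩
  | succ m => exact ⟨m + 1, fun _ => pts k m, cofaceAt k, injDeltaAt k, inj_dualBasis⟩

/-! ## Expansion in the quadratic dual of `k FI` -/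

/-- The functionals of the dual basis are the `δ_m` twisted by transpositions, so expanding `φ` in
them has the required form. The identity functor is inserted so that both quadratic duals fit the
same framework. -/
theorem injSystem_generating :
    SignedSystem.Generating (F := 𝟭 (Free k FB)) (show SignedSystem (𝟭 _ ⋙ injDualBase k) from
      injSystem k) where
  eq_zero φ := Bimod.rightDual_ext fun a v => by
    have h : v = 0 := injPart_pts_zero v
    rw [h, map_zero, map_zero]
  mem_span {m c} φ := by
    rw [← Bimod.eq_sum_of_dualBasis (cofaceAt k) (injDeltaAt k) inj_dualBasis φ, map_sum]
    refine sum_mem fun y _ => Submodule.subset_span ⟨Equiv.swap y (Fin.last m),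
      Bimod.ev φ (cofaceAt k y), ?_⟩
    refine (QuadCat.gen_comp_base _ _).symm.trans ?_
    refine Eq.trans ?_ (Category.assoc ..)
    exact congrArg (· ≫ _) (QuadCat.base_comp_gen _ _).symm

/-- The expansion of a morphism of `k FI^⊥` along the subsets of its source. -/
theorem inj_eq_sum {a : ℕ} {c : Free k FB}
    (z : (injDualBase k).obj (pts k a) ⟶ (injDualBase k).obj c) :
    ∑ s : Finset (Fin a), (injDualBase k).map (bijArr k (splitEquiv s).symm) ≫
      (injSystem k).iter s.card sᶜ.card ≫ (injDualBase k).map (injCoeff k s c z) = z :=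
  SignedSystem.eq_sum_of_coeff injSystem_generating (fun s => injCoeff k s c)
    (fun s _ _ _ _ => (congrArg (injCoeff k s c) (Category.assoc ..).symm).trans
      (RightQuadDual.value_comp_base _ _ _ _ _)) z

end FinKoszul

end

noncomputable section

namespace FinKoszul

universe u w

variable {k : Type u} [CommRing k]

/-! ## The signed system in the quadratic dual of `gr k FA` -/

/-- The standard finite sets as objects of `k FS`. -/
abbrev spts (k : Type u) [CommRing k] (m : ℕ) : Free k FS := (bijSurj k).obj (pts k m)

/-- Every class has a representative in the kernel of the augmentation. -/
theorem exists_grClass_eq {a b : Free k FS} (w : (grBimod k 1).X a b) :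
    ∃ v : (filtBimod k 1).X a b, aug k a b v.1 = 0 ∧ grClass k 1 a b v = w := by
  obtain ⟨v, rfl⟩ := Submodule.Quotient.mk_surjective _ w
  have h0 := incl_mem_filt k (a := a) (b := b) (rightAug k a b v.1)
  let v' : (filtBimod k 1).X a b := ⟨inclS k a b (rightAug k a b v.1),
    filt_mono k (by norm_num) _ _ h0⟩
  refine ⟨v - v', ?_, ?_⟩
  · refine (map_sub (rightAug k a b) v.1 _).trans (sub_eq_zero.2 ?_)
    exact (rightAug_incl k (a := a) (b := b) _).symm
  · refine (map_sub (grClass k 1 a b) v v').trans ?_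
    have h1 : grClass k 1 a b v' = 0 := (Submodule.Quotient.mk_eq_zero _).2 h0
    rw [h1, sub_zero]
    rfl

theorem grClass_eq_of_sub_mem {a b : Free k FS} {v w : (filtBimod k 1).X a b}
    (h : v.1 - w.1 ∈ filt k 0 (WideSubcategory.obj a) (WideSubcategory.obj b)) :
    grClass k 1 a b v = grClass k 1 a b w :=
  (Submodule.Quotient.eq _).2 h

theorem grClass_eq_zero {a b : Free k FS} {v : (filtBimod k 1).X a b}
    (h : v.1 ∈ filt k 0 (WideSubcategory.obj a) (WideSubcategory.obj b)) : grClass k 1 a b v = 0 :=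
  (Submodule.Quotient.mk_eq_zero _).2 h

variable (k) in
/-- The map `gr_1 k FA(a, m + 1) → k FS(a, m)` that takes the coefficient of the standard
injection. -/
def grChop (m : ℕ) (a : Free k FS) :
    (grBimod k 1).X a (spts k (m + 1)) →ₗ[k] (a ⟶ spts k m) :=
  (filtPred k 1 a (spts k (m + 1))).liftQ (chop k m a ∘ₗ Submodule.subtype _) (fun v hv => by
    have h := filt_zero_eq (x := a) (a := ⟨⟨m + 1⟩⟩) hv
    exact (congrArg (chop k m a) h).symm.trans (chop_incl _))

variable (k) in
/-- The map `gr_2 k FA(a, m + 2) → k FS(a, m)` that takes the coefficient of the standard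
injection. -/
def grChopTwo (m : ℕ) (a : Free k FS) :
    (grBimod k (1 + 1)).X a (spts k (m + 2)) →ₗ[k] (a ⟶ spts k m) :=
  (filtPred k (1 + 1) a (spts k (m + 2))).liftQ (chopTwo k m a ∘ₗ Submodule.subtype _)
    (fun v hv => chopTwo_of_filt_one (x := a) (m := m) (v := v.1) (by
      have h : (1 + 1 - 1 : ℤ) = 1 := by norm_num
      have hv' : v.1 ∈ filt k (1 + 1 - 1) (WideSubcategory.obj a) ⟨m + 2⟩ := hv
      rw [h] at hv'
      exact hv'))

variable (k) in
/-- The functional on `gr_1 k FA` that takes the coefficient of the standard injection. -/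
def grDelta (m : ℕ) : (grBimod k 1).rightDual.X (spts k (m + 1)) (spts k m) :=
  ⟨grChop k m, fun {a a'} f v => by
    obtain ⟨v, rfl⟩ := Submodule.Quotient.mk_surjective _ v
    exact chop_incl_comp (x := a) (x' := a') f v.1⟩

variable (k) in
/-- The functional on `gr_2 k FA` that takes the coefficient of the standard injection. -/
def grDeltaTwo (m : ℕ) : (grBimod k (1 + 1)).rightDual.X (spts k (m + 2)) (spts k m) :=
  ⟨grChopTwo k m, fun {a a'} f v => by
    obtain ⟨v, rfl⟩ := Submodule.Quotient.mk_surjective _ v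
    exact chopTwo_incl_comp (x := a) (x' := a') f v.1⟩

theorem filt_ract_val {n : ℤ} {a a' b : Free k FS} (f : a' ⟶ a) (v : (filtBimod k n).X a b) :
    ((filtBimod k n).ract b f v).1 = inclS k a' a f ≫ v.1 := rfl

theorem filt_lact_val {n : ℤ} {a b b' : Free k FS} (g : b ⟶ b') (v : (filtBimod k n).X a b) :
    ((filtBimod k n).lact a g v).1 = v.1 ≫ inclS k b b' g := rfl

theorem ract_grClass {n : ℤ} {a a' b : Free k FS} (f : a' ⟶ a) (v : (filtBimod k n).X a b) :
    (grBimod k n).ract b f (grClass k n a b v) = grClass k n a' b ((filtBimod k n).ract b f v) :=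
  rfl

theorem lact_grClass {n : ℤ} {a b b' : Free k FS} (g : b ⟶ b') (v : (filtBimod k n).X a b) :
    (grBimod k n).lact a g (grClass k n a b v) = grClass k n a b' ((filtBimod k n).lact a g v) :=
  rfl

theorem ev_grDelta_grClass {m : ℕ} {a : Free k FS} (v : (filtBimod k 1).X a (spts k (m + 1))) :
    Bimod.ev (grDelta k m) (grClass k 1 a (spts k (m + 1)) v) = chop k m a v.1 := rfl

theorem ev_grDeltaTwo_grClass {m : ℕ} {a : Free k FS}
    (v : (filtBimod k (1 + 1)).X a (spts k (m + 2))) :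
    Bimod.ev (grDeltaTwo k m) (grClass k (1 + 1) a (spts k (m + 2)) v) = chopTwo k m a v.1 := rfl

theorem bijSurj_map {a b : Free k FB} (r : a ⟶ b) : (bijSurj k).map r = inclBS k a b r := rfl

theorem inclS_bijSurj_map_arr {a b : FB} (f : a ⟶ b) :
    inclS k ⟨a.obj⟩ ⟨b.obj⟩ ((bijSurj k).map (arr k f)) = arr k f.hom :=
  inclS_inclBS_arr f

theorem filtMul_val {m n : ℤ} {a b c : Free k FS} (v : (filtBimod k m).X b c)
    (w : (filtBimod k n).X a b) : (filtMul k m n a b c v w).1 = w.1 ≫ v.1 := rfl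

variable (k) in
/-- An element of `k FI^[1]` as an element of `G_1 k FA`. -/
def injToFilt (a b : Free k FB) :
    (injPart k 1).X a b →ₗ[k] (filtBimod k 1).X ((bijSurj k).obj a) ((bijSurj k).obj b) :=
  LinearMap.codRestrict (filt k 1 (WideSubcategory.obj a) (WideSubcategory.obj b))
    (injIncl k 1 a b) injIncl_mem_filt

theorem injToGr_eq {a b : Free k FB} (v : (injPart k 1).X a b) :
    injToGr k a b v =
      grClass k 1 ((bijSurj k).obj a) ((bijSurj k).obj b) (injToFilt k a b v) := rfl

theorem injToFilt_val {a b : Free k FB} (v : (injPart k 1).X a b) :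
    (injToFilt k a b v).1 = injIncl k 1 a b v := rfl

attribute [local irreducible] chop chopTwo toBijPart injIncl injChop injChopTwo inclBS inclS grChop
  grChopTwo grClass injToFilt injToGr grDelta grDeltaTwo

theorem injToGr_lact {a b b' : Free k FB} (r : b ⟶ b') (v : (injPart k 1).X a b) :
    injToGr k a b' ((injPart k 1).lact a r v) =
      (grBimod k 1).lact ((bijSurj k).obj a) ((bijSurj k).map r) (injToGr k a b v) := by
  rw [injToGr_eq, injToGr_eq, lact_grClass]
  refine congrArg (grClass k 1 ((bijSurj k).obj a) ((bijSurj k).obj b')) (Subtype.ext ?_)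
  refine ((injToFilt_val _).trans (injIncl_lact r v)).trans
    (Eq.trans ?_ (filt_lact_val ((bijSurj k).map r) (injToFilt k a b v)).symm)
  exact congrArg₂ (fun x y => x ≫ inclS k ⟨WideSubcategory.obj b⟩ ⟨WideSubcategory.obj b'⟩ y)
    (injToFilt_val v).symm (bijSurj_map r).symm

theorem injToGr_ract {a a' b : Free k FB} (r : a' ⟶ a) (v : (injPart k 1).X a b) :
    injToGr k a' b ((injPart k 1).ract b r v) =
      (grBimod k 1).ract ((bijSurj k).obj b) ((bijSurj k).map r) (injToGr k a b v) := by
  rw [injToGr_eq, injToGr_eq, ract_grClass]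
  refine congrArg (grClass k 1 ((bijSurj k).obj a') ((bijSurj k).obj b)) (Subtype.ext ?_)
  refine ((injToFilt_val _).trans (injIncl_ract r v)).trans
    (Eq.trans ?_ (filt_ract_val ((bijSurj k).map r) (injToFilt k a b v)).symm)
  exact congrArg₂ (fun x y => inclS k ⟨WideSubcategory.obj a'⟩ ⟨WideSubcategory.obj a⟩ y ≫ x)
    (injToFilt_val v).symm (bijSurj_map r).symm

/-- A product that vanishes in `k FA` itself vanishes in `gr_2`, also after a further morphism `u`
of `k FS`. This makes the chain of `k FI` a chain for `gr k FA`. -/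
theorem grMul_lact_injToGr_eq_zero {a b c : Free k FB} {e : Free k FS} (v : (injPart k 1).X b c)
    (w : (injPart k 1).X a b) (u : (bijSurj k).obj c ⟶ e)
    (h : injIncl k 1 a b w ≫ injIncl k 1 b c v = 0) :
    grMul k 1 1 ((bijSurj k).obj a) ((bijSurj k).obj b) e
      ((grBimod k 1).lact ((bijSurj k).obj b) u (injToGr k b c v)) (injToGr k a b w) = 0 := by
  rw [injToGr_eq, injToGr_eq, lact_grClass]
  refine (grMul_class k 1 1 _ _ _ _ _).trans ?_
  refine (congrArg (grClass k (1 + 1) ((bijSurj k).obj a) e) (Subtype.ext ?_)).trans (map_zero _)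
  refine (filtMul_val _ _).trans ?_
  refine (congrArg₂ (· ≫ ·) (injToFilt_val w) ((filt_lact_val u _).trans
    (congrArg (· ≫ inclS k ⟨WideSubcategory.obj c⟩ e u) (injToFilt_val v)))).trans ?_
  refine (Category.assoc ..).symm.trans ?_
  exact (congrArg (· ≫ inclS k ⟨WideSubcategory.obj c⟩ e u) h).trans Limits.zero_comp

theorem injIncl_D_comp_D (x n : ℕ) :
    injIncl k 1 (pts k (x + n)) (pts k (x + n + 1)) ((injChain k x).D n) ≫
      injIncl k 1 (pts k (x + n + 1)) (pts k (x + n + 2)) ((injChain k x).D (n + 1)) = 0 :=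
  (congrArg₂ (· ≫ ·) (injIncl_D x n) (injIncl_D x (n + 1))).trans
    ((linHom_comp k injToAll _ _).symm.trans
      ((congrArg (inclI k ⟨⟨x + n⟩⟩ ⟨⟨x + n + 2⟩⟩) (altCoface_comp x n)).trans (map_zero _)))

/-- The functional on `gr_1` extends the functional on `k FI^[1]`. -/
theorem ev_grDelta_injToGr {m : ℕ} {a : Free k FB} (v : (injPart k 1).X a (pts k (m + 1))) :
    Bimod.ev (grDelta k m) (injToGr k a (pts k (m + 1)) v) =
      (bijSurj k).map (Bimod.ev (injDelta k m) v) := by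
  rw [injToGr_eq]
  refine (ev_grDelta_grClass (a := (bijSurj k).obj a) _).trans ?_
  refine (congrArg (chop k m ⟨WideSubcategory.obj a⟩) (injToFilt_val v)).trans ?_
  exact (inclBS_injChop v).symm.trans (bijSurj_map _).symm

/-- All coefficients involved descend to the graded pieces, so the identity reduces to
`chop_swap_add_chop` for representatives in `G_1`. -/
theorem grDelta_pairing {m : ℕ} {x x' : Free k FS} (v : (grBimod k 1).X x' (spts k (m + 2)))
    (w : (grBimod k 1).X x x') :
    Bimod.ev (grDelta k m) ((grBimod k 1).lact x (Bimod.ev (grDelta k (m + 1))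
      ((grBimod k 1).lact x' ((bijSurj k).map
      (bijArr k (Equiv.swap (Fin.last m).castSucc (Fin.last m).succ))) v)) w) +
    Bimod.ev (grDelta k m) ((grBimod k 1).lact x (Bimod.ev (grDelta k (m + 1)) v) w) =
      Bimod.ev (grDeltaTwo k m) (grMul k 1 1 x x' (spts k (m + 2)) v w) := by
  obtain ⟨v, -, rfl⟩ := exists_grClass_eq v
  obtain ⟨w, -, rfl⟩ := exists_grClass_eq w
  have key : ∀ r : x' ⟶ spts k (m + 1),
      Bimod.ev (grDelta k m) ((grBimod k 1).lact x r (grClass k 1 x x' w)) =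
      chop k m x (w.1 ≫ inclS k x' ⟨⟨m + 1⟩⟩ r) := fun r =>
    (congrArg (Bimod.ev (grDelta k m)) (lact_grClass r w)).trans
      ((ev_grDelta_grClass _).trans (congrArg (chop k m x) (filt_lact_val r w)))
  have h3 : Bimod.ev (grDeltaTwo k m) (grMul k 1 1 x x' (spts k (m + 2)) (grClass k 1 _ _ v)
      (grClass k 1 x x' w)) = chopTwo k m x (w.1 ≫ v.1) :=
    (congrArg (Bimod.ev (grDeltaTwo k m)) (grMul_class k 1 1 _ _ _ v w)).trans
      ((ev_grDeltaTwo_grClass _).trans (congrArg (chopTwo k m x) (filtMul_val v w)))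
  refine Eq.trans ?_ h3.symm
  refine Eq.trans ?_ (chop_swap_add_chop (x := x') (x' := x) w.2 v.2)
  refine congrArg₂ (· + ·) ((key _).trans ?_) ((key _).trans ?_)
  · refine congrArg (fun z => chop k m x (w.1 ≫ inclS k x' ⟨⟨m + 1⟩⟩ z)) ?_
    refine (congrArg (Bimod.ev (grDelta k (m + 1))) (lact_grClass _ v)).trans ?_
    refine (ev_grDelta_grClass _).trans (congrArg (chop k (m + 1) x') ?_)
    refine (filt_lact_val _ v).trans (congrArg (v.1 ≫ ·) ?_)
    exact inclS_bijSurj_map_arr (bijHom (Equiv.swap (Fin.last m).castSucc (Fin.last m).succ))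
  · exact congrArg (fun z => chop k m x (w.1 ≫ inclS k x' ⟨⟨m + 1⟩⟩ z)) (ev_grDelta_grClass v)

theorem grDelta_mem_perp (m : ℕ) :
    Bimod.tmul (grBimod k 1).rightDual (grBimod k 1).rightDual (grDelta k m)
      ((grBimod k 1).rightDual.ract _ ((bijSurj k).map
        (bijArr k (Equiv.swap (Fin.last m).castSucc (Fin.last m).succ))) (grDelta k (m + 1))) +
      Bimod.tmul (grBimod k 1).rightDual (grBimod k 1).rightDual (grDelta k m)
        (grDelta k (m + 1)) ∈
      (grBimod k 1).perp (grBimod k (1 + 1)) (fun {x x' a} => grMul k 1 1 x x' a)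
        (spts k (m + 2)) (spts k m) :=
  ⟨grDeltaTwo k m, fun _ _ v w => (map_add _ _ _).trans
    ((congrArg₂ (· + ·) (Bimod.pairing_tmul _ _ _ _ _) (Bimod.pairing_tmul _ _ _ _ _)).trans
      (grDelta_pairing v w))⟩

theorem grDelta_nat {m : ℕ} (f : (⟨⟨m⟩⟩ : FB) ⟶ ⟨⟨m⟩⟩) :
    (grBimod k 1).rightDual.ract (a := spts k (m + 1)) (a' := spts k (m + 1)) (spts k m)
      ((bijSurj k).map (arr k (addHomB f))) (grDelta k m) =
    (grBimod k 1).rightDual.lact (spts k (m + 1)) (b := spts k m) (b' := spts k m)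
      ((bijSurj k).map (arr k f)) (grDelta k m) := by
  refine Bimod.rightDual_ext fun a v => ?_
  obtain ⟨v, -, rfl⟩ := exists_grClass_eq v
  refine (Bimod.ev_ract (V := grBimod k 1) (b := spts k (m + 1)) (b' := spts k (m + 1))
    (c := spts k m) ((bijSurj k).map (arr k (addHomB f))) (grDelta k m) _).trans ?_
  refine Eq.trans ?_ (Bimod.ev_lact (V := grBimod k 1) (b := spts k (m + 1)) (c := spts k m)
    (c' := spts k m) ((bijSurj k).map (arr k f)) (grDelta k m) _).symm
  refine (congrArg (Bimod.ev (grDelta k m)) (lact_grClass _ v)).trans ?_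
  refine (ev_grDelta_grClass _).trans ?_
  refine (congrArg (chop k m a) ((filt_lact_val _ v).trans
    (congrArg (v.1 ≫ ·) (inclS_bijSurj_map_arr (addHomB f))))).trans ?_
  refine (chop_comp_addHomB (x := a) _ f).trans ?_
  exact congrArg₂ (fun x y => CategoryStruct.comp (obj := Free k FS) (X := a) (Y := spts k m)
    (Z := spts k m) x y) (ev_grDelta_grClass v).symm
    (bijSurj_map (k := k) (a := pts k m) (b := pts k m) (arr k f)).symm

variable (k) in
/-- The signed system in `(gr k FA)^⊥`. -/
def grSystem : SignedSystem (bijSurj k ⋙ grDualBase k) where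
  δ m := grDualGen k (grDelta k m)
  nat {m} f := (QuadCat.base_comp_gen ((bijSurj k).map (arr k (addHomB f))) (grDelta k m)).trans
    ((congrArg (grDualGen k) (grDelta_nat f)).trans
      (QuadCat.gen_comp_base (grDelta k m) ((bijSurj k).map (arr k f))).symm)
  swap m := by
    have h := QuadCat.compTwo_gen_eq_zero (grDelta_mem_perp (k := k) m)
    rw [map_add, QuadCat.compTwo_tmul, QuadCat.compTwo_tmul, add_eq_zero_iff_eq_neg] at h
    refine (Category.assoc ..).symm.trans (Eq.trans ?_ h)
    exact congrArg (· ≫ _) (QuadCat.base_comp_gen _ _)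

variable (k) in
/-- The chain of alternating sums in `gr k FA`. -/
def grChain (x : ℕ) : RightQuadDual.Chain (grBimod k 1) (grBimod k (1 + 1))
    (fun {x x' a} => grMul k 1 1 x x' a) where
  X n := spts k (x + n)
  D n := injToGr k (pts k (x + n)) (pts k (x + n + 1)) ((injChain k x).D n)
  mul_eq_zero n _ u := grMul_lact_injToGr_eq_zero ((injChain k x).D (n + 1)) ((injChain k x).D n) u
    (injIncl_D_comp_D x n)

end FinKoszul

end

noncomputable section

namespace FinKoszul

universe u w

theorem exists_eq_pts {k : Type u} (a : Free k FB) : ∃ n, a = pts k n := by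
  obtain ⟨⟨n⟩⟩ := a
  exact ⟨n, rfl⟩

variable {k : Type u} [CommRing k]

attribute [local irreducible] chop chopTwo toBijPart injIncl injChop injChopTwo inclBS inclS grChop
  grChopTwo grClass injToFilt injToGr grDelta grDeltaTwo

/-! ## Dual bases for `gr k FA` -/

variable (k) in
/-- The inclusion of `G_n k FA` into `k FA`. -/
def filtIncl (n : ℤ) (a b : Free k FS) : (filtBimod k n).X a b →ₗ[k]
    (Free.of k (WideSubcategory.obj a : FA) ⟶ Free.of k (WideSubcategory.obj b : FA)) :=
  Submodule.subtype (filt k n (WideSubcategory.obj a) (WideSubcategory.obj b))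

variable (k) in
/-- The functional that takes the coefficient of the injection that misses the point `y`. -/
def grDeltaAt {m : ℕ} (y : Fin (m + 1)) :
    (grBimod k 1).rightDual.X (spts k (m + 1)) (spts k m) :=
  (grBimod k 1).rightDual.ract (spts k m) (a := spts k (m + 1)) (a' := spts k (m + 1))
    ((bijSurj k).map (arr k (toLast y))) (grDelta k m)

theorem ev_grDeltaAt_grClass {m : ℕ} (y : Fin (m + 1)) {a : Free k FS}
    (v : (filtBimod k 1).X a (spts k (m + 1))) :
    Bimod.ev (grDeltaAt k y) (grClass k 1 a (spts k (m + 1)) v) =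
      chop k m a (filtIncl k 1 a (spts k (m + 1)) v ≫ arr k (toLast y).hom) := by
  refine (Bimod.ev_ract (V := grBimod k 1) (b := spts k (m + 1)) (b' := spts k (m + 1))
    (c := spts k m) ((bijSurj k).map (arr k (toLast y))) (grDelta k m) _).trans ?_
  refine (congrArg (Bimod.ev (grDelta k m)) (lact_grClass _ v)).trans ?_
  refine (ev_grDelta_grClass _).trans ?_
  exact congrArg (chop k m a) ((filt_lact_val _ v).trans
    (congrArg (filtIncl k 1 a (spts k (m + 1)) v ≫ ·) (inclS_bijSurj_map_arr (toLast y))))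

/-- In `gr_1` the expansion modulo `G_0` becomes an equality. The injections that serve for `k
FI^[1]` thus also serve over `k FS`, and functionals on `gr_1` are those on `k FI^[1]` with
coefficients extended to `k FS`. -/
theorem gr_dualBasis {m : ℕ} (a : Free k FS) (w : (grBimod k 1).X a (spts k (m + 1))) :
    ∑ y, (grBimod k 1).ract (spts k (m + 1)) (Bimod.ev (grDeltaAt k y) w)
      (injToGr k (pts k m) (pts k (m + 1)) (cofaceAt k y)) = w := by
  obtain ⟨v, -, rfl⟩ := exists_grClass_eq w
  have h1 : ∀ y : Fin (m + 1), (grBimod k 1).ract (spts k (m + 1))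
      (Bimod.ev (grDeltaAt k y) (grClass k 1 a (spts k (m + 1)) v))
      (injToGr k (pts k m) (pts k (m + 1)) (cofaceAt k y)) = grClass k 1 a (spts k (m + 1))
        ((filtBimod k 1).ract (spts k (m + 1)) (a := spts k m) (a' := a)
          (chop k m a (filtIncl k 1 a (spts k (m + 1)) v ≫ arr k (toLast y).hom))
          (injToFilt k (pts k m) (pts k (m + 1)) (cofaceAt k y))) := fun y => by
    rw [injToGr_eq, ract_grClass]
    exact congrArg (fun r => grClass k 1 a (spts k (m + 1)) ((filtBimod k 1).ract (spts k (m + 1))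
      (a := spts k m) (a' := a) r (injToFilt k (pts k m) (pts k (m + 1)) (cofaceAt k y))))
      (ev_grDeltaAt_grClass y v)
  refine (Finset.sum_congr rfl fun y _ => h1 y).trans ?_
  rw [← map_sum]
  refine grClass_eq_of_sub_mem ?_
  have h2 := sum_chop_sub_mem (x := a) v.2
  refine (congrArg (fun z => z - v.1 ∈ filt k 0 (WideSubcategory.obj a) ⟨m + 1⟩) ?_).mpr h2
  refine (map_sum (filtIncl k 1 a (spts k (m + 1))) _ _).trans ?_
  refine Finset.sum_congr rfl fun y _ => ?_
  refine (filt_ract_val (a := spts k m) (a' := a) (b := spts k (m + 1)) _ _).trans ?_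
  exact congrArg (inclS k a ⟨⟨m⟩⟩ _ ≫ ·) ((injToFilt_val _).trans (injIncl_cofaceAt y))

/-- Every map to the empty set is surjective, so `G_1 = G_0` there. -/
theorem gr_spts_zero {a : Free k FS} (w : (grBimod k 1).X a (spts k 0)) : w = 0 := by
  obtain ⟨v, hv, rfl⟩ := exists_grClass_eq w
  refine grClass_eq_zero ?_
  have h : filtIncl k 1 a (spts k 0) v ∈ filt k 0 (WideSubcategory.obj a) ⟨0⟩ := by
    refine arr_induction (P := fun v => v ∈ filt k 0 (WideSubcategory.obj a) ⟨0⟩) _ (zero_mem _)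
      (fun _ _ => add_mem) (fun r _ => Submodule.smul_mem _ r) (fun f => ?_)
    refine Submodule.subset_span ⟨f, ?_, rfl⟩
    exact ⟨⟨0⟩, f, 𝟙 _, fun p => Fin.elim0 p, Function.injective_id, by simp, rfl⟩
  exact h

theorem exists_eq_spts (a : Free k FS) : ∃ n, a = spts k n := by
  obtain ⟨⟨n⟩⟩ := a
  exact ⟨n, rfl⟩

/-- A functional on `gr_1` is determined by its values on injections. -/
theorem grDual_ext {a : Free k FB} {c : Free k FS}
    {χ χ' : (grBimod k 1).rightDual.X ((bijSurj k).obj a) c}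
    (h : ∀ (x : Free k FB) (i : (injPart k 1).X x a),
      Bimod.ev χ (injToGr k x a i) = Bimod.ev χ' (injToGr k x a i)) : χ = χ' := by
  obtain ⟨n, rfl⟩ := exists_eq_pts a
  cases n with
  | zero =>
    refine Bimod.rightDual_ext fun x v => ?_
    have h0 : v = 0 := gr_spts_zero v
    rw [h0, map_zero, map_zero]
  | succ m =>
    refine (Bimod.eq_sum_of_dualBasis (fun y => injToGr k (pts k m) (pts k (m + 1)) (cofaceAt k y))
      (grDeltaAt k) gr_dualBasis χ).symm.trans (Eq.trans ?_ (Bimod.eq_sum_of_dualBasis (fun y =>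
        injToGr k (pts k m) (pts k (m + 1)) (cofaceAt k y)) (grDeltaAt k) gr_dualBasis χ'))
    exact Finset.sum_congr rfl fun y _ => congrArg (fun r => (grBimod k 1).rightDual.lact
      (spts k (m + 1)) (b := spts k m) (b' := c) r (grDeltaAt k y)) (h (pts k m) (cofaceAt k y))

theorem ev_grDeltaAt_injToGr {m : ℕ} (y : Fin (m + 1)) {a : Free k FB}
    (v : (injPart k 1).X a (pts k (m + 1))) :
    Bimod.ev (grDeltaAt k y) (injToGr k a (pts k (m + 1)) v) =
      (bijSurj k).map (Bimod.ev (injDeltaAt k y) v) := by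
  refine (Bimod.ev_ract (V := grBimod k 1) (b := spts k (m + 1)) (b' := spts k (m + 1))
    (c := spts k m) ((bijSurj k).map (arr k (toLast y))) (grDelta k m) _).trans ?_
  refine (congrArg (Bimod.ev (grDelta k m)) (injToGr_lact (b := pts k (m + 1))
    (b' := pts k (m + 1)) (arr k (toLast y)) v).symm).trans ?_
  exact ev_grDelta_injToGr _

theorem exists_grExt {a c : Free k FB} (φ : (injPart k 1).rightDual.X a c) :
    ∃ χ : (grBimod k 1).rightDual.X ((bijSurj k).obj a) ((bijSurj k).obj c),
      ∀ (x : Free k FB) (i : (injPart k 1).X x a),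
        Bimod.ev χ (injToGr k x a i) = (bijSurj k).map (Bimod.ev φ i) := by
  obtain ⟨n, rfl⟩ := exists_eq_pts a
  cases n with
  | zero =>
    refine ⟨0, fun x i => ?_⟩
    have h0 : i = 0 := injPart_pts_zero i
    rw [h0, map_zero, map_zero, map_zero, map_zero, (bijSurj k).map_zero]
  | succ m =>
    -- The coefficients of `φ` in the dual basis of `k FI^[1]`, used in the dual basis of `gr_1`.
    refine ⟨∑ y, (grBimod k 1).rightDual.lact (spts k (m + 1)) (b := spts k m)
      (b' := (bijSurj k).obj c)
      ((bijSurj k).map (Bimod.ev φ (cofaceAt k y))) (grDeltaAt k y), fun x i => ?_⟩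
    rw [map_sum, LinearMap.sum_apply]
    refine Eq.trans ?_ (congrArg (fun φ => (bijSurj k).map (Bimod.ev φ i))
      (Bimod.eq_sum_of_dualBasis (cofaceAt k) (injDeltaAt k) inj_dualBasis φ))
    rw [map_sum, LinearMap.sum_apply, Functor.map_sum]
    refine Finset.sum_congr rfl fun y _ => ?_
    refine (congrArg (· ≫ (bijSurj k).map (Bimod.ev φ (cofaceAt k y)))
      (ev_grDeltaAt_injToGr y i)).trans ?_
    exact ((bijSurj k).map_comp _ _).symm

variable (k) in
/-- The extension of functionals on `k FI^[1]` to `gr_1 k FA`. -/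
def grExt (a c : Free k FB) : (injPart k 1).rightDual.X a c →ₗ[k]
    (grBimod k 1).rightDual.X ((bijSurj k).obj a) ((bijSurj k).obj c) where
  toFun φ := (exists_grExt φ).choose
  map_add' φ ψ := grDual_ext fun x i => by
    rw [map_add, LinearMap.add_apply, (exists_grExt φ).choose_spec, (exists_grExt ψ).choose_spec,
      (exists_grExt (φ + ψ)).choose_spec, map_add, LinearMap.add_apply, Functor.map_add]
  map_smul' r φ := grDual_ext fun x i => by
    rw [RingHom.id_apply, map_smul, LinearMap.smul_apply, (exists_grExt φ).choose_spec,
      (exists_grExt (r • φ)).choose_spec, map_smul, LinearMap.smul_apply, Functor.map_smul]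

theorem ev_grExt {a c : Free k FB} (φ : (injPart k 1).rightDual.X a c) (x : Free k FB)
    (i : (injPart k 1).X x a) :
    Bimod.ev (grExt k a c φ) (injToGr k x a i) = (bijSurj k).map (Bimod.ev φ i) :=
  (exists_grExt φ).choose_spec x i

/-- Extensions are determined by their values on injections, so only those are compared. -/
theorem grExt_ract {a a' c : Free k FB} (f : a' ⟶ a) (φ : (injPart k 1).rightDual.X a c) :
    grExt k a' c ((injPart k 1).rightDual.ract c f φ) =
      (grBimod k 1).rightDual.ract ((bijSurj k).obj c) ((bijSurj k).map f) (grExt k a c φ) :=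
  grDual_ext fun x i => (ev_grExt _ x i).trans
    ((ev_grExt φ x _).symm.trans (congrArg (Bimod.ev (grExt k a c φ)) (injToGr_lact f i)))

theorem grExt_lact {a c c' : Free k FB} (f : c ⟶ c') (φ : (injPart k 1).rightDual.X a c) :
    grExt k a c' ((injPart k 1).rightDual.lact a f φ) =
      (grBimod k 1).rightDual.lact ((bijSurj k).obj a) ((bijSurj k).map f) (grExt k a c φ) :=
  grDual_ext fun x i => (ev_grExt _ x i).trans (((bijSurj k).map_comp _ _).trans
    (congrArg (· ≫ (bijSurj k).map f) (ev_grExt φ x i).symm))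

/-! ## Expansion in the quadratic dual of `gr k FA` -/

theorem grSystem_generating : (grSystem k).Generating where
  eq_zero φ := Bimod.rightDual_ext fun a v => by
    have h : v = 0 := gr_spts_zero v
    rw [h, map_zero, map_zero]
  mem_span {m c} φ := by
    have h := Bimod.eq_sum_of_dualBasis (fun y => injToGr k (pts k m) (pts k (m + 1))
      (cofaceAt k y)) (grDeltaAt k) gr_dualBasis φ
    rw [← h, map_sum]
    refine sum_mem fun y _ => Submodule.subset_span ⟨Equiv.swap y (Fin.last m),
      Bimod.ev φ (injToGr k (pts k m) (pts k (m + 1)) (cofaceAt k y)), ?_⟩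
    refine (QuadCat.gen_comp_base _ _).symm.trans ?_
    refine Eq.trans ?_ (Category.assoc ..)
    exact congrArg (· ≫ _) (QuadCat.base_comp_gen _ _).symm

theorem grIter_mem_degree (x n : ℕ) : (grSystem k).iter x n ∈ grDualDegree k n _ _ := by
  induction n with
  | zero => exact QuadCat.base_mem_degree (𝟙 (spts k x))
  | succ n ih =>
    have := QuadCat.comp_mem_degree (QuadCat.gen_mem_degree (grDelta k (x + n))) ih
    rwa [add_comm 1 n] at this

theorem ev_grExt_D {x n : ℕ} {a c : Free k FB} (φ : (injPart k 1).rightDual.X a c)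
    (u : pts k (x + (n + 1)) ⟶ a) :
    Bimod.ev (grExt k a c φ) ((grBimod k 1).lact (spts k (x + n)) ((bijSurj k).map u)
      ((grChain k x).D n)) =
      (bijSurj k).map (Bimod.ev φ ((injPart k 1).lact (pts k (x + n)) u ((injChain k x).D n))) :=
  (congrArg (Bimod.ev (grExt k a c φ)) (injToGr_lact u ((injChain k x).D n)).symm).trans
    (ev_grExt φ _ _)

theorem grExt_injDelta (m : ℕ) : grExt k (pts k (m + 1)) (pts k m) (injDelta k m) = grDelta k m :=
  grDual_ext fun x i => (ev_grExt _ x i).trans (ev_grDelta_injToGr i).symm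

theorem RightQuadDual.value_id {k : Type u} [CommRing k] {C : Type} [Category.{u} C]
    [Preadditive C] [Linear k C] {V B₂ : Bimod k C C}
    {μ : ∀ {x x' a : C}, V.X x' a →ₗ[k] V.X x x' →ₗ[k] B₂.X x a}
    (S : RightQuadDual.Chain V B₂ μ) {a : C} (u : S.X 0 ⟶ a) :
    RightQuadDual.value S 0 u (𝟙 ((QuadCat.base V.rightDual (V.perp B₂ μ)).obj a)) = u := by
  have h1 := RightQuadDual.rep_base_single S (𝟙 a) 0 u
  refine (congrFun h1 0).trans ?_
  refine (Pi.single_eq_same (M := fun m => (S.X m ⟶ a)) 0 _).trans (Category.comp_id u)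

/-- Both values obey the same recursion, because the functionals and the chain of `gr k FA` extend
those of `k FI`. When level and length of the iterate differ, both sides vanish by degree. -/
theorem value_grIter (x n : ℕ) : ∀ (x' n' : ℕ) (u : pts k (x + n) ⟶ pts k (x' + n')),
    RightQuadDual.value (grChain k x) n ((bijSurj k).map u) ((grSystem k).iter x' n') =
      (bijSurj k).map (RightQuadDual.value (injChain k x) n u ((injSystem k).iter x' n')) := by
  have hne : ∀ (n x' n' : ℕ) (_ : n ≠ n') (u : pts k (x + n) ⟶ pts k (x' + n')),
    RightQuadDual.value (grChain k x) n ((bijSurj k).map u) ((grSystem k).iter x' n') =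
      (bijSurj k).map (RightQuadDual.value (injChain k x) n u ((injSystem k).iter x' n')) := by
    intro n x' n' h u
    refine (RightQuadDual.value_eq_zero (grChain k x) h _ (grIter_mem_degree x' n')).trans ?_
    refine Eq.trans ?_ (congrArg (fun r => (bijSurj k).map r)
      (RightQuadDual.value_eq_zero (injChain k x) h u (iter_mem_degree x' n')).symm)
    exact ((bijSurj k).map_zero _ _).symm
  induction n with
  | zero =>
    intro x' n' u
    cases n' with
    | zero =>
      refine (RightQuadDual.value_id (grChain k x) _).trans ?_
      exact congrArg (fun r => (bijSurj k).map r) (RightQuadDual.value_id (injChain k x) u).symm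
    | succ n' => exact hne 0 x' (n' + 1) (by omega) u
  | succ n ih =>
    intro x' n' u
    cases n' with
    | zero => exact hne (n + 1) x' 0 (by omega) u
    | succ n' =>
      refine (RightQuadDual.value_gen_comp (grChain k x) (grDelta k (x' + n')) n
        ((bijSurj k).map u) ((grSystem k).iter x' n')).trans ?_
      refine Eq.trans ?_ (congrArg (fun r => (bijSurj k).map r)
        (RightQuadDual.value_gen_comp (injChain k x) (injDelta k (x' + n')) n
          u ((injSystem k).iter x' n')).symm)
      refine Eq.trans ?_ (ih x' n' (Bimod.ev (injDelta k (x' + n')) ((injPart k 1).lact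
        (pts k (x + n)) u ((injChain k x).D n))))
      refine congrArg (fun r => RightQuadDual.value (grChain k x) n r ((grSystem k).iter x' n')) ?_
      have h := ev_grExt_D (injDelta k (x' + n')) u
      rw [grExt_injDelta] at h
      exact h

variable (k) in
/-- The value of a morphism of `(gr k FA)^⊥` on the chain attached to a subset. -/
def grCoeff {a : ℕ} (s : Finset (Fin a)) (c : Free k FS) :
    ((grDualBase k).obj (spts k a) ⟶ (grDualBase k).obj c) →ₗ[k] (spts k s.card ⟶ c) :=
  RightQuadDual.value (grChain k s.card) sᶜ.card ((bijSurj k).map (bijArr k (splitEquiv s)))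

theorem grCoeff_comp_base {a : ℕ} (s : Finset (Fin a)) {c d : Free k FS}
    (z : (grDualBase k).obj (spts k a) ⟶ (grDualBase k).obj c) (t : c ⟶ d) :
    grCoeff k s d (z ≫ (grDualBase k).map t) = grCoeff k s c z ≫ t :=
  RightQuadDual.value_comp_base _ _ _ _ _

theorem grCoeff_base_comp_iter {a : ℕ} (s : Finset (Fin a)) {x n : ℕ}
    (τ : pts k a ⟶ pts k (x + n)) :
    grCoeff k s (spts k x) ((grDualBase k).map ((bijSurj k).map τ) ≫ (grSystem k).iter x n) =
      (bijSurj k).map (injCoeff k s (pts k x) ((injDualBase k).map τ ≫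
        (injSystem k).iter x n)) := by
  refine (RightQuadDual.value_base_comp (grChain k s.card) ((bijSurj k).map τ) sᶜ.card
    ((bijSurj k).map (bijArr k (splitEquiv s))) ((grSystem k).iter x n)).trans ?_
  refine Eq.trans ?_ (congrArg (fun r => (bijSurj k).map r)
    (RightQuadDual.value_base_comp (injChain k s.card) τ sᶜ.card
      (bijArr k (splitEquiv s)) ((injSystem k).iter x n)).symm)
  refine Eq.trans ?_ (value_grIter s.card sᶜ.card x n (bijArr k (splitEquiv s) ≫ τ))
  exact congrArg (fun r => RightQuadDual.value (grChain k s.card) sᶜ.card r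
    ((grSystem k).iter x n)) ((bijSurj k).map_comp _ _).symm

/-- The expansion of a morphism of `(gr k FA)^⊥` along the subsets of its source. -/
theorem gr_eq_sum {a : ℕ} {c : Free k FS}
    (z : (grDualBase k).obj (spts k a) ⟶ (grDualBase k).obj c) :
    ∑ s : Finset (Fin a), (grDualBase k).map ((bijSurj k).map (bijArr k (splitEquiv s).symm)) ≫
      (grSystem k).iter s.card sᶜ.card ≫ (grDualBase k).map (grCoeff k s c z) = z :=
  SignedSystem.eq_sum_of_coeff grSystem_generating (fun s => grCoeff k s c)
    (fun s _ _ τ t => (congrArg (grCoeff k s c) (Category.assoc ..).symm).trans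
      ((grCoeff_comp_base s _ t).trans (congrArg (· ≫ t) (grCoeff_base_comp_iter s τ)))) z

/-- A morphism of `(gr k FA)^⊥` with vanishing coefficients is zero. -/
theorem eq_zero_of_grCoeff {a : ℕ} {c : Free k FS}
    {z : (grDualBase k).obj (spts k a) ⟶ (grDualBase k).obj c}
    (h : ∀ s : Finset (Fin a), grCoeff k s c z = 0) : z = 0 := by
  rw [← gr_eq_sum z]
  refine Finset.sum_eq_zero fun s _ => ?_
  rw [h s, Functor.map_zero, Limits.comp_zero, Limits.comp_zero]

theorem grCoeff_eq_zero {a n : ℕ} {c : Free k FS} {s : Finset (Fin a)} (h : sᶜ.card ≠ n)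
    {z : (grDualBase k).obj (spts k a) ⟶ (grDualBase k).obj c}
    (hz : z ∈ grDualDegree k n _ _) : grCoeff k s c z = 0 :=
  RightQuadDual.value_eq_zero _ h _ hz

/-! ### Independence of the degrees -/

variable (k) in
/-- The quadratic dual `(gr k FA)^⊥` is graded. -/
theorem gr_isGrading : IsGrading (k := k) (grDualDegree k) where
  isInternal a b := by
    refine DirectSum.isInternal_submodule_of_iSupIndep_of_iSup_eq_top ?_
      (QuadCat.iSup_degree_eq_top a b)
    intro n
    rw [Submodule.disjoint_def]
    intro z hz hz'
    obtain ⟨a⟩ := a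
    obtain ⟨b⟩ := b
    obtain ⟨a, rfl⟩ := exists_eq_spts a
    refine eq_zero_of_grCoeff (c := b) fun s => ?_
    -- The coefficient at `s` sees only the degree `|sᶜ|`. If this is `n`, it kills the span of the
    -- other degrees; otherwise it kills `z`, which has degree `n`.
    by_cases hs : sᶜ.card = n
    · have h1 : ⨆ m, ⨆ (_ : m ≠ n), grDualDegree k m ⟨spts k a⟩ ⟨b⟩ ≤
          LinearMap.ker (grCoeff k s b) :=
        iSup₂_le fun m hm z hz => grCoeff_eq_zero (fun h => hm (h.symm.trans hs)) hz
      exact h1 hz'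
    · exact grCoeff_eq_zero hs hz
  id_mem a := QuadCat.base_mem_degree (𝟙 a.obj)
  comp_mem _ _ hf hg := QuadCat.comp_mem_degree hf hg

end FinKoszul

end

noncomputable section

namespace FinKoszul

universe u w

variable {k : Type u} [CommRing k]

attribute [local irreducible] chop chopTwo toBijPart injIncl injChop injChopTwo inclBS inclS grChop
  grChopTwo grClass injToFilt injToGr grDelta grDeltaTwo grExt

/-! ## The functor between the quadratic duals -/

theorem RightQuadDual.value_gen {k : Type u} [CommRing k] {C : Type} [Category.{u} C]
    [Preadditive C] [Linear k C] {V B₂ : Bimod k C C}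
    {μ : ∀ {x x' a : C}, V.X x' a →ₗ[k] V.X x x' →ₗ[k] B₂.X x a} (S : Chain V B₂ μ) {a b : C}
    (φ : V.rightDual.X a b) (u : S.X 1 ⟶ a) :
    value S 1 u (QuadCat.gen V.rightDual (V.perp B₂ μ) φ) = Bimod.ev φ (V.lact _ u (S.D 0)) :=
  (congrFun (rep_gen_single S φ 0 u) 0).trans (Pi.single_eq_same (M := fun m => (S.X m ⟶ b)) 0 _)

variable (k) in
/-- The generators of `k FI^⊥` in `(gr k FA)^⊥`. -/
def extGen (a b : Free k FB) : (injPart k 1).rightDual.X a b →ₗ[k]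
    ((bijSurj k ⋙ grDualBase k).obj a ⟶ (bijSurj k ⋙ grDualBase k).obj b) :=
  grDualGen k ∘ₗ grExt k a b

theorem extGen_ract {a a' b : Free k FB} (f : a' ⟶ a) (φ : (injPart k 1).rightDual.X a b) :
    extGen k a' b ((injPart k 1).rightDual.ract b f φ) =
      (bijSurj k ⋙ grDualBase k).map f ≫ extGen k a b φ :=
  (congrArg (grDualGen k) (grExt_ract f φ)).trans (QuadCat.base_comp_gen _ _).symm

theorem extGen_lact {a b b' : Free k FB} (f : b ⟶ b') (φ : (injPart k 1).rightDual.X a b) :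
    extGen k a b' ((injPart k 1).rightDual.lact a f φ) =
      extGen k a b φ ≫ (bijSurj k ⋙ grDualBase k).map f :=
  (congrArg (grDualGen k) (grExt_lact f φ)).trans (QuadCat.gen_comp_base _ _).symm

variable (k) in
/-- The products of two generators of `k FI^⊥` in `(gr k FA)^⊥`. -/
def extTwo (a c : Free k FB) :
    Bimod.TensorX (injPart k 1).rightDual (injPart k 1).rightDual a c →ₗ[k]
      ((grDualBase k).obj ((bijSurj k).obj a) ⟶ (grDualBase k).obj ((bijSurj k).obj c)) :=
  QuadCat.compTwo (bijSurj k ⋙ grDualBase k) (fun {a b} => extGen k a b) extGen_ract extGen_lact a c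

theorem extTwo_tmul {a c d : Free k FB} (φ : (injPart k 1).rightDual.X d c)
    (χ : (injPart k 1).rightDual.X a d) :
    extTwo k a c (Bimod.tmul (injPart k 1).rightDual (injPart k 1).rightDual φ χ) =
      grDualGen k (grExt k a d χ) ≫ grDualGen k (grExt k d c φ) :=
  QuadCat.compTwo_tmul ..

theorem value_extTwo_of_ne {x n : ℕ} (hn : n ≠ 2) {a c : Free k FB}
    (u : spts k (x + n) ⟶ (bijSurj k).obj a)
    (t : Bimod.TensorX (injPart k 1).rightDual (injPart k 1).rightDual a c) :
    RightQuadDual.value (grChain k x) n u (extTwo k a c t) = 0 := by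
  refine LinearMap.congr_fun (f := RightQuadDual.value (grChain k x) n u ∘ₗ extTwo k a c) (g := 0)
    (Bimod.tensor_ext fun d φ χ => ?_) t
  refine (congrArg (RightQuadDual.value (grChain k x) n u) (extTwo_tmul φ χ)).trans ?_
  have h2 : grDualGen k (grExt k a d χ) ≫ grDualGen k (grExt k d c φ) ∈
      grDualDegree k (1 + 1) _ _ :=
    QuadCat.comp_mem_degree (QuadCat.gen_mem_degree (grExt k a d χ))
      (QuadCat.gen_mem_degree (grExt k d c φ))
  exact RightQuadDual.value_eq_zero (grChain k x) hn u h2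

theorem value_extTwo {x : ℕ} {a c : Free k FB} (u : pts k (x + 2) ⟶ a)
    (t : Bimod.TensorX (injPart k 1).rightDual (injPart k 1).rightDual a c) :
    RightQuadDual.value (grChain k x) 2 ((bijSurj k).map u) (extTwo k a c t) =
      (bijSurj k).map (Bimod.pairing (injPart k 1) ((injPart k 1).lact (pts k (x + 1)) u
        ((injChain k x).D 1)) ((injChain k x).D 0) t) := by
  refine LinearMap.congr_fun
    (f := RightQuadDual.value (grChain k x) 2 ((bijSurj k).map u) ∘ₗ extTwo k a c)
    (g := (bijSurj k).mapLinearMap k ∘ₗ Bimod.pairing (injPart k 1) ((injPart k 1).lact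
      (pts k (x + 1)) u ((injChain k x).D 1)) ((injChain k x).D 0))
    (Bimod.tensor_ext fun d φ χ => ?_) t
  refine (congrArg (RightQuadDual.value (grChain k x) 2 ((bijSurj k).map u))
    (extTwo_tmul φ χ)).trans ?_
  refine Eq.trans ?_ (congrArg (fun r => (bijSurj k).map r)
    (Bimod.pairing_tmul (injPart k 1) _ _ φ χ)).symm
  refine (RightQuadDual.value_gen_comp (grChain k x) (grExt k a d χ) 1 ((bijSurj k).map u)
    (grDualGen k (grExt k d c φ))).trans ?_
  refine (RightQuadDual.value_gen (grChain k x) (grExt k d c φ) _).trans ?_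
  refine Eq.trans ?_ (ev_grExt_D (x := x) (n := 0) φ (Bimod.ev χ ((injPart k 1).lact (pts k (x + 1))
    u ((injChain k x).D 1))))
  exact congrArg (fun r => Bimod.ev (grExt k d c φ) ((grBimod k 1).lact (spts k (x + 0)) r
    ((grChain k x).D 0))) (ev_grExt_D (x := x) (n := 1) χ u)

/-- No extension of `ψ` to `gr_2` is needed, since a morphism with vanishing coefficients is zero.
Only coefficients of level two can be nonzero, and there they are `ψ` of a product of two
consecutive steps of the chain, which vanishes. -/
theorem extTwo_eq_zero {a c : Free k FB}
    {t : Bimod.TensorX (injPart k 1).rightDual (injPart k 1).rightDual a c}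
    (ht : t ∈ (injPart k 1).perp (injPart k (1 + 1)) (fun {x x' a} => injMul k 1 1 x x' a) a c) :
    extTwo k a c t = 0 := by
  obtain ⟨n, rfl⟩ := exists_eq_pts a
  refine eq_zero_of_grCoeff fun s => ?_
  -- The level is a variable so that it can be set equal to `2`.
  have key : ∀ (m : ℕ) (u : pts k (s.card + m) ⟶ pts k n),
      RightQuadDual.value (grChain k s.card) m ((bijSurj k).map u)
        (extTwo k (pts k n) c t) = 0 := by
    intro m u
    by_cases hm : m = 2
    · subst hm
      refine (value_extTwo u t).trans ?_
      obtain ⟨ψ, hψ⟩ := ht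
      refine (congrArg (fun r => (bijSurj k).map r) ((hψ _ _ _ _).trans
        ((congrArg (Bimod.ev ψ) ((injChain k s.card).mul_eq_zero 0 (pts k n) u)).trans
          (map_zero _)))).trans ?_
      exact (bijSurj k).map_zero _ _
    · exact value_extTwo_of_ne hm _ t
  exact key sᶜ.card (bijArr k (splitEquiv s))

variable (k) in
/-- The functor `k FI^⊥ ⥤ (gr k FA)^⊥`. -/
def dualFunctor : InjDual k ⥤ GrDual k :=
  QuadCat.lift (bijSurj k ⋙ grDualBase k) (fun {a b} => extGen k a b) extGen_ract extGen_lact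
    (fun _ _ _ ht => extTwo_eq_zero ht)

instance : (dualFunctor k).Additive where
  map_add := by rintro _ _ ⟨x⟩ ⟨y⟩; rfl

instance : (dualFunctor k).Linear k where
  map_smul := by rintro _ _ ⟨x⟩ r; rfl

variable (k) in
/-- The functor `k FI^⊥ ⥤ (gr k FA)^⊥` on morphisms. -/
def dualMap (a b : Free k FB) : ((injDualBase k).obj a ⟶ (injDualBase k).obj b) →ₗ[k]
    ((grDualBase k).obj ((bijSurj k).obj a) ⟶ (grDualBase k).obj ((bijSurj k).obj b)) :=
  (dualFunctor k).mapLinearMap k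

theorem dualMap_comp {a b c : Free k FB} (x : (injDualBase k).obj a ⟶ (injDualBase k).obj b)
    (y : (injDualBase k).obj b ⟶ (injDualBase k).obj c) :
    dualMap k a c (x ≫ y) = dualMap k a b x ≫ dualMap k b c y :=
  (dualFunctor k).map_comp x y

theorem dualMap_base {a b : Free k FB} (r : a ⟶ b) :
    dualMap k a b ((injDualBase k).map r) = (grDualBase k).map ((bijSurj k).map r) := rfl

theorem dualMap_gen {a b : Free k FB} (φ : (injPart k 1).rightDual.X a b) :
    dualMap k a b (injDualGen k φ) = grDualGen k (grExt k a b φ) := rfl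

attribute [local irreducible] dualMap

theorem dualMap_iter (x n : ℕ) :
    dualMap k (pts k (x + n)) (pts k x) ((injSystem k).iter x n) = (grSystem k).iter x n := by
  induction n with
  | zero =>
    refine (dualMap_base (𝟙 (pts k x))).trans ?_
    exact (congrArg (fun r => (grDualBase k).map r) ((bijSurj k).map_id _)).trans
      ((grDualBase k).map_id _)
  | succ n ih =>
    refine (dualMap_comp (injDualGen k (injDelta k (x + n))) ((injSystem k).iter x n)).trans ?_
    refine congrArg₂ (· ≫ ·) ((dualMap_gen (injDelta k (x + n))).trans ?_) ih
    exact congrArg (grDualGen k) (grExt_injDelta (x + n))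

theorem dualMap_mem_degree {a b : Free k FB} {n : ℕ}
    {z : (injDualBase k).obj a ⟶ (injDualBase k).obj b} (hz : z ∈ injDualDegree k n _ _) :
    dualMap k a b z ∈ grDualDegree k n _ _ := by
  refine QuadCat.mem_degree_induction (P := fun {a b} n z => dualMap k a b z ∈ grDualDegree k n _ _)
    (fun f => ?_) (fun v => ?_) ?_ ?_ ?_ ?_ hz
  · rw [dualMap_base]; exact QuadCat.base_mem_degree _
  · rw [dualMap_gen]; exact QuadCat.gen_mem_degree _
  · intro a b n; rw [map_zero]; exact zero_mem _
  · intro a b n x y hx hy; rw [map_add]; exact add_mem hx hy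
  · intro a b n r x hx; rw [map_smul]; exact Submodule.smul_mem _ r hx
  · intro a b c m n x y hx hy; rw [dualMap_comp]; exact QuadCat.comp_mem_degree hx hy

/-- `z` is a sum of iterates between morphisms of degree zero. The functor `j` carries iterates to
iterates, and these have matching coefficients in both duals. -/
theorem grCoeff_dualMap {a : ℕ} (s : Finset (Fin a)) {c : Free k FB}
    (z : (injDualBase k).obj (pts k a) ⟶ (injDualBase k).obj c) :
    grCoeff k s ((bijSurj k).obj c) (dualMap k (pts k a) c z) =
      (bijSurj k).map (injCoeff k s c z) := by
  refine LinearMap.congr_fun (f := grCoeff k s ((bijSurj k).obj c) ∘ₗ dualMap k (pts k a) c)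
    (g := (bijSurj k).mapLinearMap k ∘ₗ injCoeff k s c) ?_ z
  refine LinearMap.ext fun z => ?_
  rw [← inj_eq_sum z, map_sum, map_sum]
  refine Finset.sum_congr rfl fun s' _ => ?_
  rw [← Category.assoc]
  generalize injCoeff k s' c z = t
  refine (congrArg (grCoeff k s ((bijSurj k).obj c)) ((dualMap_comp _ _).trans
    (congrArg₂ (· ≫ ·) ((dualMap_comp _ _).trans (congrArg₂ (· ≫ ·)
      (dualMap_base (bijArr k (splitEquiv s').symm)) (dualMap_iter _ _)))
        (dualMap_base t)))).trans ?_
  refine (grCoeff_comp_base s _ _).trans ?_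
  refine (congrArg (· ≫ (bijSurj k).map t) (grCoeff_base_comp_iter s _)).trans ?_
  refine ((bijSurj k).map_comp _ _).symm.trans ?_
  exact congrArg (fun r => (bijSurj k).map r) (RightQuadDual.value_comp_base _ _ _ _ _).symm

end FinKoszul

end

noncomputable section

namespace FinKoszul

universe u w

variable {k : Type u} [CommRing k]

attribute [local irreducible] chop chopTwo toBijPart injIncl injChop injChopTwo inclBS inclS grChop
  grChopTwo grClass injToFilt injToGr grDelta grDeltaTwo grExt dualMap

/-! ## The isomorphism -/

variable (k) in
/-- `k FS` as a right `k FB`-module. -/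
abbrev surjBij : Bimod k (Free k FB) (Free k FB) := toBij (surjMod k)

theorem surjBij_ract {a a' b : Free k FB} (r : a' ⟶ a)
    (p : (bijSurj k).obj a ⟶ (bijSurj k).obj b) :
    (surjBij k).ract b r p = (bijSurj k).map r ≫ p :=
  (surjMod_ract_bij k (a := a) (a' := a') (b := b) r p).trans
    (congrArg (fun x => CategoryStruct.comp (obj := Free k FS) (X := (bijSurj k).obj a')
      (Y := (bijSurj k).obj a) (Z := (bijSurj k).obj b) x p) (bijSurj_map r).symm)

theorem surjBij_lact {a b b' : Free k FB} (g : b ⟶ b')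
    (p : (bijSurj k).obj a ⟶ (bijSurj k).obj b) :
    (surjBij k).lact a g p = p ≫ (bijSurj k).map g :=
  congrArg (fun x => CategoryStruct.comp (obj := Free k FS) (X := (bijSurj k).obj a)
      (Y := (bijSurj k).obj b) (Z := (bijSurj k).obj b') p x) (bijSurj_map g).symm

variable (k) in
/-- The tensor product `s ⊗ ρ` in `k FS ⊗_FB k FI^⊥`. -/
def koszulMul {a d e : Free k FB} : ((bijSurj k).obj d ⟶ (bijSurj k).obj e) →ₗ[k]
    ((injDualBase k).obj a ⟶ (injDualBase k).obj d) →ₗ[k]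
      Bimod.TensorX (surjBij k) (injDualBimod k) a e :=
  Bimod.tmul (surjBij k) (injDualBimod k)

theorem koszulMul_balanced {a d d' e : Free k FB} (r : d ⟶ d')
    (s : (bijSurj k).obj d' ⟶ (bijSurj k).obj e)
    (ρ : (injDualBase k).obj a ⟶ (injDualBase k).obj d) :
    koszulMul k ((bijSurj k).map r ≫ s) ρ = koszulMul k s (ρ ≫ (injDualBase k).map r) :=
  (congrArg (fun x => koszulMul k x ρ) (surjBij_ract r s)).symm.trans
    (Bimod.tmul_balanced (surjBij k) (injDualBimod k) r s ρ)

variable (k) in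
/-- The bilinear map `(s, ρ) ↦ s j(ρ)`. -/
def koszulBilin (a d e : Free k FB) : ((bijSurj k).obj d ⟶ (bijSurj k).obj e) →ₗ[k]
    ((injDualBase k).obj a ⟶ (injDualBase k).obj d) →ₗ[k]
      ((grDualBase k).obj ((bijSurj k).obj a) ⟶ (grDualBase k).obj ((bijSurj k).obj e)) :=
  LinearMap.mk₂ k (fun s ρ => dualMap k a d ρ ≫ (grDualBase k).map s)
    (fun s s' ρ => by rw [Functor.map_add, Preadditive.comp_add])
    (fun r s ρ => by rw [Functor.map_smul, Linear.comp_smul])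
    (fun s ρ ρ' => by rw [map_add, Preadditive.add_comp])
    (fun r s ρ => by rw [map_smul, Linear.smul_comp])

theorem koszulBilin_balanced {a d d' e : Free k FB} (r : d ⟶ d')
    (s : (bijSurj k).obj d' ⟶ (bijSurj k).obj e)
    (ρ : (injDualBase k).obj a ⟶ (injDualBase k).obj d) :
    koszulBilin k a d e ((bijSurj k).map r ≫ s) ρ =
      koszulBilin k a d' e s (ρ ≫ (injDualBase k).map r) := by
  change dualMap k a d ρ ≫ (grDualBase k).map ((bijSurj k).map r ≫ s) =
    dualMap k a d' (ρ ≫ (injDualBase k).map r) ≫ (grDualBase k).map s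
  rw [dualMap_comp, dualMap_base, Category.assoc, Functor.map_comp]

variable (k) in
/-- The map `s ⊗ ρ ↦ s j(ρ)`. -/
def koszulMap (a e : Free k FB) : Bimod.TensorX (surjBij k) (injDualBimod k) a e →ₗ[k]
    ((grDualBase k).obj ((bijSurj k).obj a) ⟶ (grDualBase k).obj ((bijSurj k).obj e)) :=
  Bimod.tlift (surjBij k) (injDualBimod k) (fun d => koszulBilin k a d e)
    (fun d _ r s ρ => (congrArg (fun x => koszulBilin k a d e x ρ) (surjBij_ract r s)).trans
      (koszulBilin_balanced (a := a) r s ρ))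

theorem koszulMap_mul {a d e : Free k FB} (s : (bijSurj k).obj d ⟶ (bijSurj k).obj e)
    (ρ : (injDualBase k).obj a ⟶ (injDualBase k).obj d) :
    koszulMap k a e (koszulMul k s ρ) = dualMap k a d ρ ≫ (grDualBase k).map s :=
  Bimod.tlift_tmul (surjBij k) (injDualBimod k) _ _ s ρ

theorem koszul_ext {a e : Free k FB} {P : Type u} [AddCommGroup P] [Module k P]
    {f g : Bimod.TensorX (surjBij k) (injDualBimod k) a e →ₗ[k] P}
    (h : ∀ (d : Free k FB) (s : (bijSurj k).obj d ⟶ (bijSurj k).obj e)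
      (ρ : (injDualBase k).obj a ⟶ (injDualBase k).obj d),
      f (koszulMul k s ρ) = g (koszulMul k s ρ)) : f = g :=
  Bimod.tensor_ext h

attribute [local irreducible] koszulMul koszulMap

variable (k) in
/-- The inverse of `s ⊗ ρ ↦ s j(ρ)`. -/
def koszulInv (a : ℕ) (e : Free k FB) :
    ((grDualBase k).obj (spts k a) ⟶ (grDualBase k).obj ((bijSurj k).obj e)) →ₗ[k]
      Bimod.TensorX (surjBij k) (injDualBimod k) (pts k a) e :=
  ∑ s : Finset (Fin a), (koszulMul k).flip ((injDualBase k).map (bijArr k (splitEquiv s).symm) ≫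
    (injSystem k).iter s.card sᶜ.card) ∘ₗ grCoeff k s ((bijSurj k).obj e)

theorem koszulInv_apply {a : ℕ} {e : Free k FB}
    (z : (grDualBase k).obj (spts k a) ⟶ (grDualBase k).obj ((bijSurj k).obj e)) :
    koszulInv k a e z = ∑ s : Finset (Fin a), koszulMul k (grCoeff k s ((bijSurj k).obj e) z)
      ((injDualBase k).map (bijArr k (splitEquiv s).symm) ≫
        (injSystem k).iter s.card sᶜ.card) := by
  unfold koszulInv
  rw [LinearMap.sum_apply]
  rfl

theorem koszulMap_term {a : ℕ} {e : Free k FB} (s : Finset (Fin a))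
    (t : (bijSurj k).obj (pts k s.card) ⟶ (bijSurj k).obj e) :
    koszulMap k (pts k a) e (koszulMul k t ((injDualBase k).map (bijArr k (splitEquiv s).symm) ≫
        (injSystem k).iter s.card sᶜ.card)) =
      (grDualBase k).map ((bijSurj k).map (bijArr k (splitEquiv s).symm)) ≫
        (grSystem k).iter s.card sᶜ.card ≫ (grDualBase k).map t := by
  refine (koszulMap_mul _ _).trans ?_
  refine (congrArg (· ≫ (grDualBase k).map t) ((dualMap_comp _ _).trans
    (congrArg₂ (· ≫ ·) (dualMap_base _) (dualMap_iter _ _)))).trans ?_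
  exact Category.assoc ..

theorem koszulMap_koszulInv {a : ℕ} {e : Free k FB}
    (z : (grDualBase k).obj (spts k a) ⟶ (grDualBase k).obj ((bijSurj k).obj e)) :
    koszulMap k (pts k a) e (koszulInv k a e z) = z := by
  rw [koszulInv_apply, map_sum]
  exact (Finset.sum_congr rfl fun s _ => koszulMap_term s _).trans (gr_eq_sum z)

/-- The coefficients of `s j(ρ)` are those of `ρ`, which lie in `k FB`, followed by `s`. Balancing
moves them across the tensor sign, where the expansion in `k FI^⊥` restores `ρ`. -/
theorem koszulInv_koszulMap {a : ℕ} {e : Free k FB}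
    (t : Bimod.TensorX (surjBij k) (injDualBimod k) (pts k a) e) :
    koszulInv k a e (koszulMap k (pts k a) e t) = t := by
  refine LinearMap.congr_fun (f := koszulInv k a e ∘ₗ koszulMap k (pts k a) e)
    (g := LinearMap.id) (koszul_ext fun d s ρ => ?_) t
  refine (congrArg (koszulInv k a e) (koszulMap_mul s ρ)).trans ?_
  rw [koszulInv_apply]
  refine Eq.trans ?_ (congrArg (koszulMul k s) (inj_eq_sum ρ))
  rw [map_sum]
  refine Finset.sum_congr rfl fun s' _ => ?_
  refine (congrArg (fun x => koszulMul k x ((injDualBase k).map (bijArr k (splitEquiv s').symm) ≫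
    (injSystem k).iter s'.card s'ᶜ.card)) ((grCoeff_comp_base s' _ s).trans
      (congrArg (· ≫ s) (grCoeff_dualMap s' ρ)))).trans ?_
  exact (koszulMul_balanced _ _ _).trans (congrArg (koszulMul k s) (Category.assoc ..))

theorem koszulMap_bijective (a e : Free k FB) : Function.Bijective (koszulMap k a e) := by
  obtain ⟨n, rfl⟩ := exists_eq_pts a
  exact ⟨Function.LeftInverse.injective koszulInv_koszulMap,
    Function.RightInverse.surjective koszulMap_koszulInv⟩

variable (k) in
/-- The isomorphism `k FS ⊗_FB k FI^⊥ ≅ (gr k FA)^⊥`. -/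
def koszulIso : Bimod.Iso ((surjBij k).tensor (injDualBimod k)) (grDualBimod k) where
  equiv a e := LinearEquiv.ofBijective (koszulMap k a e) (koszulMap_bijective a e)
  map_ract {a a'} e f t := by
    refine LinearMap.congr_fun
      (f := koszulMap k a' e ∘ₗ Bimod.tensorRact (surjBij k) (injDualBimod k) e f)
      (g := (grDualBimod k).ract e f ∘ₗ koszulMap k a e) (koszul_ext fun d s ρ => ?_) t
    have h1 : Bimod.tensorRact (surjBij k) (injDualBimod k) e f (koszulMul k s ρ) =
        koszulMul k s ((injDualBase k).map f ≫ ρ) := by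
      unfold koszulMul
      exact Bimod.tensorRact_tmul (surjBij k) (injDualBimod k) f s ρ
    refine (congrArg (koszulMap k a' e) h1).trans ((koszulMap_mul _ _).trans ?_)
    refine (congrArg (· ≫ (grDualBase k).map s) ((dualMap_comp _ _).trans
      (congrArg (· ≫ dualMap k a d ρ) (dualMap_base f)))).trans ?_
    refine (Category.assoc ..).trans ?_
    exact congrArg ((grDualBase k).map ((bijSurj k).map f) ≫ ·) (koszulMap_mul s ρ).symm
  map_lact a {e e'} g t := by
    refine LinearMap.congr_fun
      (f := koszulMap k a e' ∘ₗ Bimod.tensorLact (surjBij k) (injDualBimod k) a g)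
      (g := (grDualBimod k).lact a g ∘ₗ koszulMap k a e) (koszul_ext fun d s ρ => ?_) t
    have h1 : Bimod.tensorLact (surjBij k) (injDualBimod k) a g (koszulMul k s ρ) =
        koszulMul k (s ≫ (bijSurj k).map g) ρ := by
      refine Eq.trans ?_ (congrArg (fun x => koszulMul k x ρ) (surjBij_lact g s))
      unfold koszulMul
      exact Bimod.tensorLact_tmul (surjBij k) (injDualBimod k) g s ρ
    refine (congrArg (koszulMap k a e') h1).trans ((koszulMap_mul _ _).trans ?_)
    refine (congrArg (dualMap k a d ρ ≫ ·) ((grDualBase k).map_comp s _)).trans ?_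
    refine (Category.assoc ..).symm.trans ?_
    exact congrArg (· ≫ (grDualBase k).map ((bijSurj k).map g)) (koszulMap_mul s ρ).symm

/-! ### Compatibility of the isomorphism with the gradings -/

variable (k) in
/-- The grading of `k FS ⊗_FB k FI^⊥` induced by that of `k FI^⊥`. -/
def koszulDegree (n : ℕ) (a e : Free k FB) :
    Submodule k (Bimod.TensorX (surjBij k) (injDualBimod k) a e) :=
  Submodule.span k {t | ∃ (b : Free k FB) (s : (bijSurj k).obj b ⟶ (bijSurj k).obj e)
    (ρ : (injDualBase k).obj a ⟶ (injDualBase k).obj b),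
    ρ ∈ injDualDegree k n _ _ ∧ t = koszulMul k s ρ}

theorem koszulInv_mem_degree {n m : ℕ} {e : Free k FB}
    {z : (grDualBase k).obj (spts k m) ⟶ (grDualBase k).obj ((bijSurj k).obj e)}
    (hz : z ∈ grDualDegree k n _ _) : koszulInv k m e z ∈ koszulDegree k n (pts k m) e := by
  rw [koszulInv_apply]
  refine sum_mem fun s _ => ?_
  by_cases hs : sᶜ.card = n
  · subst hs
    refine Submodule.subset_span ⟨pts k s.card, grCoeff k s ((bijSurj k).obj e) z,
      (injDualBase k).map (bijArr k (splitEquiv s).symm) ≫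
        (injSystem k).iter s.card sᶜ.card, ?_, rfl⟩
    have h := QuadCat.comp_mem_degree (QuadCat.base_mem_degree (bijArr k (splitEquiv s).symm))
      (iter_mem_degree (k := k) s.card sᶜ.card)
    rwa [zero_add] at h
  · rw [grCoeff_eq_zero hs hz, map_zero, LinearMap.zero_apply]
    exact zero_mem _

/-- The grading of `k FS ⊗_FB k FI^⊥` corresponds to the cohomological grading. -/
theorem map_koszulDegree (n : ℕ) (a e : Free k FB) :
    Submodule.map (koszulMap k a e) (koszulDegree k n a e) = grDualDegree k n _ _ := by
  refine le_antisymm ?_ fun z hz => ?_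
  · unfold koszulDegree
    rw [Submodule.map_span, Submodule.span_le]
    rintro _ ⟨_, ⟨b, s, ρ, hρ, rfl⟩, rfl⟩
    have h := QuadCat.comp_mem_degree (dualMap_mem_degree hρ) (QuadCat.base_mem_degree s)
    rw [← koszulMap_mul, add_zero] at h
    exact h
  -- For `z` of degree `n` only subsets with complement of size `n` occur in the inverse, so the
  -- preimage has degree `n`.
  · obtain ⟨m, rfl⟩ := exists_eq_pts a
    exact ⟨koszulInv k m e z, koszulInv_mem_degree hz, koszulMap_koszulInv z⟩

end FinKoszul

end

noncomputable section

namespace FinKoszul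

universe u w

variable {k : Type u} [CommRing k]

/-! ## The defect of the augmentation -/

variable (k) in
/-- The objects of `k FS` as objects of `k FA`. -/
abbrev allObj (a : Free k FS) : Free k FA := Free.of k (WideSubcategory.obj a)

variable (k) in
/-- The right augmentation, between objects of `k FS`. -/
def augS (x a : Free k FS) : (allObj k x ⟶ allObj k a) →ₗ[k] (x ⟶ a) := rightAug k x a

variable (k) in
/-- The inclusion of `k FS` into `k FA`, between objects of `k FS`. -/
def inclFS (x a : Free k FS) : (x ⟶ a) →ₗ[k] (allObj k x ⟶ allObj k a) := inclS k x a

theorem augS_incl {x a : Free k FS} (s : x ⟶ a) : augS k x a (inclFS k x a s) = s :=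
  rightAug_incl k (a := x) (b := a) s

theorem augS_incl_comp {x y a : Free k FS} (s : x ⟶ y) (v : allObj k y ⟶ allObj k a) :
    augS k x a (inclFS k x y s ≫ v) = s ≫ augS k y a v :=
  rightAug_incl_comp k (a := x) (b := y) (c := a) s v

theorem augS_comp {x y a : Free k FS} (v : allObj k x ⟶ allObj k y)
    (w : allObj k y ⟶ allObj k a) :
    augS k x a (v ≫ inclFS k y a (augS k y a w)) = augS k x a (v ≫ w) :=
  rightAug_comp k (a := x) (b := y) (c := a) v w

theorem augS_comp_bij {x : Free k FS} {a b : Free k FB}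
    (v : allObj k x ⟶ allObj k ((bijSurj k).obj a)) (r : a ⟶ b) :
    augS k x ((bijSurj k).obj b) (v ≫ inclFS k _ _ ((bijSurj k).map r)) =
      augS k x ((bijSurj k).obj a) v ≫ (bijSurj k).map r := by
  refine Eq.trans ?_ (rightAug_comp_bij k (a := ⟨WideSubcategory.obj x⟩) (b := a) (c := b) v r)
  exact congrArg (rightAug k x ⟨WideSubcategory.obj b⟩) (congrArg (v ≫ ·) (inclS_inclBS k r))

theorem inclFS_comp {x y a : Free k FS} (s : x ⟶ y) (t : y ⟶ a) :
    inclFS k x a (s ≫ t) = inclFS k x y s ≫ inclFS k y a t :=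
  inclS_comp k (a := x) (b := y) (c := a) s t

theorem inclFS_augS_of_mem {x a : Free k FS} {v : allObj k x ⟶ allObj k a}
    (hv : v ∈ filt k 0 (WideSubcategory.obj x) (WideSubcategory.obj a)) :
    inclFS k x a (augS k x a v) = v :=
  filt_zero_eq (x := x) (a := a) hv

theorem inclFS_mem_filt {x a : Free k FS} (s : x ⟶ a) :
    inclFS k x a s ∈ filt k 0 (WideSubcategory.obj x) (WideSubcategory.obj a) :=
  incl_mem_filt k (a := x) (b := a) s

variable (k) in
/-- The element of `G_n k FA` between objects of `k FS`. -/
def filtAll (n : ℤ) (x a : Free k FS) : (filtBimod k n).X x a →ₗ[k] (allObj k x ⟶ allObj k a) :=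
  filtIncl k n x a

theorem filtAll_mem {n : ℤ} {x a : Free k FS} (v : (filtBimod k n).X x a) :
    filtAll k n x a v ∈ filt k n (WideSubcategory.obj x) (WideSubcategory.obj a) := v.2

theorem filtAll_ract {n : ℤ} {x x' a : Free k FS} (f : x' ⟶ x) (v : (filtBimod k n).X x a) :
    filtAll k n x' a ((filtBimod k n).ract a f v) = inclFS k x' x f ≫ filtAll k n x a v := rfl

theorem filtAll_lact {n : ℤ} {x a a' : Free k FS} (g : a ⟶ a') (v : (filtBimod k n).X x a) :
    filtAll k n x a' ((filtBimod k n).lact x g v) = filtAll k n x a v ≫ inclFS k a a' g := rfl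

variable (k) in
/-- The map `v ↦ ε(v r) - ε(v) r`. -/
def augDefectVal {a b : Free k FS} (r : a ⟶ b) (x : Free k FS) :
    (allObj k x ⟶ allObj k a) →ₗ[k] (x ⟶ b) :=
  augS k x b ∘ₗ Linear.rightComp k _ (inclFS k a b r) - Linear.rightComp k x r ∘ₗ augS k x a

theorem augDefectVal_apply {a b : Free k FS} (r : a ⟶ b) (x : Free k FS)
    (v : allObj k x ⟶ allObj k a) :
    augDefectVal k r x v = augS k x b (v ≫ inclFS k a b r) - augS k x a v ≫ r := rfl

variable (k) in
/-- The map `v ↦ ε(v r) - ε(v) r` on `gr_1 k FA`. -/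
def augDefectGr {a b : Free k FS} (r : a ⟶ b) (x : Free k FS) :
    (grBimod k 1).X x a →ₗ[k] (x ⟶ b) :=
  (filtPred k 1 x a).liftQ (augDefectVal k r x ∘ₗ filtAll k 1 x a) (fun v hv => by
    -- On `G_0`, the image of `k FS`, the composite with `r` is again in `k FS`. So the correction
    -- `ε(v) r` cancels `ε(v r)` and the defect descends to `gr_1`.
    have h := inclFS_augS_of_mem (x := x) (a := a) (v := filtAll k 1 x a v) hv
    change augDefectVal k r x (filtAll k 1 x a v) = 0
    rw [augDefectVal_apply, ← h, ← inclFS_comp, augS_incl, augS_incl, sub_self])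

theorem augDefectGr_grClass {a b : Free k FS} (r : a ⟶ b) (x : Free k FS)
    (v : (filtBimod k 1).X x a) :
    augDefectGr k r x (grClass k 1 x a v) = augS k x b (filtAll k 1 x a v ≫ inclFS k a b r) -
      augS k x a (filtAll k 1 x a v) ≫ r := rfl

attribute [local irreducible] grClass augDefectGr augS inclFS filtAll

theorem augDefectGr_ract {a b : Free k FS} (r : a ⟶ b) {x x' : Free k FS} (f : x' ⟶ x)
    (v : (grBimod k 1).X x a) :
    augDefectGr k r x' ((grBimod k 1).ract a f v) = f ≫ augDefectGr k r x v := by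
  obtain ⟨v, -, rfl⟩ := exists_grClass_eq v
  rw [ract_grClass, augDefectGr_grClass, augDefectGr_grClass, Preadditive.comp_sub, filtAll_ract,
    Category.assoc, augS_incl_comp, augS_incl_comp, Category.assoc]

variable (k) in
/-- The functional `[v] ↦ ε(v r) - ε(v) r`, linear in `r`. -/
def augDefect (a b : Free k FS) : (a ⟶ b) →ₗ[k] (grBimod k 1).rightDual.X a b where
  toFun r := ⟨augDefectGr k r, augDefectGr_ract r⟩
  map_add' r s := Bimod.rightDual_ext fun x v => by
    obtain ⟨v, -, rfl⟩ := exists_grClass_eq v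
    change augDefectGr k (r + s) x _ = augDefectGr k r x _ + augDefectGr k s x _
    rw [augDefectGr_grClass, augDefectGr_grClass, augDefectGr_grClass, map_add,
      Preadditive.comp_add, Preadditive.comp_add, map_add, add_sub_add_comm]
  map_smul' c r := Bimod.rightDual_ext fun x v => by
    obtain ⟨v, -, rfl⟩ := exists_grClass_eq v
    change augDefectGr k (c • r) x _ = c • augDefectGr k r x _
    rw [augDefectGr_grClass, augDefectGr_grClass, map_smul, Linear.comp_smul, Linear.comp_smul,
      map_smul, smul_sub]

theorem ev_augDefect {a b : Free k FS} (r : a ⟶ b) {x : Free k FS}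
    (v : (filtBimod k 1).X x a) :
    Bimod.ev (augDefect k a b r) (grClass k 1 x a v) =
      augS k x b (filtAll k 1 x a v ≫ inclFS k a b r) - augS k x a (filtAll k 1 x a v) ≫ r :=
  augDefectGr_grClass r x v

/-- On `ker ε` the correcting term disappears, which leaves the value that condition (i) prescribes
for `dr`. -/
theorem ev_augDefect_of_aug_eq_zero {a b : Free k FS} (r : a ⟶ b) {x : Free k FS}
    (v : (filtBimod k 1).X x a) (hv : augS k x a (filtAll k 1 x a v) = 0) :
    Bimod.ev (augDefect k a b r) (grClass k 1 x a v) =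
      augS k x b (filtAll k 1 x a v ≫ inclFS k a b r) := by
  rw [ev_augDefect, hv, Limits.zero_comp, sub_zero]

/-- The functional attached to `r` is characterized by its values on the kernel of the
augmentation. -/
theorem eq_augDefect {a b : Free k FS} (r : a ⟶ b) {χ : (grBimod k 1).rightDual.X a b}
    (h : ∀ (x : Free k FS) (v : (filtBimod k 1).X x a), augS k x a (filtAll k 1 x a v) = 0 →
      Bimod.ev χ (grClass k 1 x a v) = augS k x b (filtAll k 1 x a v ≫ inclFS k a b r)) :
    χ = augDefect k a b r := by
  refine Bimod.rightDual_ext fun x v => ?_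
  obtain ⟨v, hv, rfl⟩ := exists_grClass_eq v
  have hv' : augS k x a (filtAll k 1 x a v) = 0 := by
    unfold augS filtAll
    exact hv
  rw [h x v hv', ev_augDefect_of_aug_eq_zero r v hv']

/-- `ε` commutes with postcomposition by bijections; hence the differential will vanish on `k FB`.
-/
theorem augDefect_bijSurj {a b : Free k FB} (r : a ⟶ b) :
    augDefect k _ _ ((bijSurj k).map r) = 0 := by
  refine Bimod.rightDual_ext fun x v => ?_
  obtain ⟨v, -, rfl⟩ := exists_grClass_eq v
  rw [ev_augDefect, augS_comp_bij, sub_self]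
  rfl

/-! ## The boundary of families -/

variable (k) in
/-- The alternating sum of the chain in `k FA`. -/
def altMap (x m : ℕ) : allObj k (spts k (x + m)) ⟶ allObj k (spts k (x + (m + 1))) :=
  injIncl k 1 (pts k (x + m)) (pts k (x + m + 1)) ((injChain k x).D m)

theorem altMap_comp (x m : ℕ) : altMap k x m ≫ altMap k x (m + 1) = 0 := injIncl_D_comp_D x m

variable (k) in
/-- Families on the chain in `gr k FA`. -/
abbrev GrFam (x : ℕ) (a : Free k FS) : Type u :=
  RightQuadDual.Fam (fun m => spts k (x + m)) a

variable (k) in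
/-- The map `u ↦ (ε(D_m u_{m+1}))_m` on families. -/
def boundary (x : ℕ) (a : Free k FS) : GrFam k x a →ₗ[k] GrFam k x a :=
  LinearMap.pi fun m => (augS k (spts k (x + m)) a ∘ₗ
    Linear.leftComp k (allObj k a) (altMap k x m) ∘ₗ
      inclFS k (spts k (x + (m + 1))) a) ∘ₗ LinearMap.proj (m + 1)

theorem boundary_apply {x : ℕ} {a : Free k FS} (u : GrFam k x a) (m : ℕ) :
    boundary k x a u m =
      augS k (spts k (x + m)) a (altMap k x m ≫ inclFS k (spts k (x + (m + 1))) a (u (m + 1))) :=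
  rfl

variable (k) in
/-- The element `D_m u` of `G_1 k FA`. -/
def altFilt (x m : ℕ) {a : Free k FS} (u : spts k (x + (m + 1)) ⟶ a) :
    (filtBimod k 1).X (spts k (x + m)) a :=
  (filtBimod k 1).lact (spts k (x + m)) (b := spts k (x + (m + 1))) u
    (injToFilt k (pts k (x + m)) (pts k (x + m + 1)) ((injChain k x).D m))

theorem altFilt_smul {x m : ℕ} {a : Free k FS} (r : k) (u : spts k (x + (m + 1)) ⟶ a) :
    altFilt k x m (r • u) = r • altFilt k x m u :=
  LinearMap.map_smul₂ ((filtBimod k 1).lact (spts k (x + m)) (b := spts k (x + (m + 1)))) r u _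

theorem filtAll_altFilt {x m : ℕ} {a : Free k FS} (u : spts k (x + (m + 1)) ⟶ a) :
    filtAll k 1 (spts k (x + m)) a (altFilt k x m u) =
      altMap k x m ≫ inclFS k (spts k (x + (m + 1))) a u := by
  unfold filtAll inclFS
  rfl

theorem grClass_altFilt {x m : ℕ} {a : Free k FS} (u : spts k (x + (m + 1)) ⟶ a) :
    grClass k 1 (spts k (x + m)) a (altFilt k x m u) =
      (grBimod k 1).lact (spts k (x + m)) (b := spts k (x + (m + 1))) u ((grChain k x).D m) :=
  (lact_grClass (a := spts k (x + m)) (b := spts k (x + (m + 1))) u _).symm.trans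
    (congrArg ((grBimod k 1).lact (spts k (x + m)) (b := spts k (x + (m + 1))) u)
      (injToGr_eq _).symm)

theorem rep_grGen {x : ℕ} {a b : Free k FS} (φ : (grBimod k 1).rightDual.X a b) (u : GrFam k x a)
    (m : ℕ) : RightQuadDual.rep (grChain k x) (grDualGen k φ) u m =
      Bimod.ev φ (grClass k 1 (spts k (x + m)) a (altFilt k x m (u (m + 1)))) :=
  (RightQuadDual.rep_gen (grChain k x) φ u m).trans
    (congrArg (Bimod.ev φ) (grClass_altFilt (u (m + 1))).symm)

end FinKoszul

end

noncomputable section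

namespace FinKoszul

universe u w

variable {k : Type u} [CommRing k]

/-! ## Coefficients of products -/

theorem augS_altMap (x m : ℕ) : augS k (spts k (x + m)) (spts k (x + (m + 1))) (altMap k x m) = 0 :=
  rightAug_injIncl _

variable (k) in
/-- The coefficient of the injection that misses the point `y`. -/
def chopAt {m : ℕ} (y : Fin (m + 1)) (a : Free k FS) :
    (allObj k a ⟶ allObj k (spts k (m + 1))) →ₗ[k] (a ⟶ spts k m) :=
  chop k m a ∘ₗ Linear.rightComp k _ (arr k (toLast y).hom)

theorem ev_grDeltaAt {m : ℕ} (y : Fin (m + 1)) {a : Free k FS}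
    (v : (filtBimod k 1).X a (spts k (m + 1))) :
    Bimod.ev (grDeltaAt k y) (grClass k 1 a (spts k (m + 1)) v) =
      chopAt k y a (filtAll k 1 a (spts k (m + 1)) v) :=
  ev_grDeltaAt_grClass y v

/-- This is `chop_comp` without its second term: a transposition keeps `v` in `ker ε`, where that
term vanishes. -/
theorem chopAt_comp {m : ℕ} (y : Fin (m + 1)) {x a : Free k FS} (w : allObj k x ⟶ allObj k a)
    (v : (filtBimod k 1).X a (spts k (m + 1)))
    (hv : augS k a (spts k (m + 1)) (filtAll k 1 a (spts k (m + 1)) v) = 0) :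
    chopAt k y x (w ≫ filtAll k 1 a (spts k (m + 1)) v) =
      augS k x (spts k m) (w ≫ inclFS k a (spts k m)
        (chopAt k y a (filtAll k 1 a (spts k (m + 1)) v))) := by
  have hmem := filtAll_mem ((filtBimod k 1).lact a (b := spts k (m + 1)) (b' := spts k (m + 1))
    ((bijSurj k).map (arr k (toLast y))) v)
  have hval : filtAll k 1 a (spts k (m + 1)) ((filtBimod k 1).lact a (b := spts k (m + 1))
      (b' := spts k (m + 1)) ((bijSurj k).map (arr k (toLast y))) v) =
      filtAll k 1 a (spts k (m + 1)) v ≫ arr k (toLast y).hom :=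
    (filt_lact_val _ v).trans (congrArg (filtAll k 1 a (spts k (m + 1)) v ≫ ·)
      (inclS_bijSurj_map_arr (toLast y)))
  have hzero : augS k a (spts k (m + 1)) (filtAll k 1 a (spts k (m + 1)) v ≫
      arr k (toLast y).hom) = 0 := by
    refine (congrArg (augS k a (spts k (m + 1))) (congrArg (filtAll k 1 a (spts k (m + 1)) v ≫ ·)
      (inclS_bijSurj_map_arr (toLast y)).symm)).trans ?_
    refine (augS_comp_bij (a := pts k (m + 1)) (b := pts k (m + 1)) _ (arr k (toLast y))).trans ?_
    exact (congrArg (· ≫ (bijSurj k).map (arr k (toLast y))) hv).trans Limits.zero_comp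
  rw [hval] at hmem
  have h := chop_comp (m := m) (x := a) (x' := x) w hmem
  refine Eq.trans (congrArg (chop k m x) (Category.assoc w
    (filtAll k 1 a (spts k (m + 1)) v) (arr k (toLast y).hom))) (h.trans ?_)
  refine Eq.trans (congrArg (rightAug k x ⟨⟨m⟩⟩ (w ≫ inclS k a ⟨⟨m⟩⟩ (chop k m a
    (filtAll k 1 a (spts k (m + 1)) v ≫ arr k (toLast y).hom))) + ·) ?_) (add_zero _)
  refine (congrArg (fun r => chop k m x (w ≫ inclS k a ⟨⟨m + 1⟩⟩ r)) hzero).trans ?_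
  refine (congrArg (fun r => chop k m x (w ≫ r)) (map_zero (inclS k a ⟨⟨m + 1⟩⟩))).trans ?_
  exact (congrArg (chop k m x) Limits.comp_zero).trans (map_zero _)

attribute [local irreducible] grClass augS inclFS filtAll augDefect chopAt altFilt grDeltaAt injToGr
  altMap

theorem ev_eq_sum {m : ℕ} {a c : Free k FS} (φ : (grBimod k 1).rightDual.X (spts k (m + 1)) c)
    (w : (grBimod k 1).X a (spts k (m + 1))) :
    Bimod.ev φ w = ∑ y, Bimod.ev (grDeltaAt k y) w ≫
      Bimod.ev φ (injToGr k (pts k m) (pts k (m + 1)) (cofaceAt k y)) := by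
  conv_lhs => rw [← gr_dualBasis a w]
  rw [map_sum]
  exact Finset.sum_congr rfl fun y _ => φ.2 _ _

/-- The formula for the differential of a generator, as a condition on the functionals `f`, `g`. -/
def IsGenDefect {a c : Free k FS} (φ : (grBimod k 1).rightDual.X a c) {n : ℕ}
    {e : Fin n → Free k FS} (f : ∀ j, (grBimod k 1).rightDual.X (e j) c)
    (g : ∀ j, (grBimod k 1).rightDual.X a (e j)) : Prop :=
  ∀ (x : Free k FS) (m : ℕ) (y : Fin m → Free k FS) (v : ∀ i, (filtBimod k 1).X (y i) a)
    (w : ∀ i, (filtBimod k 1).X x (y i)) (s : (filtBimod k 1).X x a),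
    (∀ i, augS k (y i) a (filtAll k 1 (y i) a (v i)) = 0) →
    (∀ i, augS k x (y i) (filtAll k 1 x (y i) (w i)) = 0) →
    filtAll k 1 x a s = ∑ i, filtAll k 1 x (y i) (w i) ≫ filtAll k 1 (y i) a (v i) →
    ∑ i, ∑ j, Bimod.ev (f j) ((grBimod k 1).lact x (Bimod.ev (g j) (grClass k 1 (y i) a (v i)))
        (grClass k 1 x (y i) (w i))) =
      ∑ i, augS k x c (filtAll k 1 x (y i) (w i) ≫
        inclFS k (y i) c (Bimod.ev φ (grClass k 1 (y i) a (v i)))) -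
        Bimod.ev φ (grClass k 1 x a s)

/-- Let `ι_y` and `δ_y` be the dual bases. Then `g_y = δ_y` and `f_y` is the defect of `φ(ι_y)`. The
leading terms `ε(φ(ι_y) δ_y(v) w)` add up to `ε(φ(v) w)`, because `φ = ∑ φ(ι_y) δ_y`. The correcting
terms contain `ε(δ_y(v) w) = δ_y(v w)`, valid for `v` in `ker ε`, and add up to `φ` of the class of
`∑ v w`. -/
theorem isGenDefect_succ {m : ℕ} {c : Free k FS}
    (φ : (grBimod k 1).rightDual.X (spts k (m + 1)) c) :
    IsGenDefect φ (fun y : Fin (m + 1) => augDefect k (spts k m) c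
      (Bimod.ev φ (injToGr k (pts k m) (pts k (m + 1)) (cofaceAt k y))))
      (fun y => grDeltaAt k y) := by
  intro x n z v w s hv _ hs
  have h1 : ∀ (i : Fin n) (y : Fin (m + 1)), Bimod.ev (augDefect k (spts k m) c
      (Bimod.ev φ (injToGr k (pts k m) (pts k (m + 1)) (cofaceAt k y))))
      ((grBimod k 1).lact x (Bimod.ev (grDeltaAt k y) (grClass k 1 (z i) (spts k (m + 1)) (v i)))
        (grClass k 1 x (z i) (w i))) =
      augS k x c (filtAll k 1 x (z i) (w i) ≫ inclFS k (z i) c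
        (Bimod.ev (grDeltaAt k y) (grClass k 1 (z i) (spts k (m + 1)) (v i)) ≫
          Bimod.ev φ (injToGr k (pts k m) (pts k (m + 1)) (cofaceAt k y)))) -
      chopAt k y x (filtAll k 1 x (z i) (w i) ≫ filtAll k 1 (z i) (spts k (m + 1)) (v i)) ≫
        Bimod.ev φ (injToGr k (pts k m) (pts k (m + 1)) (cofaceAt k y)) := fun i y => by
    refine (congrArg (Bimod.ev (augDefect k (spts k m) c _)) (lact_grClass _ (w i))).trans ?_
    refine (ev_augDefect _ _).trans ?_
    rw [filtAll_lact, Category.assoc, ← inclFS_comp, chopAt_comp y _ (v i) (hv i), ev_grDeltaAt]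
  refine (Finset.sum_congr rfl fun i _ => Finset.sum_congr rfl fun y _ => h1 i y).trans ?_
  simp only [Finset.sum_sub_distrib]
  refine congrArg₂ (· - ·) ?_ ?_
  · refine Finset.sum_congr rfl fun i _ => ?_
    rw [← map_sum, ← Preadditive.comp_sum, ← map_sum, ← ev_eq_sum]
  · rw [Finset.sum_comm, ev_eq_sum φ]
    refine Finset.sum_congr rfl fun y _ => ?_
    rw [← Preadditive.sum_comp, ← map_sum, ← hs, ev_grDeltaAt]

/-- At the empty set `gr_1` is zero, so both sides vanish with an empty family of functionals. -/
theorem isGenDefect_zero {c : Free k FS} (φ : (grBimod k 1).rightDual.X (spts k 0) c)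
    {e : Fin 0 → Free k FS} (f : ∀ j, (grBimod k 1).rightDual.X (e j) c)
    (g : ∀ j, (grBimod k 1).rightDual.X (spts k 0) (e j)) : IsGenDefect φ f g := by
  intro x n z v w s _ _ _
  have h0 : ∀ (x : Free k FS) (v : (grBimod k 1).X x (spts k 0)), Bimod.ev φ v = 0 :=
    fun x v => (congrArg (Bimod.ev φ) (gr_spts_zero v)).trans (map_zero _)
  simp [h0]

/-- The functionals in the formula for the differential of a generator exist. -/
theorem exists_isGenDefect {b : Free k FB} {c : Free k FS}
    (φ : (grBimod k 1).rightDual.X ((bijSurj k).obj b) c) :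
    ∃ (n : ℕ) (e : Fin n → Free k FB) (i : ∀ j, (injPart k 1).X (e j) b)
      (g : ∀ j, (grBimod k 1).rightDual.X ((bijSurj k).obj b) ((bijSurj k).obj (e j))),
      IsGenDefect φ (fun j => augDefect k ((bijSurj k).obj (e j)) c
        (Bimod.ev φ (injToGr k (e j) b (i j)))) g := by
  obtain ⟨n, rfl⟩ := exists_eq_pts b
  cases n with
  | zero => exact ⟨0, Fin.elim0, fun j => j.elim0, fun j => j.elim0, isGenDefect_zero φ _ _⟩
  | succ m => exact ⟨m + 1, fun _ => pts k m, cofaceAt k, grDeltaAt k, isGenDefect_succ φ⟩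

end FinKoszul

end

noncomputable section

namespace FinKoszul

universe u w

variable {k : Type u} [CommRing k]

/-! ## The commutator with the boundary -/

variable (k) in
/-- The signs `(-1)^m` on families. -/
def twist (x : ℕ) (a : Free k FS) : GrFam k x a →ₗ[k] GrFam k x a :=
  LinearMap.pi fun m => (-1 : k) ^ m • LinearMap.proj m

theorem twist_apply {x : ℕ} {a : Free k FS} (u : GrFam k x a) (m : ℕ) :
    twist k x a u m = (-1 : k) ^ m • u m := rfl

variable (k) in
/-- The action of a morphism of `(gr k FA)^⊥` on families. -/
def grRep (x : ℕ) {a b : Free k FS} : ((grDualBase k).obj a ⟶ (grDualBase k).obj b) →ₗ[k]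
    GrFam k x a →ₗ[k] GrFam k x b := RightQuadDual.rep (grChain k x)

theorem grRep_comp {x : ℕ} {a b c : Free k FS} (y : (grDualBase k).obj a ⟶ (grDualBase k).obj b)
    (z : (grDualBase k).obj b ⟶ (grDualBase k).obj c) (u : GrFam k x a) :
    grRep k x (y ≫ z) u = grRep k x z (grRep k x y u) :=
  RightQuadDual.rep_comp (grChain k x) y z u

theorem grRep_base {x : ℕ} {a b : Free k FS} (r : a ⟶ b) (u : GrFam k x a) (m : ℕ) :
    grRep k x ((grDualBase k).map r) u m = u m ≫ r := rfl

theorem grRep_gen {x : ℕ} {a b : Free k FS} (φ : (grBimod k 1).rightDual.X a b) (u : GrFam k x a)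
    (m : ℕ) : grRep k x (grDualGen k φ) u m =
      Bimod.ev φ (grClass k 1 (spts k (x + m)) a (altFilt k x m (u (m + 1)))) :=
  rep_grGen φ u m

theorem grRep_gen_comp_gen {x : ℕ} {a b c : Free k FS} (φ : (grBimod k 1).rightDual.X a b)
    (χ : (grBimod k 1).rightDual.X b c) (u : GrFam k x a) (m : ℕ) :
    grRep k x (grDualGen k φ ≫ grDualGen k χ) u m =
      Bimod.ev χ ((grBimod k 1).lact (spts k (x + m)) (b := spts k (x + (m + 1)))
        (Bimod.ev φ (grClass k 1 (spts k (x + (m + 1))) a (altFilt k x (m + 1) (u (m + 2)))))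
        (injToGr k (pts k (x + m)) (pts k (x + m + 1)) ((injChain k x).D m))) := by
  rw [grRep_comp]
  refine (RightQuadDual.rep_gen (grChain k x) χ _ m).trans ?_
  exact congrArg (fun r => Bimod.ev χ ((grBimod k 1).lact (spts k (x + m))
    (b := spts k (x + (m + 1))) r (injToGr k (pts k (x + m)) (pts k (x + m + 1)) ((injChain k x).D m)))) (grRep_gen φ u (m + 1))

/-- Morphisms of `(gr k FA)^⊥` are determined by their action on families. -/
theorem eq_of_grRep {a b : Free k FS} {z z' : (grDualBase k).obj a ⟶ (grDualBase k).obj b}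
    (h : ∀ (x : ℕ) (u : GrFam k x a), grRep k x z u = grRep k x z' u) : z = z' := by
  obtain ⟨n, rfl⟩ := exists_eq_spts a
  rw [← sub_eq_zero]
  refine eq_zero_of_grCoeff fun s => ?_
  rw [map_sub, sub_eq_zero]
  -- A coefficient is level `0` of the action on a family concentrated in one level.
  exact congrFun (h s.card _) 0

attribute [local irreducible] grClass augS inclFS filtAll augDefect altFilt injToGr altMap grRep

/-- Degree `n` lowers the level by `n`, and the twist is a sign depending on the level. -/
theorem grRep_twist {x n : ℕ} {a b : Free k FS}
    {z : (grDualBase k).obj a ⟶ (grDualBase k).obj b} (hz : z ∈ grDualDegree k n _ _)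
    (u : GrFam k x a) :
    grRep k x z (twist k x a u) = (-1 : k) ^ n • twist k x b (grRep k x z u) := by
  refine QuadCat.mem_degree_induction (P := fun {a b} n z => ∀ u : GrFam k x a,
    grRep k x z (twist k x a u) = (-1 : k) ^ n • twist k x b (grRep k x z u)) (fun f u => ?_)
    (fun φ u => ?_) (fun {a b n} u => ?_)
    (fun y z hy hz u => ?_) (fun r y hy u => ?_) (fun {_ _ _ m n} y z hy hz u => ?_) hz u
  · funext m
    rw [pow_zero, one_smul, grRep_base, twist_apply, twist_apply, Linear.smul_comp, grRep_base]
  · funext m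
    rw [Pi.smul_apply, twist_apply, grRep_gen, grRep_gen, twist_apply, smul_smul, ← pow_add,
      add_comm 1 m]
    rw [altFilt_smul, map_smul, map_smul]
  · rw [map_zero, LinearMap.zero_apply, LinearMap.zero_apply, map_zero, smul_zero]
  · rw [map_add, LinearMap.add_apply, LinearMap.add_apply, map_add, smul_add, hy, hz]
  · rw [map_smul, LinearMap.smul_apply, LinearMap.smul_apply, map_smul, hy, smul_comm]
  · rw [grRep_comp, hy, map_smul, hz, grRep_comp, smul_smul, pow_add]

theorem neg_one_pow_smul_smul {M : Type w} [AddCommGroup M] [Module k M] (n : ℕ) (v : M) :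
    (-1 : k) ^ n • (-1 : k) ^ n • v = v := by
  rw [smul_smul, ← pow_add, ← two_mul, pow_mul, neg_one_sq, one_pow, one_smul]

theorem twist_twist {x : ℕ} {a : Free k FS} (u : GrFam k x a) :
    twist k x a (twist k x a u) = u := by
  funext m
  rw [twist_apply, twist_apply, neg_one_pow_smul_smul]

theorem twist_grRep_twist {x n : ℕ} {a b : Free k FS}
    {z : (grDualBase k).obj a ⟶ (grDualBase k).obj b} (hz : z ∈ grDualDegree k n _ _)
    (u : GrFam k x a) :
    twist k x b (grRep k x z (twist k x a u)) = (-1 : k) ^ n • grRep k x z u := by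
  rw [grRep_twist hz, map_smul, twist_twist]

/-- The boundary lowers the level by one, hence it anticommutes with the twist. -/
theorem boundary_twist {x : ℕ} {a : Free k FS} (u : GrFam k x a) :
    boundary k x a (twist k x a u) = -twist k x a (boundary k x a u) := by
  funext m
  rw [Pi.neg_apply, twist_apply, boundary_apply, boundary_apply, twist_apply, map_smul,
    Linear.comp_smul, map_smul, pow_succ, mul_neg_one, neg_smul]

/-- As `ker ε` is a right ideal, the inner `ε` can be dropped; the two consecutive steps of the
chain then compose to zero in `k FA`. -/
theorem boundary_boundary {x : ℕ} {a : Free k FS} (u : GrFam k x a) :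
    boundary k x a (boundary k x a u) = 0 := by
  funext m
  rw [boundary_apply, boundary_apply, augS_comp]
  refine (congrArg (augS k (spts k (x + m)) a) (Category.assoc ..).symm).trans ?_
  refine (congrArg (augS k (spts k (x + m)) a) (congrArg (· ≫ inclFS k (spts k (x + (m + 2))) a
    (u (m + 2))) (altMap_comp x m))).trans ?_
  rw [Limits.zero_comp, map_zero]
  rfl

/-- The action of `w` on families is the graded commutator of that of `z` with the boundary. -/
def IsBoundary {a b : Free k FS} (z w : (grDualBase k).obj a ⟶ (grDualBase k).obj b) : Prop :=
  ∀ (x : ℕ) (u : GrFam k x a), grRep k x w u = boundary k x b (grRep k x z u) -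
    twist k x b (grRep k x z (twist k x a (boundary k x a u)))

namespace IsBoundary

theorem unique {a b : Free k FS} {z w w' : (grDualBase k).obj a ⟶ (grDualBase k).obj b}
    (h : IsBoundary z w) (h' : IsBoundary z w') : w = w' :=
  eq_of_grRep fun x u => (h x u).trans (h' x u).symm

theorem zero {a b : Free k FS} :
    IsBoundary (0 : (grDualBase k).obj a ⟶ (grDualBase k).obj b) 0 := fun x u => by
  simp only [map_zero, LinearMap.zero_apply, sub_zero]

/-- The sign of the commutator is carried by the twist and not by an exponent, so the condition is
linear also in inhomogeneous morphisms. -/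
theorem add {a b : Free k FS} {z z' w w' : (grDualBase k).obj a ⟶ (grDualBase k).obj b}
    (h : IsBoundary z w) (h' : IsBoundary z' w') : IsBoundary (z + z') (w + w') := fun x u => by
  simp only [map_add, LinearMap.add_apply, h x u, h' x u]
  abel

theorem smul (r : k) {a b : Free k FS} {z w : (grDualBase k).obj a ⟶ (grDualBase k).obj b}
    (h : IsBoundary z w) : IsBoundary (r • z) (r • w) := fun x u => by
  simp only [map_smul, LinearMap.smul_apply, h x u, smul_sub]

/-- The graded commutator with the boundary is a derivation. Conjugation by the twist is the sign
`(-1)^n` on a factor of degree `n`. -/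
theorem comp {n : ℕ} {a b c : Free k FS} {y y' : (grDualBase k).obj a ⟶ (grDualBase k).obj b}
    {z z' : (grDualBase k).obj b ⟶ (grDualBase k).obj c} (hz : z ∈ grDualDegree k n _ _)
    (h : IsBoundary y y') (h' : IsBoundary z z') :
    IsBoundary (y ≫ z) (y ≫ z' + (-1 : k) ^ n • (y' ≫ z)) := fun x u => by
  have h1 : twist k x c (grRep k x z (grRep k x y (twist k x a (boundary k x a u)))) =
      (-1 : k) ^ n • grRep k x z (twist k x b (grRep k x y (twist k x a (boundary k x a u)))) := by
    rw [← twist_grRep_twist hz, twist_twist]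
  rw [map_add, LinearMap.add_apply, map_smul, LinearMap.smul_apply, grRep_comp, grRep_comp,
    grRep_comp, grRep_comp, h', h, h1, twist_grRep_twist hz, map_sub, smul_sub]
  abel

/-- In the iterated commutator the outer terms contain the square of the boundary, and the mixed
terms cancel because the boundary anticommutes with the twist. -/
theorem square {a b : Free k FS} {z w : (grDualBase k).obj a ⟶ (grDualBase k).obj b}
    (h : IsBoundary z w) : IsBoundary w 0 := fun x u => by
  rw [h, h, map_zero, LinearMap.zero_apply, map_sub, boundary_boundary, boundary_twist,
    boundary_twist, boundary_boundary, map_zero, neg_zero, map_zero, map_zero, map_zero, sub_zero,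
    zero_sub, neg_neg, sub_self]

/-- At level `m` the commutator is `ε(r u D) - r ε(u D)` with `u = u_{m+1}` and `D = D_m`, which is
the defect of `r` evaluated at `u D`. -/
theorem base {a b : Free k FS} (r : a ⟶ b) :
    IsBoundary ((grDualBase k).map r) (grDualGen k (augDefect k a b r)) := fun x u => by
  rw [twist_grRep_twist (QuadCat.base_mem_degree r), pow_zero, one_smul]
  funext m
  rw [Pi.sub_apply, grRep_gen, ev_augDefect, filtAll_altFilt, grRep_base, boundary_apply,
    boundary_apply, grRep_base, inclFS_comp, Category.assoc]

end IsBoundary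

end FinKoszul

end

noncomputable section

namespace FinKoszul

universe u w

variable {k : Type u} [CommRing k]

/-! ## The differential -/

variable (k) in
/-- The alternating sum of the chain as an element of `G_1 k FA`. -/
def altUnit (x m : ℕ) : (filtBimod k 1).X (spts k (x + m)) (spts k (x + (m + 1))) :=
  injToFilt k (pts k (x + m)) (pts k (x + m + 1)) ((injChain k x).D m)

theorem filtAll_altUnit (x m : ℕ) :
    filtAll k 1 (spts k (x + m)) (spts k (x + (m + 1))) (altUnit k x m) = altMap k x m := rfl

theorem grClass_altUnit (x m : ℕ) :
    grClass k 1 (spts k (x + m)) (spts k (x + (m + 1))) (altUnit k x m) =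
      injToGr k (pts k (x + m)) (pts k (x + m + 1)) ((injChain k x).D m) := rfl

/-- The representative of a class in the kernel of the augmentation. -/
theorem exists_sub_augS {x a : Free k FS} (v : (filtBimod k 1).X x a) :
    ∃ v' : (filtBimod k 1).X x a, augS k x a (filtAll k 1 x a v') = 0 ∧
      grClass k 1 x a v' = grClass k 1 x a v ∧
      filtAll k 1 x a v' = filtAll k 1 x a v - inclFS k x a (augS k x a (filtAll k 1 x a v)) := by
  have h0 := inclFS_mem_filt (augS k x a (filtAll k 1 x a v))
  let v' : (filtBimod k 1).X x a := ⟨inclFS k x a (augS k x a (filtAll k 1 x a v)),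
    filt_mono k (by norm_num) _ _ h0⟩
  have h1 : filtAll k 1 x a (v - v') = filtAll k 1 x a v -
      inclFS k x a (augS k x a (filtAll k 1 x a v)) := map_sub (filtAll k 1 x a) v v'
  refine ⟨v - v', ?_, ?_, h1⟩
  · rw [h1, map_sub, augS_incl, sub_self]
  · rw [map_sub, grClass_eq_zero (v := v') h0, sub_zero]

section

attribute [local irreducible] grClass augS inclFS filtAll augDefect altFilt injToGr altMap grRep
  altUnit

/-- Condition (ii) is used for the single pair `v = u D_{m+1} - ε(u D_{m+1})` and `w = D_m`, both in
`ker ε`. Since `D_{m+1} D_m = 0` in `k FA`, the product is `-ε(u D_{m+1}) D_m`, which lies in `G_1`.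
The right side of (ii) then becomes the commutator of the boundary with a generator of degree one.
-/
theorem IsBoundary.gen {a c : Free k FS} {φ : (grBimod k 1).rightDual.X a c} {n : ℕ}
    {e : Fin n → Free k FS} {f : ∀ j, (grBimod k 1).rightDual.X (e j) c}
    {g : ∀ j, (grBimod k 1).rightDual.X a (e j)} (h : IsGenDefect φ f g) :
    IsBoundary (grDualGen k φ) (∑ j, grDualGen k (g j) ≫ grDualGen k (f j)) := fun x u => by
  rw [twist_grRep_twist (QuadCat.gen_mem_degree φ), pow_one, neg_smul, one_smul, sub_neg_eq_add]
  funext m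
  -- Subtracting its augmentation moves `u D_{m+1}` into `ker ε` without changing the class in
  -- `gr_1`, hence without changing what generators do to it.
  obtain ⟨v, hv, hcl, hval⟩ := exists_sub_augS (altFilt k x (m + 1) (u (m + 2)))
  rw [filtAll_altFilt, ← boundary_apply] at hval
  have hs : filtAll k 1 (spts k (x + m)) a (-altFilt k x m (boundary k x a u (m + 1))) =
      altMap k x m ≫ filtAll k 1 (spts k (x + (m + 1))) a v := by
    have h0 : altMap k x m ≫ altMap k x (m + 1) ≫ inclFS k (spts k (x + (m + 2))) a (u (m + 2)) =
        0 := (Category.assoc ..).symm.trans ((congrArg (· ≫ inclFS k (spts k (x + (m + 2))) a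
          (u (m + 2))) (altMap_comp x m)).trans Limits.zero_comp)
    refine (map_neg _ _).trans ?_
    rw [filtAll_altFilt, hval]
    refine Eq.trans ?_ (Preadditive.comp_sub ..).symm
    exact (zero_sub _).symm.trans (congrArg (· - altMap k x m ≫
      inclFS k (spts k (x + (m + 1))) a (boundary k x a u (m + 1))) h0.symm)
  have key := h (spts k (x + m)) 1 (fun _ => spts k (x + (m + 1))) (fun _ => v)
    (fun _ => altUnit k x m) (-altFilt k x m (boundary k x a u (m + 1))) (fun _ => hv)
    (fun _ => (congrArg (augS k (spts k (x + m)) (spts k (x + (m + 1))))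
      (filtAll_altUnit x m)).trans (augS_altMap x m))
    (by rw [Fin.sum_univ_one, filtAll_altUnit]; exact hs)
  rw [Fin.sum_univ_one, Fin.sum_univ_one, filtAll_altUnit, grClass_altUnit, hcl, map_neg, map_neg,
    sub_neg_eq_add] at key
  rw [Pi.add_apply, boundary_apply, grRep_gen, grRep_gen]
  refine Eq.trans ?_ key
  rw [map_sum, LinearMap.sum_apply, Finset.sum_apply]
  exact Finset.sum_congr rfl fun j _ => grRep_gen_comp_gen _ _ u m

/-- The elements for morphisms of `k FS` and for generators are known, and the Leibniz formula
provides those for composites. Homogeneity is carried along because that formula needs the degree of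
the second factor. -/
theorem exists_isBoundary_of_mem {n : ℕ} {a b : Free k FS}
    {z : (grDualBase k).obj a ⟶ (grDualBase k).obj b} (hz : z ∈ grDualDegree k n _ _) :
    ∃ w ∈ grDualDegree k (n + 1) ((grDualBase k).obj a) ((grDualBase k).obj b),
      IsBoundary z w := by
  refine (QuadCat.mem_degree_induction (P := fun {a b} n z => z ∈ grDualDegree k n _ _ ∧
    ∃ w ∈ grDualDegree k (n + 1) ((grDualBase k).obj a) ((grDualBase k).obj b), IsBoundary z w)
    (fun f => ?_) (fun {a b} φ => ?_) (fun {a b n} => ?_) (fun y z hy hz => ?_) (fun r y hy => ?_)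
    (fun {_ _ _ m n} y z hy hz => ?_) hz).2
  · exact ⟨QuadCat.base_mem_degree f, _, QuadCat.gen_mem_degree _, IsBoundary.base f⟩
  · obtain ⟨n, rfl⟩ := exists_eq_spts a
    obtain ⟨n, e, i, g, h⟩ := exists_isGenDefect φ
    exact ⟨QuadCat.gen_mem_degree φ, _, sum_mem fun j _ => QuadCat.comp_mem_degree
      (QuadCat.gen_mem_degree _) (QuadCat.gen_mem_degree _), IsBoundary.gen h⟩
  · exact ⟨zero_mem _, 0, zero_mem _, IsBoundary.zero⟩
  · obtain ⟨hy, y', hy', h⟩ := hy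
    obtain ⟨hz, z', hz', h'⟩ := hz
    exact ⟨add_mem hy hz, _, add_mem hy' hz', h.add h'⟩
  · obtain ⟨hy, y', hy', h⟩ := hy
    exact ⟨Submodule.smul_mem _ r hy, _, Submodule.smul_mem _ r hy', h.smul r⟩
  · obtain ⟨hy, y', hy', h⟩ := hy
    obtain ⟨hz, z', hz', h'⟩ := hz
    refine ⟨QuadCat.comp_mem_degree hy hz, _, add_mem ?_ (Submodule.smul_mem _ _ ?_),
      IsBoundary.comp hz h h'⟩
    · have := QuadCat.comp_mem_degree hy hz'
      rwa [← add_assoc] at this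
    · have := QuadCat.comp_mem_degree hy' hz
      rwa [add_right_comm] at this

theorem exists_isBoundary {a b : Free k FS} (z : (grDualBase k).obj a ⟶ (grDualBase k).obj b) :
    ∃ w, IsBoundary z w := by
  refine QuadCat.degree_induction (P := fun z => ∃ w, IsBoundary z w)
    ⟨0, IsBoundary.zero⟩ ?_ (fun n z hz => ?_) z
  · rintro y z ⟨y', hy⟩ ⟨z', hz⟩
    exact ⟨_, hy.add hz⟩
  · obtain ⟨w, -, h⟩ := exists_isBoundary_of_mem hz
    exact ⟨w, h⟩

variable (k) in
/-- The differential of `(gr k FA)^⊥`. -/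
def diff (a b : GrDual k) : (a ⟶ b) →ₗ[k] (a ⟶ b) where
  toFun z := (exists_isBoundary (a := a.obj) (b := b.obj) z).choose
  map_add' y z := IsBoundary.unique (a := a.obj) (b := b.obj)
    (exists_isBoundary (a := a.obj) (b := b.obj) (y + z)).choose_spec
    (IsBoundary.add (exists_isBoundary (a := a.obj) (b := b.obj) y).choose_spec
      (exists_isBoundary (a := a.obj) (b := b.obj) z).choose_spec)
  map_smul' r z := IsBoundary.unique (a := a.obj) (b := b.obj)
    (exists_isBoundary (a := a.obj) (b := b.obj) (r • z)).choose_spec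
    (IsBoundary.smul r (exists_isBoundary (a := a.obj) (b := b.obj) z).choose_spec)

theorem isBoundary_diff {a b : Free k FS} (z : (grDualBase k).obj a ⟶ (grDualBase k).obj b) :
    IsBoundary z (diff k ((grDualBase k).obj a) ((grDualBase k).obj b) z) :=
  (exists_isBoundary z).choose_spec

theorem diff_eq {a b : Free k FS} {z w : (grDualBase k).obj a ⟶ (grDualBase k).obj b}
    (h : IsBoundary z w) : diff k ((grDualBase k).obj a) ((grDualBase k).obj b) z = w :=
  (isBoundary_diff z).unique h

/-- Each property holds for commutators and passes to `d` because a morphism is determined by its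
action on families. -/
theorem diff_isDG : IsDGDifferential (grDualDegree k) (diff k) where
  degree {a b n} f hf := by
    obtain ⟨w, hw, h⟩ := exists_isBoundary_of_mem (a := a.obj) (b := b.obj) hf
    have h1 : diff k a b f = w := diff_eq (a := a.obj) (b := b.obj) h
    rw [h1]
    exact hw
  square {a b} f := diff_eq (a := a.obj) (b := b.obj)
    (isBoundary_diff (a := a.obj) (b := b.obj) f).square
  leibniz {a b c n} f g hg := diff_eq (a := a.obj) (b := c.obj)
    (IsBoundary.comp (a := a.obj) (b := b.obj) (c := c.obj) hg
      (isBoundary_diff (a := a.obj) (b := b.obj) f) (isBoundary_diff (a := b.obj) (b := c.obj) g))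

end

theorem diff_isDual : IsDualDifferential k (diff k) where
  on_base {a b} r := ⟨augDefect k a b r, diff_eq (IsBoundary.base r),
    fun x v hv => ev_augDefect_of_aug_eq_zero r v hv⟩
  on_gen {a c} φ := by
    obtain ⟨n, rfl⟩ := exists_eq_spts a
    obtain ⟨n, e, i, g, h⟩ := exists_isGenDefect φ
    exact ⟨n, _, _, g, diff_eq (IsBoundary.gen h), h⟩

/-- The differential dual to the augmentation is unique. -/
theorem eq_diff {d : ∀ a b : GrDual k, (a ⟶ b) →ₗ[k] (a ⟶ b)}
    (hd : IsDGDifferential (grDualDegree k) d) (hd' : IsDualDifferential k d) : d = diff k := by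
  -- The functionals in (ii) are not unique, but any choice acts on families as the same commutator.
  -- So `d` acts as the commutator on generators, and the Leibniz rule extends this to all
  -- homogeneous morphisms.
  have hmem : ∀ {n : ℕ} {a b : Free k FS} {z : (grDualBase k).obj a ⟶ (grDualBase k).obj b},
      z ∈ grDualDegree k n _ _ → IsBoundary z (d _ _ z) := fun {n a b z} hz => by
    refine (QuadCat.mem_degree_induction (P := fun {a b} n z => z ∈ grDualDegree k n _ _ ∧
      IsBoundary z (d _ _ z))
      (fun f => ⟨QuadCat.base_mem_degree f, ?_⟩) (fun {a b} φ => ⟨QuadCat.gen_mem_degree φ, ?_⟩)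
      (fun {a b n} => ⟨zero_mem _, ?_⟩) (fun y z hy hz => ⟨add_mem hy.1 hz.1, ?_⟩)
      (fun r y hy => ⟨Submodule.smul_mem _ r hy.1, ?_⟩)
      (fun {_ _ _ m n} y z hy hz => ⟨QuadCat.comp_mem_degree hy.1 hz.1, ?_⟩) hz).2
    · obtain ⟨χ, h1, h2⟩ := hd'.on_base f
      rw [h1, eq_augDefect f h2]
      exact IsBoundary.base f
    · obtain ⟨n, e, f, g, h1, h2⟩ := hd'.on_gen φ
      rw [h1]
      exact IsBoundary.gen h2
    · rw [map_zero]
      exact IsBoundary.zero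
    · rw [map_add]
      exact hy.2.add hz.2
    · rw [map_smul]
      exact hy.2.smul r
    · rw [hd.leibniz y z hz.1]
      exact IsBoundary.comp hz.1 hy.2 hz.2
  funext a b
  refine LinearMap.ext fun z => ?_
  refine QuadCat.degree_induction (P := fun z => d a b z = diff k a b z) ?_ ?_ ?_ z
  · rw [map_zero, map_zero]
  · intro y z hy hz
    rw [map_add, map_add, hy, hz]
  · intro n z hz
    exact (diff_eq (a := a.obj) (b := b.obj) (hmem hz)).symm

/-! ## The Koszul differential -/

section

attribute [local irreducible] grClass augS inclFS filtAll augDefect injToGr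

/-- `d` vanishes on the image of `j`. Bijections have no defect, and an extended functional takes
values in `k FB` on injections, so the factors `f_j` in its differential are defects of elements of
`k FB`, hence zero. The Leibniz rule covers products. -/
theorem isBoundary_dualMap {a b : Free k FB} (ρ : (injDualBase k).obj a ⟶ (injDualBase k).obj b) :
    IsBoundary (dualMap k a b ρ) 0 := by
  have hmem : ∀ {n : ℕ} {a b : Free k FB} {ρ : (injDualBase k).obj a ⟶ (injDualBase k).obj b},
      ρ ∈ injDualDegree k n _ _ → IsBoundary (dualMap k a b ρ) 0 := fun {n a b ρ} hρ => by
    refine (QuadCat.mem_degree_induction (P := fun {a b} n ρ => ρ ∈ injDualDegree k n _ _ ∧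
      IsBoundary (dualMap k a b ρ) 0)
      (fun f => ⟨QuadCat.base_mem_degree f, ?_⟩) (fun {a b} φ => ⟨QuadCat.gen_mem_degree φ, ?_⟩)
      (fun {a b n} => ⟨zero_mem _, ?_⟩) (fun y z hy hz => ⟨add_mem hy.1 hz.1, ?_⟩)
      (fun r y hy => ⟨Submodule.smul_mem _ r hy.1, ?_⟩)
      (fun {_ _ _ m n} y z hy hz => ⟨QuadCat.comp_mem_degree hy.1 hz.1, ?_⟩) hρ).2
    · rw [dualMap_base]
      have h := IsBoundary.base ((bijSurj k).map f)
      rwa [augDefect_bijSurj, map_zero] at h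
    · rw [dualMap_gen]
      obtain ⟨n, e, i, g, h⟩ := exists_isGenDefect (grExt k a b φ)
      have h1 := IsBoundary.gen h
      rwa [Finset.sum_eq_zero fun j _ => by
        rw [ev_grExt, augDefect_bijSurj, map_zero, Limits.comp_zero]] at h1
    · rw [map_zero]
      exact IsBoundary.zero
    · rw [map_add]
      have h := hy.2.add hz.2
      rwa [add_zero] at h
    · rw [map_smul]
      have h := hy.2.smul r
      rwa [smul_zero] at h
    · rw [dualMap_comp]
      have h := IsBoundary.comp (dualMap_mem_degree hz.1) hy.2 hz.2
      rwa [Limits.comp_zero, Limits.zero_comp, smul_zero, add_zero] at h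
  refine QuadCat.degree_induction (P := fun ρ => IsBoundary (dualMap k a b ρ) 0) ?_ ?_
    (fun n ρ hρ => hmem hρ) ρ
  · rw [map_zero]
    exact IsBoundary.zero
  · intro y z hy hz
    rw [map_add]
    have h := hy.add hz
    rwa [add_zero] at h

/-- By the Leibniz rule only the factor in `k FS` is differentiated, and no sign appears because
that factor has degree zero. -/
theorem diff_dualMap_comp_base {a d e : Free k FB}
    (ρ : (injDualBase k).obj a ⟶ (injDualBase k).obj d)
    (s : (bijSurj k).obj d ⟶ (bijSurj k).obj e) :
    diff k ((grDualBase k).obj ((bijSurj k).obj a)) ((grDualBase k).obj ((bijSurj k).obj e))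
      (dualMap k a d ρ ≫ (grDualBase k).map s) =
      dualMap k a d ρ ≫ grDualGen k (augDefect k _ _ s) := by
  have h := IsBoundary.comp (QuadCat.base_mem_degree s) (isBoundary_dualMap ρ) (IsBoundary.base s)
  rw [Limits.zero_comp, smul_zero, add_zero] at h
  exact diff_eq h

/-- The expansion of a functional on `gr_1` along a dual basis of `k FI^[1]`. -/
theorem eq_sum_grExt {d : Free k FB} {c : Free k FS} {n : ℕ} {e : Fin n → Free k FB}
    {v : ∀ j, (injPart k 1).X (e j) d} {φ : ∀ j, (injPart k 1).rightDual.X d (e j)}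
    (h : IsDualBasis v φ) (χ : (grBimod k 1).rightDual.X ((bijSurj k).obj d) c) :
    χ = ∑ j, (grBimod k 1).rightDual.lact ((bijSurj k).obj d) (b := (bijSurj k).obj (e j)) (b' := c)
      (Bimod.ev χ (injToGr k (e j) d (v j))) (grExt k d (e j) (φ j)) := by
  refine grDual_ext fun x i => ?_
  rw [map_sum, LinearMap.sum_apply]
  conv_lhs => rw [← h x i]
  rw [map_sum, map_sum]
  refine Finset.sum_congr rfl fun j _ => ?_
  refine (congrArg (Bimod.ev χ) (injToGr_ract _ (v j))).trans ?_
  refine (χ.2 _ _).trans ?_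
  exact congrArg (· ≫ Bimod.ev χ (injToGr k (e j) d (v j))) (ev_grExt (φ j) x i).symm

end

/-- The action of `k FI^[1]` on `k FS` is given by the augmentation defect. -/
theorem surjMod_ract_eq {x d e : Free k FB} (i : (injPart k 1).X x d)
    (s : (bijSurj k).obj d ⟶ (bijSurj k).obj e) :
    (surjMod k).ract (a := (bijInj k).obj d) (a' := (bijInj k).obj x) e i.1 s =
      Bimod.ev (augDefect k _ _ s) (injToGr k x d i) :=
  (ev_augDefect_of_aug_eq_zero s (injToFilt k x d i) (rightAug_injIncl i)).symm

/-- `ds` is a functional on `gr_1`. Expanded along any dual basis of `k FI^[1]`, it has as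
coefficients its values on the `v_j`, multiplying the extensions of the `φ_j`; this is the Koszul
formula, whatever the basis. -/
theorem diff_koszul {a d e : Free k FB} {n : ℕ} {c : Fin n → Free k FB}
    {v : ∀ j, (injPart k 1).X (c j) d} {φ : ∀ j, (injPart k 1).rightDual.X d (c j)}
    (h : IsDualBasis v φ) (s : (bijSurj k).obj d ⟶ (bijSurj k).obj e)
    (ρ : (injDualBase k).obj a ⟶ (injDualBase k).obj d) :
    diff k ((grDualBase k).obj ((bijSurj k).obj a)) ((grDualBase k).obj ((bijSurj k).obj e))
      (koszulMap k a e (koszulMul k s ρ)) = koszulMap k a e (∑ j, koszulMul k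
        (Bimod.ev (augDefect k _ _ s) (injToGr k (c j) d (v j))) (ρ ≫ injDualGen k (φ j))) := by
  rw [koszulMap_mul, diff_dualMap_comp_base, map_sum]
  conv_lhs => rw [eq_sum_grExt h (augDefect k _ _ s)]
  rw [map_sum, Preadditive.comp_sum]
  refine Finset.sum_congr rfl fun j _ => ?_
  rw [koszulMap_mul, dualMap_comp, dualMap_gen, Category.assoc]
  exact congrArg (dualMap k a d ρ ≫ ·) (QuadCat.gen_comp_base _ _).symm

variable (k) in
/-- The differential of `(gr k FA)^⊥`, transported to `k FS ⊗_FB k FI^⊥`. -/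
def koszulDiff (a e : Free k FB) : ((surjBij k).tensor (injDualBimod k)).X a e →ₗ[k]
    ((surjBij k).tensor (injDualBimod k)).X a e :=
  ((koszulIso k).equiv a e).symm.toLinearMap ∘ₗ
    diff k ((grDualBase k).obj ((bijSurj k).obj a)) ((grDualBase k).obj ((bijSurj k).obj e)) ∘ₗ
      ((koszulIso k).equiv a e).toLinearMap

theorem equiv_koszulDiff {a e : Free k FB} (t : ((surjBij k).tensor (injDualBimod k)).X a e) :
    (koszulIso k).equiv a e (koszulDiff k a e t) =
      diff k ((grDualBase k).obj ((bijSurj k).obj a)) ((grDualBase k).obj ((bijSurj k).obj e))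
        ((koszulIso k).equiv a e t) :=
  ((koszulIso k).equiv a e).apply_symm_apply _

theorem koszulDiff_isKoszul : IsKoszulDifferential (surjMod k) (koszulDiff k) := by
  refine fun d => ⟨exists_isDualBasis d, fun n c v φ h a e s ρ => ?_⟩
  refine ((koszulIso k).equiv a e).injective ((equiv_koszulDiff _).trans ?_)
  refine (diff_koszul h s ρ).trans (congrArg (koszulMap k a e) ?_)
  exact Finset.sum_congr rfl fun j _ => congrArg (fun r => koszulMul k r (ρ ≫ injDualGen k (φ j)))
    (surjMod_ract_eq (v j) s).symm

end FinKoszul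

end

/-! ### Assembly of the proposition -/

theorem mainTheorem6 (k : Type*) [Field k] :
    -- `(gr^G k FA)^⊥` is graded, and it is a DG category with a unique dual differential
    FinKoszul.IsGrading (k := k) (FinKoszul.grDualDegree k) ∧
    ∃ d : ∀ a b : FinKoszul.GrDual k, (a ⟶ b) →ₗ[k] (a ⟶ b),
      FinKoszul.IsDGDifferential (FinKoszul.grDualDegree k) d ∧
      FinKoszul.IsDualDifferential k d ∧
      (∀ d' : ∀ a b : FinKoszul.GrDual k, (a ⟶ b) →ₗ[k] (a ⟶ b),
        FinKoszul.IsDGDifferential (FinKoszul.grDualDegree k) d' →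
        FinKoszul.IsDualDifferential k d' → d' = d) ∧
      -- the canonical `k`-linear functor `j : k FI^⊥ → (gr^G k FA)^⊥`
      ∃ j : ∀ a b : Free k FinKoszul.FB,
          ((FinKoszul.injDualBase k).obj a ⟶ (FinKoszul.injDualBase k).obj b) →ₗ[k]
            ((FinKoszul.bijSurj k ⋙ FinKoszul.grDualBase k).obj a ⟶
              (FinKoszul.bijSurj k ⋙ FinKoszul.grDualBase k).obj b),
        (∀ (a b c : Free k FinKoszul.FB)
          (x : (FinKoszul.injDualBase k).obj a ⟶ (FinKoszul.injDualBase k).obj b)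
          (y : (FinKoszul.injDualBase k).obj b ⟶ (FinKoszul.injDualBase k).obj c),
          j a c (x ≫ y) = j a b x ≫ j b c y) ∧
        (∀ (a b : Free k FinKoszul.FB) (r : a ⟶ b),
          j a b ((FinKoszul.injDualBase k).map r) =
            (FinKoszul.bijSurj k ⋙ FinKoszul.grDualBase k).map r) ∧
        (∀ (a b : Free k FinKoszul.FB) (φ : (FinKoszul.injPart k 1).rightDual.X a b),
          ∃ χ : (FinKoszul.grBimod k 1).rightDual.X
              ((FinKoszul.bijSurj k).obj a) ((FinKoszul.bijSurj k).obj b),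
            j a b (FinKoszul.injDualGen k φ) = FinKoszul.grDualGen k χ ∧
            ∀ (x : Free k FinKoszul.FB) (i : (FinKoszul.injPart k 1).X x a),
              FinKoszul.Bimod.ev χ (FinKoszul.injToGr k x a i) =
                (FinKoszul.bijSurj k).map (FinKoszul.Bimod.ev φ i)) ∧
        -- the isomorphism `k FS ⊗_FB k FI^⊥ ≅ (gr^G k FA)^⊥`, `s ⊗ ρ ↦ s j(ρ)`
        ∃ Φ : FinKoszul.Bimod.Iso
            ((FinKoszul.toBij (FinKoszul.surjMod k)).tensor (FinKoszul.injDualBimod k))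
            (FinKoszul.grDualBimod k),
          (∀ (a b e : Free k FinKoszul.FB) (s : (FinKoszul.bijSurj k).obj b ⟶
              (FinKoszul.bijSurj k).obj e) (ρ : (FinKoszul.injDualBimod k).X a b),
            Φ.equiv a e (FinKoszul.Bimod.tmul (FinKoszul.toBij (FinKoszul.surjMod k))
                (FinKoszul.injDualBimod k) s ρ) =
              j a b ρ ≫ (FinKoszul.grDualBase k).map s) ∧
          (∀ (n : ℕ) (a e : Free k FinKoszul.FB),
            Submodule.map (Φ.equiv a e).toLinearMap (Submodule.span k
              {t | ∃ (b : Free k FinKoszul.FB)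
                (s : (FinKoszul.toBij (FinKoszul.surjMod k)).X b e)
                (ρ : (FinKoszul.injDualBimod k).X a b),
                ρ ∈ FinKoszul.injDualDegree k n _ _ ∧
                t = FinKoszul.Bimod.tmul (FinKoszul.toBij (FinKoszul.surjMod k))
                  (FinKoszul.injDualBimod k) s ρ}) =
              FinKoszul.grDualDegree k n _ _) ∧
          -- the differential is the Koszul complex differential
          ∃ κ : ∀ a e : Free k FinKoszul.FB,
              ((FinKoszul.toBij (FinKoszul.surjMod k)).tensor (FinKoszul.injDualBimod k)).X a e
                →ₗ[k]
              ((FinKoszul.toBij (FinKoszul.surjMod k)).tensor (FinKoszul.injDualBimod k)).X a e,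
            FinKoszul.IsKoszulDifferential (FinKoszul.surjMod k) κ ∧
            ∀ (a e : Free k FinKoszul.FB)
              (t : ((FinKoszul.toBij (FinKoszul.surjMod k)).tensor
                (FinKoszul.injDualBimod k)).X a e),
              d _ _ (Φ.equiv a e t) = Φ.equiv a e (κ a e t) := by
  refine ⟨FinKoszul.gr_isGrading k, FinKoszul.diff k, FinKoszul.diff_isDG, FinKoszul.diff_isDual,
    fun d' h h' => FinKoszul.eq_diff h h', FinKoszul.dualMap k,
    fun a b c x y => FinKoszul.dualMap_comp x y, fun a b r => FinKoszul.dualMap_base r,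
    fun a b φ => ⟨FinKoszul.grExt k a b φ, FinKoszul.dualMap_gen φ, FinKoszul.ev_grExt φ⟩,
    FinKoszul.koszulIso k, fun a b e s ρ => FinKoszul.koszulMap_mul s ρ,
    fun n a e => FinKoszul.map_koszulDegree n a e, FinKoszul.koszulDiff k,
    FinKoszul.koszulDiff_isKoszul, fun a e t => (FinKoszul.equiv_koszulDiff t).symm⟩
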